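/- Let $(M,g)$ be a Lorentzian manifold with a smooth timelike Killing vector field $\mathcal Y$. (No further causality or completeness assumption is needed; the main example is a globally hyperbolic stationary spacetime with $\mathcal Y$ complete.) A closed geodesic is a (possibly constant) smooth $1$-periodic curve $\gamma:\mathbb R\to M$ with $\frac{D}{dt}\gamma'=0$; its $N$-th iterate is $\gamma^{(N)}(t)=\gamma(Nt)$, $N\ge1$. For a closed geodesic $\gamma$, let $T_\gamma\mathcal N$ be the space of $1$-periodic vector fields $V$ along $\gamma$ of Sobolev class $H^1$ for which $g(\frac{D}{dt}V,\mathcal Y)-g(V,\frac{D}{dt}\mathcal Y)$ is a.e. constant on $[0,1]$; it is the tangent space at $\gamma$ of the manifold $\mathcal N$ of $H^1$ loops with $g(\dot\gamma,\mathcal Y)$ a.e. constant. Let $$I_\gamma(V,W)=\int_0^1 g\big(\tfrac{D}{dt}V,\tfrac{D}{dt}W\big)+g\big(R(\dot\gamma,V)\dot\gamma,W\big)\,dt$$ be the index form, i.e. the Hessian at $\gamma$ of $f(\gamma)=\frac12\int_0^1g(\dot\gamma,\dot\gamma)\,dt$ restricted to $\mathcal N$, where $R(X,Z)=[\nabla_X,\nabla_Z]-\nabla_{[X,Z]}$.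 The nullity $\mathrm n(\gamma)$ is the dimension of the kernel of $I_\gamma$ on $T_\gamma\mathcal N$. Write $\widetilde{\mathcal N}$ for the quotient of $\mathcal N$ by the flow of $\mathcal Y$, so that $T_{[\gamma]}\widetilde{\mathcal N}=T_\gamma\mathcal N/\mathbb R\,\mathcal Y|_\gamma$ with the Hessian of $f$ at $[\gamma]$ induced by $I_\gamma$, and let $\mathrm O(2)$ act on the parameter circle. The critical orbit $\mathrm O(2)[\gamma]$ is called nondegenerate if the kernel of the Hessian of $f$ at $[\gamma]$ is the tangent space of the orbit, i.e. if the kernel of $I_\gamma$ on $T_\gamma\mathcal N$ is spanned by $\gamma'$ and $\mathcal Y|_\gamma$ (when these fields are linearly independent, as they are for nonconstant $\gamma$ in the globally hyperbolic case, this means $\mathrm n(\gamma)=2$). Then for every closed geodesic $\gamma$: 1. There is a unique linear map $\mathfrak P_\gamma$ of $T_{\gamma(0)}M\oplus T_{\gamma(0)}M^*$ (the linearized Poincaré map) such that $\mathfrak P_\gamma\big(J(0),g\tfrac{D}{dt}J(0)\big)=\big(J(1),g\tfrac{D}{dt}J(1)\big)$ for all Jacobi fields $J$ along $\gamma$. Let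 $\mathfrak s(\mathfrak P_\gamma)\subset\mathbb C$ be its (complex) spectrum. For all $N\ge1$, $\mathrm O(2)[\gamma^{(N)}]$ is a nondegenerate critical orbit of $f$ in $\widetilde{\mathcal N}$ if and only if (a) $\mathrm O(2)[\gamma]$ is a nondegenerate critical orbit of $f$ in $\widetilde{\mathcal N}$, and (b) $\mathfrak s(\mathfrak P_\gamma)\setminus\{1\}$ contains no $N$-th root of unity. 2. There are positive integers $m_1,\dots,m_s$ with $s\le2^{\dim M}$ and, for each $j\in\{1,\dots,s\}$, a strictly increasing sequence $q_{j1}<q_{j2}<\cdots$ of positive integers such that the sets $N_j=\{m_jq_{ji}: i=1,2,\dots\}$ form a partition of $\mathbb N\setminus\{0\}$ and $$\mathrm n\big(\gamma^{(m_jq_{ji})}\big)=\mathrm n\big(\gamma^{(m_j)}\big)\qquad\text{for all } j \text{ and } i.$$ -/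

import Mathlib

open Set MeasureTheory Bundle
open scoped Manifold ContDiff TensorProduct

namespace StationaryLorentz

noncomputable section

variable {E : Type*} [NormedAddCommGroup E] [NormedSpace ℝ E]
  {M : Type*} [TopologicalSpace M] [ChartedSpace E M] [IsManifold 𝓘(ℝ, E) ∞ M]

/-! ## Lorentzian metrics and their Levi-Civita connection -/

variable (E M) in
/-- A smooth Lorentzian metric on `M`: a smooth field of symmetric bilinear forms on the tangent
spaces, of signature `(-, +, …, +)` (there is a timelike vector, and the form is positive definite
on its orthogonal complement). -/
structure LorentzMetric where
  inner (x : M) : TangentSpace 𝓘(ℝ, E) x →L[ℝ] TangentSpace 𝓘(ℝ, E) x →L[ℝ] ℝ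
  symm (x : M) (v w : TangentSpace 𝓘(ℝ, E) x) : inner x v w = inner x w v
  lorentzian (x : M) : ∃ v : TangentSpace 𝓘(ℝ, E) x, inner x v v < 0 ∧
    ∀ w : TangentSpace 𝓘(ℝ, E) x, w ≠ 0 → inner x v w = 0 → 0 < inner x w w
  contMDiff : ContMDiff 𝓘(ℝ, E) (𝓘(ℝ, E).prod 𝓘(ℝ, E →L[ℝ] E →L[ℝ] ℝ)) ∞
    (fun x ↦ TotalSpace.mk' (E →L[ℝ] E →L[ℝ] ℝ) x (inner x))

/-- Coordinates, in the preferred chart at `x₀`, of tangent vectors at `p` (meaningful for `p` in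
the domain of that chart). -/
def toCoord (x₀ p : M) : TangentSpace 𝓘(ℝ, E) p →L[ℝ] E :=
  (trivializationAt E (TangentSpace 𝓘(ℝ, E)) x₀).continuousLinearMapAt ℝ p

/-- The tangent vector at `p` with given coordinates in the preferred chart at `x₀`; inverse of
`toCoord x₀ p`. -/
def ofCoord (x₀ p : M) : E →L[ℝ] TangentSpace 𝓘(ℝ, E) p :=
  (trivializationAt E (TangentSpace 𝓘(ℝ, E)) x₀).symmL ℝ p

namespace LorentzMetric

variable (g : LorentzMetric E M)

/-- The matrix `(g_{ij}(y))` of the metric in the preferred chart at `x₀`, as a bilinear form on the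
model space `E`, as a function of the point `y` of the chart's image. -/
def chartForm (x₀ : M) (y : E) : E →L[ℝ] E →L[ℝ] ℝ :=
  let p : M := (extChartAt 𝓘(ℝ, E) x₀).symm y
  (ofCoord x₀ p).precomp ℝ ∘L g.inner p ∘L ofCoord x₀ p

/-- The Christoffel symbol `Γ_y(v, w)` in the preferred chart at `x₀`: the vector such that
`g_y(Γ_y(v, w), u) = ½ (∂_v g(w, u) + ∂_w g(v, u) - ∂_u g(v, w))` for all `u`. -/
def christoffel (x₀ : M) (y v w : E) : E :=
  (g.chartForm x₀ y).inverse ((1 / 2 : ℝ) • (fderiv ℝ (g.chartForm x₀) y v w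
    + fderiv ℝ (g.chartForm x₀) y w v - ((fderiv ℝ (g.chartForm x₀) y).flip v).flip w))

/-- `R(u, v) w = ∇_u ∇_v w - ∇_v ∇_u w - ∇_[u,v] w`, in coordinates. -/
def chartCurvature (x₀ : M) (y u v w : E) : E :=
  fderiv ℝ (fun z ↦ g.christoffel x₀ z v w) y u - fderiv ℝ (fun z ↦ g.christoffel x₀ z u w) y v
    + g.christoffel x₀ y u (g.christoffel x₀ y v w)
    - g.christoffel x₀ y v (g.christoffel x₀ y u w)

/-- The curvature tensor `R_x(u, v) w` of the Levi-Civita connection. -/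
def curvature (x : M) (u v w : TangentSpace 𝓘(ℝ, E) x) : TangentSpace 𝓘(ℝ, E) x :=
  ofCoord x x (g.chartCurvature x (extChartAt 𝓘(ℝ, E) x x)
    (toCoord x x u) (toCoord x x v) (toCoord x x w))

/-- The covariant derivative `∇_v X` at `x` of a vector field `X` on `M`. -/
def nabla (X : (x : M) → TangentSpace 𝓘(ℝ, E) x) (x : M) (v : TangentSpace 𝓘(ℝ, E) x) :
    TangentSpace 𝓘(ℝ, E) x :=
  ofCoord x x
    (fderiv ℝ (fun y ↦ toCoord x ((extChartAt 𝓘(ℝ, E) x).symm y)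
        (X ((extChartAt 𝓘(ℝ, E) x).symm y))) (extChartAt 𝓘(ℝ, E) x x) (toCoord x x v)
      + g.christoffel x (extChartAt 𝓘(ℝ, E) x x) (toCoord x x v) (toCoord x x (X x)))

/-- A timelike Killing vector field: smooth, timelike at every point, and with `∇Y` skew-symmetric,
i.e. the Lie derivative `L_Y g` vanishes. -/
structure IsTimelikeKilling (Y : (x : M) → TangentSpace 𝓘(ℝ, E) x) : Prop where
  contMDiff : ContMDiff 𝓘(ℝ, E) 𝓘(ℝ, E).tangent ∞
    (fun x ↦ (⟨x, Y x⟩ : TangentBundle 𝓘(ℝ, E) M))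
  timelike (x : M) : g.inner x (Y x) (Y x) < 0
  killing (x : M) (v w : TangentSpace 𝓘(ℝ, E) x) :
    g.inner x (g.nabla Y x v) w + g.inner x v (g.nabla Y x w) = 0

end LorentzMetric

/-! ## Vector fields along curves, geodesics, Jacobi fields -/

/-- (Not necessarily continuous) vector fields along a curve `γ`. -/
abbrev FieldAlong (γ : ℝ → M) : Type _ := (t : ℝ) → TangentSpace 𝓘(ℝ, E) (γ t)

/-- The velocity field `γ'`. -/
def velocity (γ : ℝ → M) : FieldAlong (E := E) γ :=
  fun t ↦ mfderiv 𝓘(ℝ, ℝ) 𝓘(ℝ, E) γ t (1 : ℝ)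

/-- The local representative, near time `t₀`, of a vector field along `γ` in the preferred chart
at `γ t₀`. -/
def localRep {γ : ℝ → M} (V : FieldAlong (E := E) γ) (t₀ s : ℝ) : E :=
  toCoord (γ t₀) (γ s) (V s)

/-- Smooth vector fields along `γ`. -/
def IsSmoothField {γ : ℝ → M} (V : FieldAlong (E := E) γ) : Prop :=
  ContMDiff 𝓘(ℝ, ℝ) 𝓘(ℝ, E).tangent ∞ (fun t ↦ (⟨γ t, V t⟩ : TangentBundle 𝓘(ℝ, E) M))

/-- `1`-periodic vector fields along a (`1`-periodic) curve `γ`. -/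
def IsPeriodicField {γ : ℝ → M} (V : FieldAlong (E := E) γ) : Prop :=
  ∀ t, (⟨γ (t + 1), V (t + 1)⟩ : TangentBundle 𝓘(ℝ, E) M) = ⟨γ t, V t⟩

/-- Vector fields of Sobolev class `H¹` along `γ`: in charts, they are absolutely continuous with
square integrable derivative. -/
def IsH1Field {γ : ℝ → M} (V : FieldAlong (E := E) γ) : Prop :=
  ∀ t₀ : ℝ, ∃ ε > 0, AbsolutelyContinuousOnInterval (localRep V t₀) (t₀ - ε) (t₀ + ε) ∧
    MemLp (deriv (localRep V t₀)) 2 (volume.restrict (Icc (t₀ - ε) (t₀ + ε)))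

/-- The `N`-th iterate `γ^(N)(t) = γ(N t)` of a `1`-periodic curve. -/
def iterate (γ : ℝ → M) (N : ℕ) : ℝ → M := fun t ↦ γ (N * t)

namespace LorentzMetric

variable (g : LorentzMetric E M)

/-- The covariant derivative `DV/dt` of a vector field `V` along `γ`, at the times `t` where `V` is
differentiable (for a field of class `H¹`: at almost every `t`). -/
def covDeriv {γ : ℝ → M} (V : FieldAlong (E := E) γ) : FieldAlong (E := E) γ := fun t ↦
  ofCoord (γ t) (γ t)
    (deriv (localRep V t) t
      + g.christoffel (γ t) (extChartAt 𝓘(ℝ, E) (γ t) (γ t))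
          (localRep (velocity γ) t t) (localRep V t t))

/-- Closed geodesics `[0, 1] → M`, identified with their `1`-periodic extensions to `ℝ`. -/
structure IsClosedGeodesic (γ : ℝ → M) : Prop where
  contMDiff : ContMDiff 𝓘(ℝ, ℝ) 𝓘(ℝ, E) ∞ γ
  periodic : Function.Periodic γ 1
  geodesic : ∀ t, g.covDeriv (velocity (E := E) γ) t = 0

/-- Jacobi fields along `γ`: `D²J/dt² = R(γ', J) γ'`. -/
structure IsJacobi {γ : ℝ → M} (J : FieldAlong (E := E) γ) : Prop where
  smooth : IsSmoothField J
  jacobi : ∀ t, g.covDeriv (g.covDeriv J) t =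
    g.curvature (γ t) (velocity γ t) (J t) (velocity γ t)

/-! ## The constrained variational problem -/

/-- The tangent space `T_γ ΛM` of the free loop space: the periodic vector fields of class `H¹`
along `γ`. -/
def loopTangent (γ : ℝ → M) : Set (FieldAlong (E := E) γ) :=
  {V | IsPeriodicField V ∧ IsH1Field V}

/-- The tangent space at `γ` of the constraint manifold
`𝒩 = {γ ∈ ΛM | g(γ', Y) is a.e. constant}`: the fields `V ∈ T_γ ΛM` such that
`g(DV/dt, Y) - g(V, DY/dt)` is a.e. constant on `[0, 1]`. -/
def constraintTangent (Y : (x : M) → TangentSpace 𝓘(ℝ, E) x) (γ : ℝ → M) :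
    Set (FieldAlong (E := E) γ) :=
  {V | V ∈ loopTangent γ ∧ ∃ C : ℝ, ∀ᵐ t : ℝ, t ∈ Icc (0 : ℝ) 1 →
    g.inner (γ t) (g.covDeriv V t) (Y (γ t))
      - g.inner (γ t) (V t) (g.covDeriv (fun s ↦ Y (γ s)) t) = C}

/-- The index form `I_γ(V, W) = ∫₀¹ g(DV/dt, DW/dt) + g(R(γ', V) γ', W) dt`, i.e. (on
`T_γ ΛM` or `T_γ 𝒩`, at a closed geodesic `γ`) the Hessian of the action functional
`f(γ) = ½ ∫₀¹ g(γ', γ') dt`. -/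
def indexForm {γ : ℝ → M} (V W : FieldAlong (E := E) γ) : ℝ :=
  ∫ t in (0 : ℝ)..1, (g.inner (γ t) (g.covDeriv V t) (g.covDeriv W t)
    + g.inner (γ t) (g.curvature (γ t) (velocity γ t) (V t) (velocity γ t)) (W t))

/-- The kernel of the restriction of `I_γ` to `T_γ 𝒩 × T_γ 𝒩`. -/
def hessianKernel (Y : (x : M) → TangentSpace 𝓘(ℝ, E) x) (γ : ℝ → M) :
    Set (FieldAlong (E := E) γ) :=
  {V | V ∈ g.constraintTangent Y γ ∧ ∀ W ∈ g.constraintTangent Y γ, g.indexForm V W = 0}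

/-- The nullity `n(γ)`: the dimension of the kernel of `I_γ` on `T_γ 𝒩`. (This kernel is a vector
space; the span only serves to make it one by construction.) -/
def nullity (Y : (x : M) → TangentSpace 𝓘(ℝ, E) x) (γ : ℝ → M) : Cardinal :=
  Module.rank ℝ (Submodule.span ℝ (g.hessianKernel Y γ))

/-- `O(2)[γ]` is a nondegenerate critical orbit of `f` in `𝒩/ℝ`, the quotient of `𝒩` by the flow of
`Y`: the point `[γ]` is critical, i.e. `γ` is a closed geodesic, and the kernel of the Hessian of
`f` at `[γ]` is the tangent space of the orbit `O(2)[γ]`.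

Here `T_[γ](𝒩/ℝ) = T_γ 𝒩 / ℝ (Y ∘ γ)`, the Hessian is the form induced by `I_γ`, and the tangent
space of the orbit is spanned by the class of `γ'`; so the condition says that the kernel of `I_γ`
on `T_γ 𝒩`, which always contains `γ'` and `Y ∘ γ`, is spanned by these two fields. As `O(2)`
and the flow act by isometries that preserve `f`, one point of the orbit decides. -/
structure IsNondegenerateCriticalOrbit (Y : (x : M) → TangentSpace 𝓘(ℝ, E) x) (γ : ℝ → M) :
    Prop where
  isClosedGeodesic : g.IsClosedGeodesic γ
  kernel_eq : g.hessianKernel Y γ =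
    (Submodule.span ℝ {velocity γ, fun t ↦ Y (γ t)} : Submodule ℝ (FieldAlong (E := E) γ))

/-! ## The linearized Poincaré map -/

/-- The space `T_p M ⊕ T_p M*`. -/
abbrev PhaseSpace (p : M) : Type _ :=
  TangentSpace 𝓘(ℝ, E) p × (TangentSpace 𝓘(ℝ, E) p →L[ℝ] ℝ)

/-- `P` is the linearized Poincaré map of the closed geodesic `γ`: for all Jacobi fields `J`,
`P (J(0), g DJ/dt(0)) = (J(1), g DJ/dt(1))`. The vectors `u`, `w` are `J(1)`, `DJ/dt(1)`, seen as
vectors at `γ 0 = γ 1`. -/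
def IsPoincareMap (γ : ℝ → M)
    (P : PhaseSpace (E := E) (γ 0) →ₗ[ℝ] PhaseSpace (E := E) (γ 0)) : Prop :=
  ∀ J : FieldAlong (E := E) γ, g.IsJacobi J → ∀ u w : TangentSpace 𝓘(ℝ, E) (γ 0),
    (⟨γ 0, u⟩ : TangentBundle 𝓘(ℝ, E) M) = ⟨γ 1, J 1⟩ →
    (⟨γ 0, w⟩ : TangentBundle 𝓘(ℝ, E) M) = ⟨γ 1, g.covDeriv J 1⟩ →
    P (J 0, g.inner (γ 0) (g.covDeriv J 0)) = (u, g.inner (γ 0) w)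

end LorentzMetric

/-- The (complex) spectrum of an endomorphism of a real vector space. -/
def complexSpectrum {V : Type*} [AddCommGroup V] [Module ℝ V] (P : V →ₗ[ℝ] V) : Set ℂ :=
  spectrum ℂ (P.baseChange ℂ : Module.End ℂ (ℂ ⊗[ℝ] V))

end

end StationaryLorentz

/-! The constraint does not change the kernel: on `T_γ 𝒩` the kernel of `I_γ` is exactly the space
of periodic Jacobi fields (`mem_hessianKernel_iff`). A kernel element `V` is a priori tested only
against constrained variations. Since `Y` is timelike, one can divide by `g(Y, Y)` and find, for
every periodic variation `W`, a periodic function `l` vanishing at `0` and `1` such that `W - l Y`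
is constrained. Moreover `I_γ(V, l Y) = 0`: `Y` is a Jacobi field along `γ`, and the constraint on
`V` turns the integrand into a total derivative. So `V` is tested against all `W`
(`index_unconstrained`), and the du Bois-Reymond argument makes it a Jacobi field
(`solves_of_mem_kernel`). Conversely a Jacobi field has a constant Wronskian with `Y`, which is the
constraint (`mem_kernel_of_solves`).

In a parallel frame the Jacobi equation becomes `z'' = A z` on a fixed vector space, twisted by the
holonomy of the loop. Its return map `P` on initial data is conjugate to the linearized Poincaré map
(`isPoincareMap_iff`), and restarting after each period identifies the kernel for the `N`-th iterate
with `ker (P ^ N - 1)` (`hessianKernel_iterate`). The rest is linear algebra.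

For nondegeneracy, `γ'` and `Y` always give a subspace of `ker (P - 1) ≤ ker (P ^ N - 1)`, so the
iterate is nondegenerate iff `γ` is and the two kernels agree. As `X ^ N - 1` is separable, they
agree iff `P` has no eigenvalue `z ≠ 1` with `z ^ N = 1` (`ker_pow_sub_one_eq`,
`eq_one_of_mem_complexSpectrum`).

For the nullities, `ker (P ^ k - 1)` depends only on which orders of root-of-unity eigenvalues
divide `k`. Grouping the integers by this set of divisors gives the partition, with `m_j` the least
common multiple of the set (`exists_divisibility_partition`). Conjugate eigenvalues have equal order
and `Y` supplies the eigenvalue `1`, so at most `dim M` orders exceed `1`, whence at most `2 ^ dim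
M` classes. -/

set_option maxSynthPendingDepth 3

namespace StationaryLorentz

/-! ## Local (pseudo-)Riemannian geometry on open subsets of a vector space -/

section ChartCalculus

variable {E : Type*} [NormedAddCommGroup E] [NormedSpace ℝ E]

/-- A smooth field of nondegenerate symmetric bilinear forms on an open set `U`. -/
structure IsMetricOn (G : E → E →L[ℝ] E →L[ℝ] ℝ) (U : Set E) : Prop where
  isOpen : IsOpen U
  contDiffOn : ContDiffOn ℝ ∞ G U
  symm : ∀ y ∈ U, ∀ v w, G y v w = G y w v
  invertible : ∀ y ∈ U, (G y).IsInvertible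

/-- The lowered Christoffel symbol as a continuous linear function of the derivative `D` of the
metric. -/
noncomputable def koszulForm :
    (E →L[ℝ] E →L[ℝ] E →L[ℝ] ℝ) →L[ℝ] (E →L[ℝ] E →L[ℝ] E →L[ℝ] ℝ) :=
  let F := (ContinuousLinearMap.flipₗᵢ ℝ E E (E →L[ℝ] ℝ)).toContinuousLinearEquiv.toContinuousLinearMap
  let f := (ContinuousLinearMap.flipₗᵢ ℝ E E ℝ).toContinuousLinearEquiv.toContinuousLinearMap
  (1 / 2 : ℝ) • (ContinuousLinearMap.id ℝ _ + F -
    (ContinuousLinearMap.compL ℝ E (E →L[ℝ] E →L[ℝ] ℝ) (E →L[ℝ] E →L[ℝ] ℝ) f) ∘L F)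

theorem koszulForm_apply (D : E →L[ℝ] E →L[ℝ] E →L[ℝ] ℝ) (v w : E) :
    koszulForm D v w = (1 / 2 : ℝ) • (D v w + D w v - (D.flip v).flip w) := rfl

/-- The Christoffel symbol of a metric `G`, as an operator. -/
noncomputable def christoffelOp (G : E → E →L[ℝ] E →L[ℝ] ℝ) (y : E) : E →L[ℝ] E →L[ℝ] E :=
  (ContinuousLinearMap.compL ℝ E (E →L[ℝ] ℝ) E (G y).inverse) ∘L koszulForm (fderiv ℝ G y)

/-- The curvature tensor of a metric `G`. -/
noncomputable def curvatureForm (G : E → E →L[ℝ] E →L[ℝ] ℝ) (y u v w : E) : E :=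
  fderiv ℝ (fun z ↦ christoffelOp G z v w) y u - fderiv ℝ (fun z ↦ christoffelOp G z u w) y v
    + christoffelOp G y u (christoffelOp G y v w)
    - christoffelOp G y v (christoffelOp G y u w)

/-- The tensor identities below are differentiated along lines: this reduces the product rule for
multilinear expressions to one variable, and uniqueness of the derivative compares the two sides of
an identity valid near `y`. -/
theorem _root_.HasFDerivAt.hasDerivAt_line {D F : Type*} [NormedAddCommGroup D] [NormedSpace ℝ D]
    [NormedAddCommGroup F] [NormedSpace ℝ F] {f : D → F} {f' : D →L[ℝ] F} {y : D}
    (hf : HasFDerivAt f f' y) (u : D) : HasDerivAt (fun t : ℝ ↦ f (y + t • u)) (f' u) 0 := by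
  have hl : HasDerivAt (fun t : ℝ ↦ y + t • u) u 0 := by
    simpa using ((hasDerivAt_id (0 : ℝ)).smul_const u).const_add y
  exact HasFDerivAt.comp_hasDerivAt (0 : ℝ) (by simpa using hf) hl

theorem eventually_line_mem {D : Type*} [NormedAddCommGroup D] [NormedSpace ℝ D] {U : Set D}
    (hU : IsOpen U) {y : D} (hy : y ∈ U) (u : D) : ∀ᶠ t in nhds (0 : ℝ), y + t • u ∈ U := by
  have hc : Continuous (fun t : ℝ ↦ y + t • u) := by fun_prop
  exact hc.continuousAt.eventually_mem (hU.mem_nhds (by simpa using hy))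

theorem hasFDerivAt_apply₂ {F : Type*} [NormedAddCommGroup F] [NormedSpace ℝ F]
    {D : Type*} [NormedAddCommGroup D] [NormedSpace ℝ D]
    {L : D → E →L[ℝ] E →L[ℝ] F} {L' : D →L[ℝ] E →L[ℝ] E →L[ℝ] F} {a b : D → E} {a' b' : D →L[ℝ] E}
    {y : D} (hL : HasFDerivAt L L' y) (ha : HasFDerivAt a a' y) (hb : HasFDerivAt b b' y) (u : D) :
    HasDerivAt (fun t : ℝ ↦ L (y + t • u) (a (y + t • u)) (b (y + t • u)))
      (L' u (a y) (b y) + L y (a' u) (b y) + L y (a y) (b' u)) 0 := by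
  have h1 := hL.hasDerivAt_line u
  have h2 := ha.hasDerivAt_line u
  have h3 := hb.hasDerivAt_line u
  have := (h1.clm_apply h2).clm_apply h3
  simpa using this

theorem two_le_infty : (2 : WithTop ℕ∞) ≤ ∞ := by
  exact WithTop.coe_le_coe.2 (le_top : (2 : ℕ∞) ≤ ⊤)

theorem fderiv_apply₂ {F : Type*} [NormedAddCommGroup F] [NormedSpace ℝ F]
    {D : Type*} [NormedAddCommGroup D] [NormedSpace ℝ D]
    {L : D → E →L[ℝ] E →L[ℝ] F} {y : D} (hL : DifferentiableAt ℝ L y) (u : D) (v w : E) :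
    fderiv ℝ (fun z ↦ L z v w) y u = fderiv ℝ L y u v w := by
  have h : HasFDerivAt (fun z ↦ L z v w) _ y :=
    (hL.hasFDerivAt.clm_apply (hasFDerivAt_const v y)).clm_apply (hasFDerivAt_const w y)
  rw [h.fderiv]; simp

/-! ### Metric compatibility, vanishing torsion and the symmetries of the curvature tensor -/

namespace IsMetricOn

variable {G : E → E →L[ℝ] E →L[ℝ] ℝ} {U : Set E} (hG : IsMetricOn G U) {y : E} (hy : y ∈ U)
include hG hy

theorem contDiffAt : ContDiffAt ℝ ∞ G y := hG.contDiffOn.contDiffAt (hG.isOpen.mem_nhds hy)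

theorem differentiableAt : DifferentiableAt ℝ G y :=
  (hG.contDiffAt hy).differentiableAt (by simp)

theorem contDiffAt_fderiv : ContDiffAt ℝ ∞ (fderiv ℝ G) y :=
  (hG.contDiffAt hy).fderiv_right (m := ∞) (by simp)

theorem fderiv_symm (u v w : E) : fderiv ℝ G y u v w = fderiv ℝ G y u w v := by
  rw [← fderiv_apply₂ (hG.differentiableAt hy), ← fderiv_apply₂ (hG.differentiableAt hy)]
  have : (fun z ↦ G z v w) =ᶠ[nhds y] fun z ↦ G z w v := by
    filter_upwards [hG.isOpen.mem_nhds hy] with z hz using hG.symm z hz v w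
  rw [this.fderiv_eq]

theorem apply_christoffelOp (v w u : E) : G y (christoffelOp G y v w) u =
    1 / 2 * (fderiv ℝ G y v w u + fderiv ℝ G y w v u - fderiv ℝ G y u v w) := by
  have : christoffelOp G y v w = (G y).inverse (koszulForm (fderiv ℝ G y) v w) := rfl
  rw [this, (hG.invertible y hy).self_apply_inverse, koszulForm_apply]
  simp

theorem ext_left {a b : E} (h : ∀ u, G y a u = G y b u) : a = b :=
  (hG.invertible y hy).injective (ContinuousLinearMap.ext h)

theorem christoffelOp_symm (v w : E) : christoffelOp G y v w = christoffelOp G y w v := by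
  refine hG.ext_left hy fun u ↦ ?_
  rw [hG.apply_christoffelOp hy, hG.apply_christoffelOp hy, hG.fderiv_symm hy u v w]
  ring

/-- Adding Koszul's formulas for `⟨Γ(u, v), w⟩` and `⟨Γ(u, w), v⟩` cancels everything but the
`u`-derivative of the metric. This is `∇G = 0` in coordinates. -/
theorem fderiv_eq (u v w : E) : fderiv ℝ G y u v w =
    G y (christoffelOp G y u v) w + G y v (christoffelOp G y u w) := by
  rw [hG.symm y hy v, hG.apply_christoffelOp hy, hG.apply_christoffelOp hy]
  linarith [hG.fderiv_symm hy u v w, hG.fderiv_symm hy v w u, hG.fderiv_symm hy w v u]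

theorem contDiffAt_christoffelOp [CompleteSpace E] : ContDiffAt ℝ ∞ (christoffelOp G) y := by
  have h1 : ContDiffAt ℝ ∞ (fun z ↦ (G z).inverse) y :=
    ((hG.invertible y hy).contDiffAt_map_inverse).comp y (hG.contDiffAt hy)
  have h2 : ContDiffAt ℝ ∞ (fun z ↦ koszulForm (fderiv ℝ G z)) y :=
    koszulForm.contDiff.contDiffAt.comp y (hG.contDiffAt_fderiv hy)
  exact ((ContinuousLinearMap.compL ℝ E (E →L[ℝ] ℝ) E).contDiff.contDiffAt.comp y h1).clm_comp h2

theorem differentiableAt_christoffelOp [CompleteSpace E] :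
    DifferentiableAt ℝ (christoffelOp G) y :=
  (hG.contDiffAt_christoffelOp hy).differentiableAt (by simp)

theorem curvatureForm_eq [CompleteSpace E] (u v w : E) : curvatureForm G y u v w =
    fderiv ℝ (christoffelOp G) y u v w - fderiv ℝ (christoffelOp G) y v u w
    + christoffelOp G y u (christoffelOp G y v w)
    - christoffelOp G y v (christoffelOp G y u w) := by
  rw [curvatureForm, fderiv_apply₂ (hG.differentiableAt_christoffelOp hy),
    fderiv_apply₂ (hG.differentiableAt_christoffelOp hy)]

omit hG hy in
theorem curvatureForm_swap (u v w : E) : curvatureForm G y u v w = -curvatureForm G y v u w := by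
  simp only [curvatureForm]; abel

theorem fderiv_christoffelOp_symm (u v w : E) [CompleteSpace E] :
    fderiv ℝ (christoffelOp G) y u v w = fderiv ℝ (christoffelOp G) y u w v := by
  rw [← fderiv_apply₂ (hG.differentiableAt_christoffelOp hy),
    ← fderiv_apply₂ (hG.differentiableAt_christoffelOp hy)]
  have : (fun z ↦ christoffelOp G z v w) =ᶠ[nhds y] fun z ↦ christoffelOp G z w v := by
    filter_upwards [hG.isOpen.mem_nhds hy] with z hz using hG.christoffelOp_symm hz v w
  rw [this.fderiv_eq]

/-- Once the Christoffel symbol and its derivative are known to be symmetric in the lower arguments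
(no torsion), every term of the cyclic sum occurs with both signs. -/
theorem curvatureForm_bianchi [CompleteSpace E] (u v w : E) :
    curvatureForm G y u v w + curvatureForm G y v w u + curvatureForm G y w u v = 0 := by
  simp only [hG.curvatureForm_eq hy]
  rw [hG.fderiv_christoffelOp_symm hy u v w, hG.fderiv_christoffelOp_symm hy v u w,
    hG.fderiv_christoffelOp_symm hy w u v, hG.christoffelOp_symm hy v w,
    hG.christoffelOp_symm hy u w, hG.christoffelOp_symm hy v u]
  abel

/-- The derivative of the lowered form of metric compatibility. -/
theorem fderiv_fderiv_eq [CompleteSpace E] (u v w z : E) :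
    fderiv ℝ (fderiv ℝ G) y u v w z =
      G y (fderiv ℝ (christoffelOp G) y u v w) z + G y w (fderiv ℝ (christoffelOp G) y u v z)
      + G y (christoffelOp G y u (christoffelOp G y v w)) z
      + G y (christoffelOp G y v w) (christoffelOp G y u z)
      + G y (christoffelOp G y u w) (christoffelOp G y v z)
      + G y w (christoffelOp G y u (christoffelOp G y v z)) := by
  have hd := (hG.contDiffAt_fderiv hy).differentiableAt (by simp)
  have hΓ := (hG.differentiableAt_christoffelOp hy).hasFDerivAt
  have hg := (hG.differentiableAt hy).hasFDerivAt
  have hc (a b : E) : HasFDerivAt (fun x ↦ christoffelOp G x a b)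
      ((fderiv ℝ (christoffelOp G) y).flip a |>.flip b) y := by
    have := (hΓ.clm_apply (hasFDerivAt_const a y)).clm_apply (hasFDerivAt_const b y)
    convert this using 1
    ext x; simp
  have h1 : HasDerivAt (fun t : ℝ ↦ fderiv ℝ G (y + t • u) v w z)
      (fderiv ℝ (fderiv ℝ G) y u v w z) 0 := by
    have := hd.hasFDerivAt.hasDerivAt_line u
    have := ((this.clm_apply (hasDerivAt_const 0 v)).clm_apply (hasDerivAt_const 0 w)).clm_apply
      (hasDerivAt_const 0 z)
    simpa using this
  have h2 := (hasFDerivAt_apply₂ hg (hc v w) (hasFDerivAt_const z y) u).add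
    (hasFDerivAt_apply₂ hg (hasFDerivAt_const w y) (hc v z) u)
  have heq : (fun t : ℝ ↦ fderiv ℝ G (y + t • u) v w z) =ᶠ[nhds 0]
      fun t ↦ G (y + t • u) (christoffelOp G (y + t • u) v w) z +
        G (y + t • u) w (christoffelOp G (y + t • u) v z) := by
    filter_upwards [eventually_line_mem hG.isOpen hy u] with t ht using hG.fderiv_eq ht v w z
  have h3 := (h1.congr_of_eventuallyEq heq.symm).unique h2
  rw [h3, hG.fderiv_eq hy u, hG.fderiv_eq hy u]
  simp
  ring

/-- The second derivative of `G`, expanded by differentiating metric compatibility, is symmetric in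
`u` and `v`. The products `⟨Γ(v, w), Γ(u, z)⟩ + ⟨Γ(u, w), Γ(v, z)⟩` are symmetric by themselves and
drop out; what remains is the skewness. -/
theorem curvatureForm_skew [CompleteSpace E] (u v w z : E) :
    G y (curvatureForm G y u v w) z = -G y w (curvatureForm G y u v z) := by
  have hs : IsSymmSndFDerivAt ℝ G y :=
    (hG.contDiffAt hy).isSymmSndFDerivAt (by simpa using two_le_infty)
  have h := hs.eq u v
  have h' : fderiv ℝ (fderiv ℝ G) y u v w z = fderiv ℝ (fderiv ℝ G) y v u w z := by rw [h]
  rw [hG.fderiv_fderiv_eq hy, hG.fderiv_fderiv_eq hy] at h'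
  simp only [hG.curvatureForm_eq hy, map_add, map_sub, add_apply, sub_apply]
  linarith

/-- The classical octahedron argument: the four Bianchi identities obtained by cyclically shifting
`(u, v, w, z)`, combined with the two antisymmetries. -/
theorem curvatureForm_pair_symm [CompleteSpace E] (u v w z : E) :
    G y (curvatureForm G y u v w) z = G y (curvatureForm G y w z u) v := by
  have b (u v w z : E) : G y (curvatureForm G y u v w) z + G y (curvatureForm G y v w u) z
      + G y (curvatureForm G y w u v) z = 0 := by
    have := congrArg (fun x ↦ G y x z) (hG.curvatureForm_bianchi hy u v w)
    simpa using this
  have s (u v w z : E) : G y (curvatureForm G y u v w) z = -G y (curvatureForm G y u v z) w := by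
    rw [hG.curvatureForm_skew hy, hG.symm y hy w]
  have a (u v w z : E) : G y (curvatureForm G y u v w) z = -G y (curvatureForm G y v u w) z := by
    rw [curvatureForm_swap]; simp
  linarith [b u v w z, b v w z u, b w z u v, b z u v w, s u v w z, s v w u z, s w u v z,
    s v w z u, s w z v u, s z v w u, s w z u v, s z u w v, s u w z v, s z u v w, s u v z w,
    s v z u w, a u v w z, a v w u z, a w u v z, a v w z u, a w z v u, a z v w u,
    a w z u v, a z u w v, a u w z v, a z u v w, a u v z w, a v z u w]

end IsMetricOn

/-- `φ` is a smooth isometry from `(W, G₀)`, `W ⊆ U₀` open, to `(U₁, G₁)`. -/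
structure IsTransition (φ : E → E) (W : Set E) (G₀ : E → E →L[ℝ] E →L[ℝ] ℝ) (U₀ : Set E)
    (G₁ : E → E →L[ℝ] E →L[ℝ] ℝ) (U₁ : Set E) : Prop where
  isOpen : IsOpen W
  subset : W ⊆ U₀
  mapsTo : MapsTo φ W U₁
  contDiffOn : ContDiffOn ℝ ∞ φ W
  surjective : ∀ y ∈ W, Function.Surjective (fderiv ℝ φ y)
  isometry : ∀ y ∈ W, ∀ v w, G₀ y v w = G₁ (φ y) (fderiv ℝ φ y v) (fderiv ℝ φ y w)

/-! ### Transformation laws of Christoffel symbols and curvature under isometric coordinate changes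
-/

namespace IsTransition

variable {G₀ G₁ : E → E →L[ℝ] E →L[ℝ] ℝ} {U₀ U₁ W : Set E} {φ : E → E}
  (hφ : IsTransition φ W G₀ U₀ G₁ U₁) (h₀ : IsMetricOn G₀ U₀) (h₁ : IsMetricOn G₁ U₁)
  {y : E} (hy : y ∈ W)
include hφ hy

theorem contDiffAt : ContDiffAt ℝ ∞ φ y := hφ.contDiffOn.contDiffAt (hφ.isOpen.mem_nhds hy)

theorem hasFDerivAt : HasFDerivAt φ (fderiv ℝ φ y) y :=
  ((hφ.contDiffAt hy).differentiableAt (by simp)).hasFDerivAt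

theorem contDiffAt_fderiv : ContDiffAt ℝ ∞ (fderiv ℝ φ) y :=
  (hφ.contDiffAt hy).fderiv_right (m := ∞) (by simp)

theorem hasFDerivAt_fderiv : HasFDerivAt (fderiv ℝ φ) (fderiv ℝ (fderiv ℝ φ) y) y :=
  ((hφ.contDiffAt_fderiv hy).differentiableAt (by simp)).hasFDerivAt

theorem snd_symm (v w : E) : fderiv ℝ (fderiv ℝ φ) y v w = fderiv ℝ (fderiv ℝ φ) y w v :=
  ((hφ.contDiffAt hy).isSymmSndFDerivAt (by simpa using two_le_infty)).eq v w

omit hφ hy in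
theorem hasFDerivAt_flip {F : Type*} [NormedAddCommGroup F] [NormedSpace ℝ F]
    {f : E → E →L[ℝ] F} {f' : E →L[ℝ] E →L[ℝ] F}
    (hf : HasFDerivAt f f' y) (v : E) : HasFDerivAt (fun z ↦ f z v) (f'.flip v) y := by
  have := hf.clm_apply (hasFDerivAt_const v y)
  convert this using 1
  ext x; simp

include h₁ in
theorem fderiv_metric (u v w : E) : fderiv ℝ G₀ y u v w =
    fderiv ℝ G₁ (φ y) (fderiv ℝ φ y u) (fderiv ℝ φ y v) (fderiv ℝ φ y w)
    + G₁ (φ y) (fderiv ℝ (fderiv ℝ φ) y u v) (fderiv ℝ φ y w)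
    + G₁ (φ y) (fderiv ℝ φ y v) (fderiv ℝ (fderiv ℝ φ) y u w) := by
  have hD := hφ.hasFDerivAt_fderiv hy
  have hc := (h₁.differentiableAt (hφ.mapsTo hy)).hasFDerivAt.comp y (hφ.hasFDerivAt hy)
  have h := hasFDerivAt_apply₂ hc (hasFDerivAt_flip hD v) (hasFDerivAt_flip hD w) u
  have heq : (fun t : ℝ ↦ G₀ (y + t • u) v w) =ᶠ[nhds 0] fun t ↦ (G₁ ∘ φ) (y + t • u)
      (fderiv ℝ φ (y + t • u) v) (fderiv ℝ φ (y + t • u) w) := by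
    filter_upwards [eventually_line_mem hφ.isOpen hy u] with t ht using hφ.isometry _ ht v w
  -- Near `y` the form `G₀` is the pullback of `G₁` by `φ`, hence a composition of differentiable
  -- maps.
  have hdiff : DifferentiableAt ℝ G₀ y := by
    have : G₀ =ᶠ[nhds y] fun z ↦ ((ContinuousLinearMap.compL ℝ E E ℝ).flip (fderiv ℝ φ z)) ∘L
        (G₁ (φ z) ∘L fderiv ℝ φ z) := by
      filter_upwards [hφ.isOpen.mem_nhds hy] with z hz
      ext v w; simpa using hφ.isometry z hz v w
    refine this.symm.differentiableAt_iff.1 ?_ 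
    exact (((ContinuousLinearMap.compL ℝ E E ℝ).flip.differentiableAt.comp y
      hD.differentiableAt).clm_comp (hc.differentiableAt.clm_comp hD.differentiableAt))
  have h2 := hasFDerivAt_apply₂ hdiff.hasFDerivAt (hasFDerivAt_const v y) (hasFDerivAt_const w y) u
  have := (h2.congr_of_eventuallyEq heq.symm).unique h
  simpa using this

include h₀ h₁

/-- With the pullback formula inserted into Koszul's formula, all terms containing `D²φ` cancel
except `⟨D²φ(v, w), Dφ u⟩`. Surjectivity of `Dφ` makes test vectors of the form `Dφ u` sufficient.
-/
theorem map_christoffelOp (v w : E) : fderiv ℝ φ y (christoffelOp G₀ y v w) =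
    christoffelOp G₁ (φ y) (fderiv ℝ φ y v) (fderiv ℝ φ y w) + fderiv ℝ (fderiv ℝ φ) y v w := by
  refine h₁.ext_left (hφ.mapsTo hy) fun u' ↦ ?_
  obtain ⟨u, rfl⟩ := hφ.surjective y hy u'
  have s := h₁.symm (φ y) (hφ.mapsTo hy)
  rw [← hφ.isometry y hy, h₀.apply_christoffelOp (hφ.subset hy), hφ.fderiv_metric h₁ hy,
    hφ.fderiv_metric h₁ hy, hφ.fderiv_metric h₁ hy, map_add, add_apply,
    h₁.apply_christoffelOp (hφ.mapsTo hy), hφ.snd_symm hy w v, hφ.snd_symm hy u v,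
    hφ.snd_symm hy u w, s (fderiv ℝ φ y w), s (fderiv ℝ φ y v)]
  ring

theorem map_curvatureForm [CompleteSpace E] (u v w : E) :
    fderiv ℝ φ y (curvatureForm G₀ y u v w) =
      curvatureForm G₁ (φ y) (fderiv ℝ φ y u) (fderiv ℝ φ y v) (fderiv ℝ φ y w) := by
  have hD := hφ.hasFDerivAt_fderiv hy
  have hDD : ContDiffAt ℝ ∞ (fderiv ℝ (fderiv ℝ φ)) y :=
    (hφ.contDiffAt_fderiv hy).fderiv_right (m := ∞) (by simp)
  have hΓ₀ := (h₀.differentiableAt_christoffelOp (hφ.subset hy)).hasFDerivAt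
  have hΓ₁ := (h₁.differentiableAt_christoffelOp (hφ.mapsTo hy)).hasFDerivAt.comp y
    (hφ.hasFDerivAt hy)
  -- The transformation law of the Christoffel symbols, differentiated in the direction `a`.
  -- Antisymmetrizing in `u` and `v` then removes the third derivative of `φ`, and the remaining
  -- second derivatives cancel against the quadratic terms of the curvature.
  have key (a v w : E) : fderiv ℝ (fderiv ℝ φ) y a (christoffelOp G₀ y v w)
      + fderiv ℝ φ y (fderiv ℝ (christoffelOp G₀) y a v w) =
      fderiv ℝ (christoffelOp G₁) (φ y) (fderiv ℝ φ y a) (fderiv ℝ φ y v) (fderiv ℝ φ y w)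
      + christoffelOp G₁ (φ y) (fderiv ℝ (fderiv ℝ φ) y a v) (fderiv ℝ φ y w)
      + christoffelOp G₁ (φ y) (fderiv ℝ φ y v) (fderiv ℝ (fderiv ℝ φ) y a w)
      + fderiv ℝ (fderiv ℝ (fderiv ℝ φ)) y a v w := by
    have h1 := (hD.hasDerivAt_line a).clm_apply
      ((hasFDerivAt_flip (hasFDerivAt_flip hΓ₀ v) w).hasDerivAt_line a)
    have h2 := (hasFDerivAt_apply₂ hΓ₁ (hasFDerivAt_flip hD v) (hasFDerivAt_flip hD w) a).add
      ((hasFDerivAt_flip (hasFDerivAt_flip (hDD.differentiableAt (by simp)).hasFDerivAt v)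
        w).hasDerivAt_line a)
    have heq : (fun t : ℝ ↦ fderiv ℝ φ (y + t • a) (christoffelOp G₀ (y + t • a) v w)) =ᶠ[nhds 0]
        fun t ↦ (christoffelOp G₁ ∘ φ) (y + t • a) (fderiv ℝ φ (y + t • a) v)
          (fderiv ℝ φ (y + t • a) w) + fderiv ℝ (fderiv ℝ φ) (y + t • a) v w := by
      filter_upwards [eventually_line_mem hφ.isOpen hy a] with t ht
        using hφ.map_christoffelOp h₀ h₁ ht v w
    have := (h1.congr_of_eventuallyEq heq.symm).unique h2
    simpa using this
  have hs : fderiv ℝ (fderiv ℝ (fderiv ℝ φ)) y u v w = fderiv ℝ (fderiv ℝ (fderiv ℝ φ)) y v u w := by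
    rw [((hφ.contDiffAt_fderiv hy).isSymmSndFDerivAt (by simpa using two_le_infty)).eq u v]
  have k1 := key u v w
  have k2 := key v u w
  rw [hφ.snd_symm hy v u] at k2
  rw [h₀.curvatureForm_eq (hφ.subset hy), h₁.curvatureForm_eq (hφ.mapsTo hy)]
  simp only [map_add, map_sub, hφ.map_christoffelOp h₀ h₁ hy]
  have e1 := eq_sub_of_add_eq' k1
  have e2 := eq_sub_of_add_eq' k2
  rw [e1, e2, hs]
  abel

end IsTransition

/-- The covariant differential `v ↦ ∇_v Y` of a vector field `Y`. -/
noncomputable def covDiff (G : E → E →L[ℝ] E →L[ℝ] ℝ) (Y : E → E) (y : E) : E →L[ℝ] E :=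
  fderiv ℝ Y y + (christoffelOp G y).flip (Y y)

theorem covDiff_apply (G : E → E →L[ℝ] E →L[ℝ] ℝ) (Y : E → E) (y v : E) :
    covDiff G Y y v = fderiv ℝ Y y v + christoffelOp G y v (Y y) := rfl

/-- Differentiating `Y₁ ∘ φ = Dφ Y₀` produces `D²φ(v, Y₀)`, which is exactly the inhomogeneous term
in the transformation law of the Christoffel symbols. -/
theorem IsTransition.map_covDiff {G₀ G₁ : E → E →L[ℝ] E →L[ℝ] ℝ} {U₀ U₁ W : Set E} {φ : E → E}
    (hφ : IsTransition φ W G₀ U₀ G₁ U₁) (h₀ : IsMetricOn G₀ U₀) (h₁ : IsMetricOn G₁ U₁)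
    {y : E} (hy : y ∈ W) {Y₀ Y₁ : E → E} (hY : ∀ z ∈ W, Y₁ (φ z) = fderiv ℝ φ z (Y₀ z))
    (d₀ : DifferentiableAt ℝ Y₀ y) (d₁ : DifferentiableAt ℝ Y₁ (φ y)) (v : E) :
    covDiff G₁ Y₁ (φ y) (fderiv ℝ φ y v) = fderiv ℝ φ y (covDiff G₀ Y₀ y v) := by
  have h1 := (d₁.hasFDerivAt.comp y (hφ.hasFDerivAt hy)).hasDerivAt_line v
  have h2 := ((hφ.hasFDerivAt_fderiv hy).hasDerivAt_line v).clm_apply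
    (d₀.hasFDerivAt.hasDerivAt_line v)
  have heq : (fun t : ℝ ↦ (Y₁ ∘ φ) (y + t • v)) =ᶠ[nhds 0]
      fun t ↦ fderiv ℝ φ (y + t • v) (Y₀ (y + t • v)) := by
    filter_upwards [eventually_line_mem hφ.isOpen hy v] with t ht using hY _ ht
  have := (h1.congr_of_eventuallyEq heq.symm).unique h2
  simp only [ContinuousLinearMap.comp_apply, zero_smul, add_zero] at this
  rw [covDiff_apply, covDiff_apply, map_add, hφ.map_christoffelOp h₀ h₁ hy, hY y hy, this]
  abel

/-- The second covariant derivative of a Killing field along a vector `u`. -/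
theorem IsMetricOn.killing_second [CompleteSpace E] {G : E → E →L[ℝ] E →L[ℝ] ℝ} {U : Set E}
    (hG : IsMetricOn G U)
    {Y : E → E} (hY : ContDiffOn ℝ ∞ Y U)
    (hK : ∀ y ∈ U, ∀ v w, G y (covDiff G Y y v) w + G y v (covDiff G Y y w) = 0)
    {y : E} (hy : y ∈ U) (u : E) :
    fderiv ℝ (covDiff G Y) y u u - covDiff G Y y (christoffelOp G y u u)
      + christoffelOp G y u (covDiff G Y y u) = curvatureForm G y u (Y y) u := by
  have hYy : ContDiffAt ℝ ∞ Y y := hY.contDiffAt (hG.isOpen.mem_nhds hy)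
  have hDY : ContDiffAt ℝ ∞ (fderiv ℝ Y) y := hYy.fderiv_right (m := ∞) (by simp)
  have hΓ := hG.contDiffAt_christoffelOp hy
  have dΓ := (hG.differentiableAt_christoffelOp hy).hasFDerivAt
  have dY := (hYy.differentiableAt (by simp)).hasFDerivAt
  have dDY := (hDY.differentiableAt (by simp)).hasFDerivAt
  have hB : ContDiffAt ℝ ∞ (covDiff G Y) y :=
    hDY.add (((ContinuousLinearMap.flipₗᵢ ℝ E E E).contDiff.contDiffAt.comp y hΓ).clm_apply hYy)
  have dB := (hB.differentiableAt (by simp)).hasFDerivAt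
  have hBd (a v : E) : fderiv ℝ (covDiff G Y) y a v = fderiv ℝ (fderiv ℝ Y) y a v
      + fderiv ℝ (christoffelOp G) y a v (Y y) + christoffelOp G y v (fderiv ℝ Y y a) := by
    have h1 := (IsTransition.hasFDerivAt_flip dB v).hasDerivAt_line a
    have h2 := ((IsTransition.hasFDerivAt_flip dDY v).hasDerivAt_line a).add
      (hasFDerivAt_apply₂ dΓ (hasFDerivAt_const v y) dY a)
    have := h1.unique h2
    simpa [add_assoc] using this
  -- `T a v` is the second covariant derivative `∇²_{a,v} Y`. It is skew for the metric in the last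
  -- slot, because the Killing equation can be differentiated in the direction `a`.
  set T : E → E → E := fun a v ↦ fderiv ℝ (covDiff G Y) y a v - covDiff G Y y (christoffelOp G y a v)
    + christoffelOp G y a (covDiff G Y y v) with hT
  have skew (a v w : E) : G y (T a v) w + G y v (T a w) = 0 := by
    have dG := (hG.differentiableAt hy).hasFDerivAt
    have h1 := (hasFDerivAt_apply₂ dG (IsTransition.hasFDerivAt_flip dB v) (hasFDerivAt_const w y)
      a).add (hasFDerivAt_apply₂ dG (hasFDerivAt_const v y) (IsTransition.hasFDerivAt_flip dB w) a)
    have heq : (fun t : ℝ ↦ G (y + t • a) (covDiff G Y (y + t • a) v) w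
        + G (y + t • a) v (covDiff G Y (y + t • a) w)) =ᶠ[nhds 0] fun _ ↦ 0 := by
      filter_upwards [eventually_line_mem hG.isOpen hy a] with t ht using hK _ ht v w
    have h2 := (h1.congr_of_eventuallyEq heq.symm).unique (hasDerivAt_const 0 0)
    rw [hG.fderiv_eq hy, hG.fderiv_eq hy] at h2
    have k1 := hK y hy (christoffelOp G y a v) w
    have k2 := hK y hy v (christoffelOp G y a w)
    simp only [hT, map_add, map_sub, add_apply, sub_apply]
    simp at h2
    linarith
  -- The Ricci identity: the antisymmetric part of `∇²Y` is the curvature applied to `Y`.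
  have anti (a v : E) : T a v - T v a = curvatureForm G y a v (Y y) := by
    have hs := (hYy.isSymmSndFDerivAt (by simpa using two_le_infty)).eq a v
    rw [hG.curvatureForm_eq hy]
    simp only [hT, hBd, hs, hG.christoffelOp_symm hy v a]
    simp only [covDiff_apply, map_add]
    abel
  -- By skewness `⟨T u u, w⟩ = -⟨T u w, u⟩` and `⟨T w u, u⟩ = 0`. The Ricci identity makes the
  -- former `-⟨R(u, w) Y, u⟩`, and pair symmetry turns this into `⟨R(u, Y) u, w⟩`.
  change T u u = _
  refine hG.ext_left hy fun w ↦ ?_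
  have h1 := skew u u w
  have h2 := skew w u u
  have h3 := congrArg (fun x ↦ G y x u) (anti u w)
  have h4 := hG.curvatureForm_pair_symm hy u w (Y y) u
  have h5 : G y (curvatureForm G y u (Y y) u) w = -G y (curvatureForm G y (Y y) u u) w := by
    rw [IsMetricOn.curvatureForm_swap]; simp
  simp only [map_sub, sub_apply] at h3
  rw [hG.symm y hy u] at h1 h2
  linarith

end ChartCalculus

end StationaryLorentz

namespace StationaryLorentz

/-! ## Global solutions of linear equations on a line, glued from local trivializations -/

section Cocycle

open Filter Topology

variable {R : Type*} [NormedRing R] [NormedAlgebra ℝ R]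

theorem _root_.HasDerivAt.ringInverse [CompleteSpace R] {X : ℝ → R} {X' : R} {t : ℝ}
    (h : HasDerivAt X X' t) (hu : IsUnit (X t)) :
    HasDerivAt (fun s ↦ Ring.inverse (X s)) (-(Ring.inverse (X t) * X' * Ring.inverse (X t))) t := by
  obtain ⟨u, hu⟩ := hu
  have h1 : HasFDerivAt Ring.inverse (-ContinuousLinearMap.mulLeftRight ℝ R ↑u⁻¹ ↑u⁻¹) (X t) :=
    hu ▸ hasFDerivAt_ringInverse u
  have := h1.comp_hasDerivAt t h
  refine this.congr_deriv ?_
  rw [← hu, Ring.inverse_unit]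
  rfl

/-- Bootstrapping: the right-hand side `L X` is as smooth as `X` is known to be, so each use of the
equation gains a derivative. -/
theorem contDiffOn_of_hasDerivAt_linear {S : Set ℝ} (hS : IsOpen S) {L X : ℝ → R}
    (hL : ContDiffOn ℝ ∞ L S) (hX : ∀ t ∈ S, HasDerivAt X (L t * X t) t) :
    ContDiffOn ℝ ∞ X S := by
  refine contDiffOn_infty.2 fun n ↦ ?_
  induction n with
  | zero =>
    exact contDiffOn_zero.2 fun t ht ↦ (hX t ht).continuousAt.continuousWithinAt
  | succ n ih =>
    rw [Nat.cast_add, Nat.cast_one, contDiffOn_succ_iff_deriv_of_isOpen hS]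
    refine ⟨fun t ht ↦ (hX t ht).differentiableAt.differentiableWithinAt, by simp, ?_⟩
    exact (((contDiffOn_infty.1 hL) n).mul ih).congr fun t ht ↦ (hX t ht).deriv

theorem exists_local_solution_linear [CompleteSpace R] {L : ℝ → R} {t₀ : ℝ}
    (hL : ContDiffAt ℝ ∞ L t₀) :
    ∃ X : ℝ → R, X t₀ = 1 ∧ ∀ᶠ t in 𝓝 t₀, HasDerivAt X (L t * X t) t := by
  -- Adjoining time as a coordinate makes the equation autonomous; the first component of the
  -- solution is later identified with `t`.
  let f : ℝ × R → ℝ × R := fun p ↦ (1, L p.1 * p.2)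
  have hf : ContDiffAt ℝ 1 f (t₀, 1) := by
    have : ContDiffAt ℝ 1 (fun p : ℝ × R ↦ L p.1) (t₀, 1) :=
      ContDiffAt.comp (t₀, (1 : R)) (hL.of_le (by exact_mod_cast le_top)) contDiffAt_fst
    exact contDiffAt_const.prodMk (this.mul contDiffAt_snd)
  obtain ⟨α, h0, ε, hε, hα⟩ :=
    hf.exists_forall_mem_closedBall_exists_eq_forall_mem_Ioo_hasDerivAt₀ t₀
  have h1 : ∀ t ∈ Ioo (t₀ - ε) (t₀ + ε), HasDerivAt (fun s ↦ (α s).1) 1 t := fun t ht ↦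
    (ContinuousLinearMap.fst ℝ ℝ R).hasFDerivAt.comp_hasDerivAt t (hα t ht)
  have h2 : ∀ t ∈ Ioo (t₀ - ε) (t₀ + ε), HasDerivAt (fun s ↦ (α s).2) (L (α t).1 * (α t).2) t :=
    fun t ht ↦ (ContinuousLinearMap.snd ℝ ℝ R).hasFDerivAt.comp_hasDerivAt t (hα t ht)
  have hm : t₀ ∈ Ioo (t₀ - ε) (t₀ + ε) := by constructor <;> linarith
  have h3 : ∀ t ∈ Ioo (t₀ - ε) (t₀ + ε), (α t).1 = t := by
    intro t ht
    have := isOpen_Ioo.is_const_of_deriv_eq_zero isPreconnected_Ioo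
      (f := fun s ↦ (α s).1 - s) (fun s hs ↦ ((h1 s hs).fun_sub (hasDerivAt_id' s)).differentiableAt.differentiableWithinAt)
      (fun s hs ↦ by simpa using ((h1 s hs).fun_sub (hasDerivAt_id' s)).deriv) ht hm
    simp only [h0, sub_self] at this
    linarith
  refine ⟨fun s ↦ (α s).2, by simp [h0], ?_⟩
  filter_upwards [Ioo_mem_nhds hm.1 hm.2] with t ht
  simpa [h3 t ht] using h2 t ht

variable (R) in
/-- A linear connection on a line, in local trivializations `τ i` over open sets `dom i`, with
connection coefficients `con i`. -/
structure LineConnection (ι : Type*) where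
  dom : ι → Set ℝ
  τ : ι → ℝ → R
  con : ι → ℝ → R
  isOpen : ∀ i, IsOpen (dom i)
  cover : ∀ t, ∃ i, t ∈ dom i
  isUnit : ∀ i, ∀ t ∈ dom i, IsUnit (τ i t)
  contDiffOn : ∀ i, ContDiffOn ℝ ∞ (con i) (dom i)
  trans : ∀ i j t, t ∈ dom i → t ∈ dom j → HasDerivAt (fun s ↦ τ i s * Ring.inverse (τ j s))
    (τ i t * Ring.inverse (τ j t) * con j t - con i t * (τ i t * Ring.inverse (τ j t))) t

/-! ### Uniqueness, gluing and global existence of parallel frames -/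

namespace LineConnection

variable {ι : Type*} (c : LineConnection R ι)

/-- The family `Φ` is parallel at time `t`. -/
def IsParallelAt (Φ : ℝ → R) (t : ℝ) : Prop :=
  ∀ i, t ∈ c.dom i → HasDerivAt (fun s ↦ c.τ i s * Φ s) (-(c.con i t) * (c.τ i t * Φ t)) t

variable {c}

/-- The gauge law `trans` is precisely what carries the parallel equation from one trivialization to
another, so a single trivialization around `t` decides. -/
theorem isParallelAt_of_mem {Φ : ℝ → R} {t : ℝ} {i : ι} (hi : t ∈ c.dom i)
    (h : HasDerivAt (fun s ↦ c.τ i s * Φ s) (-(c.con i t) * (c.τ i t * Φ t)) t) :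
    c.IsParallelAt Φ t := by
  intro j hj
  have h1 := (c.trans j i t hj hi).mul h
  have e : ∀ s ∈ c.dom i, c.τ j s * Ring.inverse (c.τ i s) * (c.τ i s * Φ s) = c.τ j s * Φ s := by
    intro s hs
    rw [mul_assoc, ← mul_assoc (Ring.inverse _), Ring.inverse_mul_cancel _ (c.isUnit i s hs), one_mul]
  have h2 := h1.congr_of_eventuallyEq (f₁ := fun s ↦ c.τ j s * Φ s) (by
    filter_upwards [(c.isOpen i).mem_nhds hi] with s hs using (e s hs).symm)
  refine h2.congr_deriv ?_
  rw [← e t hi]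
  noncomm_ring

theorem IsParallelAt.mul_const {Φ : ℝ → R} {t : ℝ} (h : c.IsParallelAt Φ t) (C : R) :
    c.IsParallelAt (fun s ↦ Φ s * C) t := by
  intro i hi
  have := (h i hi).mul_const C
  simpa only [mul_assoc] using this

theorem IsParallelAt.congr {Φ Ψ : ℝ → R} {t : ℝ} (h : c.IsParallelAt Φ t) (e : Ψ =ᶠ[𝓝 t] Φ) :
    c.IsParallelAt Ψ t := by
  intro i hi
  have := (h i hi).congr_of_eventuallyEq (f₁ := fun s ↦ c.τ i s * Ψ s)
    (by filter_upwards [e] with s hs; rw [hs])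
  rwa [e.eq_of_nhds]

omit [NormedAlgebra ℝ R] in
theorem inverse_mul_eq_of_isUnit {a x y : R} (ha : IsUnit a) (hx : IsUnit x) :
    Ring.inverse (a * x) * (a * y) = Ring.inverse x * y := by
  obtain ⟨u, rfl⟩ := ha
  obtain ⟨v, rfl⟩ := hx
  rw [← Units.val_mul, Ring.inverse_unit, Ring.inverse_unit]
  simp [mul_assoc]

variable [CompleteSpace R]

/-- In `(τΦ)⁻¹ (τΨ)` the trivialization drops out, and so do the two connection terms in the
derivative. Hence parallel families differ by a constant right factor, which is the uniqueness used
for gluing. -/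
theorem IsParallelAt.hasDerivAt_inverse_mul {Φ Ψ : ℝ → R} {t : ℝ} (hΦ : c.IsParallelAt Φ t)
    (hΨ : c.IsParallelAt Ψ t) (hu : ∀ᶠ s in 𝓝 t, IsUnit (Φ s)) :
    HasDerivAt (fun s ↦ Ring.inverse (Φ s) * Ψ s) 0 t := by
  obtain ⟨i, hi⟩ := c.cover t
  have hut := hu.self_of_nhds
  have h1 := ((hΦ i hi).ringInverse ((c.isUnit i t hi).mul hut)).mul (hΨ i hi)
  have h2 := h1.congr_of_eventuallyEq (f₁ := fun s ↦ Ring.inverse (Φ s) * Ψ s) (by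
    filter_upwards [(c.isOpen i).mem_nhds hi, hu] with s hs hus
    exact (inverse_mul_eq_of_isUnit (c.isUnit i s hs) hus).symm)
  refine h2.congr_deriv ?_
  set A := c.τ i t * Φ t
  have hA : Ring.inverse A * A = 1 := Ring.inverse_mul_cancel _ ((c.isUnit i t hi).mul hut)
  have : -(Ring.inverse A * (-c.con i t * A) * Ring.inverse A) = Ring.inverse A * c.con i t := by
    have hA' : A * Ring.inverse A = 1 := Ring.mul_inverse_cancel _ ((c.isUnit i t hi).mul hut)
    simp only [mul_assoc, hA', mul_one, neg_mul, mul_neg, neg_neg]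
  rw [this]
  noncomm_ring

theorem eq_of_isParallelAt {Φ Ψ : ℝ → R} {S : Set ℝ} (hS : IsOpen S) (hS' : IsPreconnected S)
    (hΦ : ∀ t ∈ S, c.IsParallelAt Φ t ∧ IsUnit (Φ t)) (hΨ : ∀ t ∈ S, c.IsParallelAt Ψ t)
    {b : ℝ} (hb : b ∈ S) {t : ℝ} (ht : t ∈ S) : Ψ t = Φ t * (Ring.inverse (Φ b) * Ψ b) := by
  have hd : ∀ s ∈ S, HasDerivAt (fun s ↦ Ring.inverse (Φ s) * Ψ s) 0 s := fun s hs ↦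
    (hΦ s hs).1.hasDerivAt_inverse_mul (hΨ s hs) (by
      filter_upwards [hS.mem_nhds hs] with r hr using (hΦ r hr).2)
  have := hS.is_const_of_deriv_eq_zero hS'
    (fun s hs ↦ (hd s hs).differentiableAt.differentiableWithinAt) (fun s hs ↦ (hd s hs).deriv) ht hb
  rw [← this, ← mul_assoc, Ring.mul_inverse_cancel _ (hΦ t ht).2, one_mul]

variable (c)

/-- There is a parallel frame over a neighbourhood of `[a, b]`. -/
def HasFrame (a b : ℝ) : Prop :=
  ∃ Φ : ℝ → R, ∃ ε > 0, ∀ t ∈ Ioo (a - ε) (b + ε), c.IsParallelAt Φ t ∧ IsUnit (Φ t)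

variable {c}

theorem hasFrame_local (t₀ : ℝ) : ∃ ε > 0, ∀ a b, Icc a b ⊆ Metric.ball t₀ ε → a ≤ b →
    c.HasFrame a b := by
  obtain ⟨i, hi⟩ := c.cover t₀
  obtain ⟨X, h0, hX⟩ := exists_local_solution_linear (L := fun t ↦ -(c.con i t))
    (((c.contDiffOn i).contDiffAt ((c.isOpen i).mem_nhds hi)).neg)
  have hunit : ∀ᶠ t in 𝓝 t₀, IsUnit (X t) := by
    have : ContinuousAt X t₀ := hX.self_of_nhds.continuousAt
    exact this.eventually_mem (Units.isOpen.mem_nhds (by simp [h0]))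
  obtain ⟨ε, hε, H⟩ := Metric.eventually_nhds_iff_ball.1
    ((hX.and hunit).and ((c.isOpen i).mem_nhds hi))
  refine ⟨ε / 2, by positivity, fun a b hab hle ↦ ⟨fun t ↦ Ring.inverse (c.τ i t) * X t, ε / 2,
    by positivity, fun t ht ↦ ?_⟩⟩
  have ha := hab (left_mem_Icc.2 hle)
  have hb := hab (right_mem_Icc.2 hle)
  rw [Real.ball_eq_Ioo] at ha hb
  have htb : t ∈ Metric.ball t₀ ε := by
    rw [Real.ball_eq_Ioo]
    exact ⟨by linarith [ht.1, ha.1], by linarith [ht.2, hb.2]⟩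
  obtain ⟨⟨h1, h2⟩, h3⟩ := H t htb
  have e : ∀ s ∈ c.dom i, c.τ i s * (Ring.inverse (c.τ i s) * X s) = X s := by
    intro s hs
    rw [← mul_assoc, Ring.mul_inverse_cancel _ (c.isUnit i s hs), one_mul]
  refine ⟨isParallelAt_of_mem h3 ?_, (c.isUnit i t h3).ringInverse.mul h2⟩
  rw [e t h3]
  exact h1.congr_of_eventuallyEq (by
    filter_upwards [(c.isOpen i).mem_nhds h3] with s hs using e s hs)

theorem HasFrame.trans {a b d : ℝ} (hab : a ≤ b) (hbd : b ≤ d) (h₁ : c.HasFrame a b)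
    (h₂ : c.HasFrame b d) : c.HasFrame a d := by
  obtain ⟨Φ, ε, hε, hΦ⟩ := h₁
  obtain ⟨Ψ, δ, hδ, hΨ⟩ := h₂
  -- The right factor for which `Ψ C` agrees with `Φ` at `b`, hence by uniqueness on a neighbourhood
  -- of `b`; this overlap makes the glued family parallel across `b`.
  set C := Ring.inverse (Ψ b) * Φ b with hC
  have hbΦ : b ∈ Ioo (a - ε) (b + ε) := ⟨by linarith, by linarith⟩
  have hbΨ : b ∈ Ioo (b - δ) (d + δ) := ⟨by linarith, by linarith⟩
  have hCu : IsUnit C := (hΨ b hbΨ).2.ringInverse.mul (hΦ b hbΦ).2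
  set η := min ε δ
  have hη : 0 < η := lt_min hε hδ
  have hη1 : η ≤ ε := min_le_left _ _
  have hη2 : η ≤ δ := min_le_right _ _
  have key : ∀ t ∈ Ioo (b - η) (b + η), Φ t = Ψ t * C := fun t ht ↦
    eq_of_isParallelAt (S := Ioo (b - η) (b + η)) isOpen_Ioo isPreconnected_Ioo
      (fun s hs ↦ hΨ s ⟨by linarith [hs.1], by linarith [hs.2]⟩)
      (fun s hs ↦ (hΦ s ⟨by linarith [hs.1], by linarith [hs.2]⟩).1)
      ⟨by linarith, by linarith⟩ ht
  refine ⟨fun t ↦ if t < b then Φ t else Ψ t * C, η, hη, fun t ht ↦ ?_⟩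
  rcases lt_or_ge t b with htb | htb
  · have := hΦ t ⟨by linarith [ht.1], by linarith⟩
    refine ⟨this.1.congr ?_, by simpa [htb] using this.2⟩
    filter_upwards [Iio_mem_nhds htb] with s hs
    simp [mem_Iio.1 hs]
  · have := hΨ t ⟨by linarith, by linarith [ht.2]⟩
    refine ⟨(this.1.mul_const C).congr ?_, by simpa [not_lt.2 htb] using this.2.mul hCu⟩
    filter_upwards [Ioi_mem_nhds (show b - η < t by linarith)] with s hs
    by_cases hsb : s < b
    · simpa [hsb] using key s ⟨hs, by linarith⟩
    · simp [hsb]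

/-- A subdivision of the compact interval finer than the cover by intervals with local frames,
followed by gluing from left to right. -/
theorem hasFrame (c : LineConnection R ι) {a b : ℝ} (hab : a ≤ b) : c.HasFrame a b := by
  choose ε hε H using fun t₀ ↦ hasFrame_local (c := c) t₀
  obtain ⟨t, h0, hmono, ⟨m, hm⟩, hsub⟩ := exists_monotone_Icc_subset_open_cover_Icc hab
    (c := fun t₀ : ℝ ↦ (Subtype.val ⁻¹' Metric.ball t₀ (ε t₀) : Set (Icc a b)))
    (fun t₀ ↦ Metric.isOpen_ball.preimage continuous_subtype_val)
    (fun x _ ↦ mem_iUnion.2 ⟨x, Metric.mem_ball_self (hε x)⟩)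
  have step : ∀ n, c.HasFrame (t n) (t (n + 1)) := fun n ↦ by
    obtain ⟨i, hi⟩ := hsub n
    refine H i _ _ (fun x hx ↦ ?_) (hmono n.le_succ)
    exact hi (show (⟨x, (t n).2.1.trans hx.1, hx.2.trans (t (n + 1)).2.2⟩ : Icc a b) ∈ Icc _ _ from hx)
  have : ∀ n, c.HasFrame a (t n) := fun n ↦ by
    induction n with
    | zero =>
      obtain ⟨Φ, δ, hδ, hΦ⟩ := step 0
      have h01 : (t 0 : ℝ) ≤ t (0 + 1) := hmono (Nat.le_succ 0)
      rw [h0] at hΦ h01 ⊢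
      exact ⟨Φ, δ, hδ, fun s hs ↦ hΦ s ⟨hs.1, by linarith [hs.2]⟩⟩
    | succ n ih => exact ih.trans (t n).2.1 (hmono n.le_succ) (step n)
  simpa [hm m le_rfl] using this m

/-- Existence of a global parallel frame. -/
theorem exists_frame (c : LineConnection R ι) :
    ∃ Φ : ℝ → R, Φ 0 = 1 ∧ ∀ t, c.IsParallelAt Φ t ∧ IsUnit (Φ t) := by
  have h : ∀ n : ℕ, ∃ Φ : ℝ → R, Φ 0 = 1 ∧
      ∀ t ∈ Ioo (-(n + 1) : ℝ) (n + 1), c.IsParallelAt Φ t ∧ IsUnit (Φ t) := by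
    intro n
    obtain ⟨Φ, ε, hε, hΦ⟩ := c.hasFrame (a := -(n + 1)) (b := n + 1) (by linarith [n.cast_nonneg (α := ℝ)])
    have hn : (0 : ℝ) ≤ n := n.cast_nonneg
    have h0 := hΦ 0 ⟨by linarith, by linarith⟩
    refine ⟨fun t ↦ Φ t * Ring.inverse (Φ 0), Ring.mul_inverse_cancel _ h0.2, fun t ht ↦ ?_⟩
    have := hΦ t ⟨by linarith [ht.1], by linarith [ht.2]⟩
    exact ⟨this.1.mul_const _, this.2.mul h0.2.ringInverse⟩
  choose Φ h0 hΦ using h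
  have agree : ∀ n m : ℕ, n ≤ m → ∀ t ∈ Ioo (-(n + 1) : ℝ) (n + 1), Φ m t = Φ n t := by
    intro n m hnm t ht
    have hnm' : (n : ℝ) ≤ m := by exact_mod_cast hnm
    have hn : (0 : ℝ) ≤ n := n.cast_nonneg
    have := eq_of_isParallelAt isOpen_Ioo isPreconnected_Ioo (hΦ n)
      (fun s hs ↦ (hΦ m s ⟨by linarith [hs.1], by linarith [hs.2]⟩).1)
      (b := 0) ⟨by linarith, by linarith⟩ ht
    simpa [h0] using this
  -- The frames on the growing intervals are all `1` at `0`, so they agree where they overlap. The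
  -- index `⌈|t|⌉₊` selects one whose interval contains a neighbourhood of `t`.
  refine ⟨fun t ↦ Φ ⌈|t|⌉₊ t, by simp [h0], fun t ↦ ?_⟩
  have hmem : ∀ s : ℝ, s ∈ Ioo (-(⌈|s|⌉₊ + 1) : ℝ) (⌈|s|⌉₊ + 1) := fun s ↦
    abs_lt.1 (by linarith [Nat.le_ceil |s|])
  have := hΦ _ t (hmem t)
  refine ⟨this.1.congr ?_, this.2⟩
  filter_upwards [Ioo_mem_nhds (hmem t).1 (hmem t).2] with s hs
  rcases le_total ⌈|s|⌉₊ ⌈|t|⌉₊ with h | h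
  · exact (agree _ _ h s (hmem s)).symm
  · exact agree _ _ h s hs

omit [CompleteSpace R] in
theorem contDiffOn_frame {Φ : ℝ → R} (hΦ : ∀ t, c.IsParallelAt Φ t) (i : ι) :
    ContDiffOn ℝ ∞ (fun t ↦ c.τ i t * Φ t) (c.dom i) :=
  contDiffOn_of_hasDerivAt_linear (c.isOpen i) (c.contDiffOn i).neg fun t ht ↦ hΦ t i ht

end LineConnection

/-- The fundamental solution of a linear ordinary differential equation. -/
theorem exists_fundamental_solution [CompleteSpace R] {L : ℝ → R} (hL : ContDiff ℝ ∞ L) :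
    ∃ X : ℝ → R, X 0 = 1 ∧ ContDiff ℝ ∞ X ∧ (∀ t, IsUnit (X t)) ∧
      (∀ t, HasDerivAt X (L t * X t) t) ∧
      ∀ Z : ℝ → R, (∀ t, HasDerivAt Z (L t * Z t) t) → ∀ t, Z t = X t * Z 0 := by
  let c : LineConnection R Unit :=
    { dom := fun _ ↦ univ
      τ := fun _ _ ↦ 1
      con := fun _ t ↦ -(L t)
      isOpen := fun _ ↦ isOpen_univ
      cover := fun _ ↦ ⟨(), mem_univ _⟩
      isUnit := fun _ _ _ ↦ isUnit_one
      contDiffOn := fun _ ↦ hL.neg.contDiffOn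
      trans := fun _ _ t _ _ ↦ by simpa using hasDerivAt_const t (1 : R) }
  have hc : ∀ Z t, c.IsParallelAt Z t ↔ HasDerivAt Z (L t * Z t) t := fun Z t ↦ by
    simp [LineConnection.IsParallelAt, c]
  obtain ⟨X, h0, hX⟩ := c.exists_frame
  refine ⟨X, h0, ?_, fun t ↦ (hX t).2, fun t ↦ (hc X t).1 (hX t).1, fun Z hZ t ↦ ?_⟩
  · have := c.contDiffOn_frame (fun t ↦ (hX t).1) ()
    simpa [c] using contDiffOn_univ.1 (by simpa [c] using this)
  · have := LineConnection.eq_of_isParallelAt (c := c) isOpen_univ isPreconnected_univ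
      (fun t _ ↦ hX t) (fun t _ ↦ (hc Z t).2 (hZ t)) (mem_univ 0) (mem_univ t)
    simpa [h0] using this

end Cocycle

end StationaryLorentz

namespace StationaryLorentz

/-! ## Functions of class `H¹` on the line -/

section Sobolev

set_option linter.unusedSectionVars false

open Filter Topology

variable {E : Type*} [NormedAddCommGroup E] [NormedSpace ℝ E]
  {F : Type*} [NormedAddCommGroup F] [NormedSpace ℝ F]

/-- A pointwise bound on increments sums to a bound on total increments over finite families of
intervals. Products, integrals and modifications by constants are all treated by such a comparison.
-/
theorem _root_.AbsolutelyContinuousOnInterval.of_dist_le {X Y Z : Type*} [PseudoMetricSpace X]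
    [PseudoMetricSpace Y] [PseudoMetricSpace Z] {f : ℝ → X} {h : ℝ → Y} {k : ℝ → Z} {a b K L : ℝ}
    (hh : AbsolutelyContinuousOnInterval h a b) (hk : AbsolutelyContinuousOnInterval k a b)
    (H : ∀ x ∈ uIcc a b, ∀ y ∈ uIcc a b,
      dist (f x) (f y) ≤ K * dist (h x) (h y) + L * dist (k x) (k y)) :
    AbsolutelyContinuousOnInterval f a b := by
  unfold AbsolutelyContinuousOnInterval at hh hk ⊢
  refine squeeze_zero' (Eventually.of_forall fun _ ↦ Finset.sum_nonneg fun _ _ ↦ dist_nonneg) ?_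
    (by simpa using (hh.const_mul K).add (hk.const_mul L))
  refine eventually_inf_principal.2 (Eventually.of_forall fun I hI ↦ ?_)
  rw [Finset.mul_sum, Finset.mul_sum, ← Finset.sum_add_distrib]
  exact Finset.sum_le_sum fun i hi ↦ H _ (hI.1 i hi).1 _ (hI.1 i hi).2

theorem _root_.AbsolutelyContinuousOnInterval.bilin {D : Type*} [NormedAddCommGroup D]
    [NormedSpace ℝ D] (B : D →L[ℝ] E →L[ℝ] F) {u : ℝ → D} {v : ℝ → E} {a b : ℝ}
    (hu : AbsolutelyContinuousOnInterval u a b) (hv : AbsolutelyContinuousOnInterval v a b) :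
    AbsolutelyContinuousOnInterval (fun t ↦ B (u t) (v t)) a b := by
  obtain ⟨C, hC⟩ := hu.exists_bound
  obtain ⟨C', hC'⟩ := hv.exists_bound
  refine hu.of_dist_le (K := ‖B‖ * C') (L := ‖B‖ * C) hv fun x hx y hy ↦ ?_
  have e : B (u x) (v x) - B (u y) (v y) = B (u x - u y) (v x) + B (u y) (v x - v y) := by
    simp
  rw [dist_eq_norm, dist_eq_norm, dist_eq_norm, e]
  refine (norm_add_le _ _).trans (add_le_add ?_ ?_)
  · refine (B.le_opNorm₂ _ _).trans ?_
    rw [mul_right_comm]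
    gcongr
    exact hC' x hx
  · refine (B.le_opNorm₂ _ _).trans ?_
    gcongr
    exact hC y hy

theorem _root_.AbsolutelyContinuousOnInterval.intervalIntegral {f : ℝ → E} {a b c : ℝ}
    (hf : IntervalIntegrable f volume a b) (hc : c ∈ uIcc a b) :
    AbsolutelyContinuousOnInterval (fun t ↦ ∫ s in c..t, f s) a b := by
  have hn := hf.norm.absolutelyContinuousOnInterval_intervalIntegral hc
  refine hn.of_dist_le (K := 1) (L := 0) hn fun x hx y hy ↦ ?_
  have hi : ∀ x ∈ uIcc a b, IntervalIntegrable f volume c x := fun x hx ↦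
    hf.mono_set (uIcc_subset_uIcc hc hx)
  rw [dist_eq_norm, Real.dist_eq, intervalIntegral.integral_interval_sub_left (hi x hx) (hi y hy),
    intervalIntegral.integral_interval_sub_left (hi x hx).norm (hi y hy).norm]
  simpa using intervalIntegral.norm_integral_le_abs_integral_norm

theorem _root_.AbsolutelyContinuousOnInterval.congr {f g : ℝ → E} {a b : ℝ}
    (hf : AbsolutelyContinuousOnInterval f a b) (h : EqOn g f (uIcc a b)) :
    AbsolutelyContinuousOnInterval g a b :=
  hf.of_dist_le (K := 1) (L := 0) hf fun x hx y hy ↦ by simp [h hx, h hy]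

theorem _root_.AbsolutelyContinuousOnInterval.ae_differentiableAt' [FiniteDimensional ℝ E]
    {f : ℝ → E} {a b : ℝ}
    (hf : AbsolutelyContinuousOnInterval f a b) :
    ∀ᵐ x : ℝ, x ∈ uIcc a b → DifferentiableAt ℝ f x :=
  hf.boundedVariationOn.ae_differentiableAt_of_mem_uIcc

theorem _root_.AbsolutelyContinuousOnInterval.eq_add_integral_deriv [FiniteDimensional ℝ E]
    {f : ℝ → E} {a b : ℝ}
    (hf : AbsolutelyContinuousOnInterval f a b) (hi : IntervalIntegrable (deriv f) volume a b)
    {x : ℝ} (hx : x ∈ uIcc a b) : f x = f a + ∫ t in a..x, deriv f t := by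
  have := FiniteDimensional.complete ℝ E
  obtain ⟨C, hC⟩ := (hf.sub (AbsolutelyContinuousOnInterval.intervalIntegral hi
    left_mem_uIcc)).const_of_ae_hasDerivAt_zero (by
      filter_upwards [hf.ae_differentiableAt', hi.ae_hasDerivAt_integral] with x h1 h2 hx
      have := (h1 hx).hasDerivAt.sub (h2 hx a left_mem_uIcc)
      simpa using this)
  have h1 := hC x hx
  have h2 := hC a left_mem_uIcc
  simp only [Pi.sub_apply, intervalIntegral.integral_same, sub_zero] at h1 h2
  rw [h2, ← h1]
  abel

theorem memLp_union {f : ℝ → E} {s t : Set ℝ} (hs : MemLp f 2 (volume.restrict s))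
    (ht : MemLp f 2 (volume.restrict t)) : MemLp f 2 (volume.restrict (s ∪ t)) := by
  have hm : AEStronglyMeasurable f (volume.restrict (s ∪ t)) :=
    aestronglyMeasurable_union_iff.2 ⟨hs.1, ht.1⟩
  rw [memLp_two_iff_integrable_sq_norm hm]
  exact IntegrableOn.union ((memLp_two_iff_integrable_sq_norm hs.1).1 hs)
    ((memLp_two_iff_integrable_sq_norm ht.1).1 ht)

theorem MemLp.restrict_mono {f : ℝ → E} {s t : Set ℝ} (ht : MemLp f 2 (volume.restrict t))
    (h : s ⊆ t) : MemLp f 2 (volume.restrict s) :=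
  ht.mono_measure (Measure.restrict_mono h le_rfl)

/-- Compactness of `[a, b]`: square integrability passes to subsets and to finite unions. -/
theorem memLp_of_locally {f : ℝ → E}
    (h : ∀ t, ∃ ε > 0, MemLp f 2 (volume.restrict (Icc (t - ε) (t + ε)))) (a b : ℝ) :
    MemLp f 2 (volume.restrict (Icc a b)) := by
  refine isCompact_Icc.induction_on (p := fun s ↦ MemLp f 2 (volume.restrict s)) (by simp)
    (fun s t hst ht ↦ MemLp.restrict_mono ht hst) (fun s t ↦ memLp_union) fun t _ ↦ ?_
  obtain ⟨ε, hε, H⟩ := h t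
  exact ⟨_, mem_nhdsWithin_of_mem_nhds (Icc_mem_nhds (by linarith) (by linarith)), H⟩

theorem MemLp.intervalIntegrable {f : ℝ → E} {a b : ℝ} (hab : a ≤ b)
    (h : MemLp f 2 (volume.restrict (Icc a b))) : IntervalIntegrable f volume a b := by
  rw [intervalIntegrable_iff_integrableOn_Icc_of_le hab]
  exact h.integrable one_le_two

theorem MemLp.clm_apply_of_continuousOn {Ψ : ℝ → E →L[ℝ] F} {f : ℝ → E} {a b : ℝ}
    (hΨ : ContinuousOn Ψ (Icc a b)) (hf : MemLp f 2 (volume.restrict (Icc a b))) :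
    MemLp (fun t ↦ Ψ t (f t)) 2 (volume.restrict (Icc a b)) := by
  obtain ⟨C, hC⟩ := isCompact_Icc.exists_bound_of_continuousOn hΨ
  have hm : AEStronglyMeasurable Ψ (volume.restrict (Icc a b)) :=
    hΨ.aestronglyMeasurable measurableSet_Icc
  refine hf.of_le_mul (c := C)
    ((ContinuousLinearMap.id ℝ (E →L[ℝ] F)).aestronglyMeasurable_comp₂ hm hf.1) ?_
  filter_upwards [ae_restrict_mem measurableSet_Icc] with t ht
  exact (Ψ t).le_of_opNorm_le (hC t ht) _

theorem _root_.ContinuousOn.memLp_two {f : ℝ → E} {a b : ℝ} (hf : ContinuousOn f (Icc a b)) :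
    MemLp f 2 (volume.restrict (Icc a b)) := by
  obtain ⟨C, hC⟩ := isCompact_Icc.exists_bound_of_continuousOn hf
  refine MemLp.of_bound (hf.aestronglyMeasurable measurableSet_Icc) C ?_
  filter_upwards [ae_restrict_mem measurableSet_Icc] with t ht using hC t ht

/-- `f` is of class `H¹` near `t₀`. -/
def IsH1At (f : ℝ → E) (t₀ : ℝ) : Prop :=
  ∃ ε > 0, AbsolutelyContinuousOnInterval f (t₀ - ε) (t₀ + ε) ∧
    MemLp (deriv f) 2 (volume.restrict (Icc (t₀ - ε) (t₀ + ε)))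

theorem IsH1At.exists_small {f : ℝ → E} {t₀ : ℝ} (h : IsH1At f t₀) {S : Set ℝ} (hS : S ∈ 𝓝 t₀) :
    ∃ ε > 0, Icc (t₀ - ε) (t₀ + ε) ⊆ S ∧ AbsolutelyContinuousOnInterval f (t₀ - ε) (t₀ + ε) ∧
    MemLp (deriv f) 2 (volume.restrict (Icc (t₀ - ε) (t₀ + ε))) := by
  obtain ⟨ε, hε, h1, h2⟩ := h
  obtain ⟨δ, hδ, hδS⟩ := Metric.nhds_basis_closedBall.mem_iff.1 hS
  rw [Real.closedBall_eq_Icc] at hδS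
  have hm : 0 < min ε δ := lt_min hε hδ
  have hl := min_le_left ε δ
  have hr := min_le_right ε δ
  refine ⟨min ε δ, hm, fun t ht ↦ hδS ⟨by linarith [ht.1], by linarith [ht.2]⟩, h1.mono ?_,
    MemLp.restrict_mono h2 (Icc_subset_Icc (by linarith) (by linarith))⟩
  rw [uIcc_of_le (by linarith), uIcc_of_le (by linarith)]
  exact Icc_subset_Icc (by linarith) (by linarith)

theorem IsH1At.congr {f g : ℝ → E} {t₀ : ℝ} (hf : IsH1At f t₀) (h : g =ᶠ[𝓝 t₀] f) :
    IsH1At g t₀ := by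
  obtain ⟨ε, hε, hS, h1, h2⟩ := hf.exists_small (eventually_eventually_nhds.2 h)
  refine ⟨ε, hε, h1.congr fun t ht ↦ ?_, h2.ae_eq ?_⟩
  · rw [uIcc_of_le (by linarith)] at ht
    exact (hS ht).self_of_nhds
  · filter_upwards [ae_restrict_mem measurableSet_Icc] with t ht
    exact (Filter.EventuallyEq.deriv_eq (hS ht)).symm

/-- Lebesgue differentiation identifies the derivative of the primitive with `q` almost everywhere.
Functions of class `H¹` with a prescribed square integrable derivative are recognized in this way.
-/
theorem IsH1At.of_integral [FiniteDimensional ℝ E] {f q : ℝ → E} {t₀ a b : ℝ} (ha : a < t₀)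
    (hb : t₀ < b) (hq : MemLp q 2 (volume.restrict (Icc a b)))
    (hf : ∀ t ∈ Icc a b, f t = f a + ∫ s in a..t, q s) :
    IsH1At f t₀ ∧ ∀ᵐ t : ℝ, t ∈ Ioo a b → HasDerivAt f (q t) t := by
  have := FiniteDimensional.complete ℝ E
  have hab : a ≤ b := by linarith
  have hi := MemLp.intervalIntegrable hab hq
  have had : ∀ᵐ t : ℝ, t ∈ Ioo a b → HasDerivAt f (q t) t := by
    filter_upwards [hi.ae_hasDerivAt_integral] with t ht htm
    have h1 := ht (by rw [uIcc_of_le hab]; exact Ioo_subset_Icc_self htm) a left_mem_uIcc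
    refine (h1.const_add (f a)).congr_of_eventuallyEq ?_
    filter_upwards [Icc_mem_nhds htm.1 htm.2] with s hs using hf s hs
  refine ⟨?_, had⟩
  have hac : AbsolutelyContinuousOnInterval f a b :=
    (AbsolutelyContinuousOnInterval.intervalIntegral hi left_mem_uIcc).of_dist_le (K := 1) (L := 0)
      (AbsolutelyContinuousOnInterval.intervalIntegral hi left_mem_uIcc) fun x hx y hy ↦ by
        rw [uIcc_of_le hab] at hx hy
        rw [hf x hx, hf y hy]; simp
  set ε := min (t₀ - a) (b - t₀) / 2 with hε
  have h0 : 0 < min (t₀ - a) (b - t₀) := lt_min (by linarith) (by linarith)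
  have hl := min_le_left (t₀ - a) (b - t₀)
  have hr := min_le_right (t₀ - a) (b - t₀)
  refine ⟨ε, by positivity, hac.mono ?_, (MemLp.restrict_mono hq ?_).ae_eq ?_⟩
  · rw [uIcc_of_le (by linarith), uIcc_of_le hab]
    exact Icc_subset_Icc (by linarith) (by linarith)
  · exact Icc_subset_Icc (by linarith) (by linarith)
  · filter_upwards [ae_restrict_mem measurableSet_Icc, ae_restrict_of_ae had] with t ht h1
    exact (h1 ⟨by linarith [ht.1], by linarith [ht.2]⟩).deriv.symm

/-- Product rule almost everywhere: near `t₀` both `Ψ` and `Ψ'` are bounded and `f` is continuous.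
This makes the class `H¹` independent of the choice of smooth frame. -/
theorem IsH1At.clm_apply [FiniteDimensional ℝ E] {Ψ : ℝ → E →L[ℝ] F} {f : ℝ → E} {t₀ : ℝ}
    {S : Set ℝ} (hS : IsOpen S)
    (ht₀ : t₀ ∈ S) (hΨ : ContDiffOn ℝ ∞ Ψ S) (hf : IsH1At f t₀) :
    IsH1At (fun t ↦ Ψ t (f t)) t₀ := by
  obtain ⟨ε, hε, hsub, h1, h2⟩ := hf.exists_small (hS.mem_nhds ht₀)
  have hle : t₀ - ε ≤ t₀ + ε := by linarith
  have hd : ∀ t ∈ S, DifferentiableAt ℝ Ψ t := fun t ht ↦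
    (hΨ.contDiffAt (hS.mem_nhds ht)).differentiableAt (by simp)
  have hc : ContinuousOn (deriv Ψ) S := hΨ.continuousOn_deriv_of_isOpen hS (by simp)
  have hac : AbsolutelyContinuousOnInterval Ψ (t₀ - ε) (t₀ + ε) := by
    refine ContDiffOn.absolutelyContinuousOnInterval ((hΨ.of_le (by exact_mod_cast le_top)).mono ?_)
    rwa [uIcc_of_le hle]
  have hf1 : ContinuousOn f (Icc (t₀ - ε) (t₀ + ε)) := by
    simpa [uIcc_of_le hle] using h1.continuousOn
  have h3 : AbsolutelyContinuousOnInterval (fun t ↦ Ψ t (f t)) (t₀ - ε) (t₀ + ε) :=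
    hac.bilin (ContinuousLinearMap.id ℝ (E →L[ℝ] F)) h1
  have h4 : MemLp (fun t ↦ deriv Ψ t (f t)) 2 (volume.restrict (Icc (t₀ - ε) (t₀ + ε))) :=
    ((hc.mono hsub).clm_apply hf1).memLp_two
  have h5 : MemLp (fun t ↦ Ψ t (deriv f t)) 2 (volume.restrict (Icc (t₀ - ε) (t₀ + ε))) :=
    MemLp.clm_apply_of_continuousOn (hΨ.continuousOn.mono hsub) h2
  refine ⟨ε, hε, h3, (h4.add h5).ae_eq ?_⟩
  filter_upwards [ae_restrict_mem measurableSet_Icc, ae_restrict_of_ae h1.ae_differentiableAt']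
    with t ht hft
  rw [uIcc_of_le hle] at hft
  exact ((hd t (hsub ht)).hasDerivAt.clm_apply (hft ht).hasDerivAt).deriv.symm

theorem IsH1At.of_contDiffOn {f : ℝ → E} {t₀ : ℝ} {S : Set ℝ} (hS : IsOpen S) (ht₀ : t₀ ∈ S)
    (hf : ContDiffOn ℝ ∞ f S) : IsH1At f t₀ := by
  obtain ⟨δ, hδ, hsub⟩ := Metric.nhds_basis_closedBall.mem_iff.1 (hS.mem_nhds ht₀)
  rw [Real.closedBall_eq_Icc] at hsub
  refine ⟨δ, hδ, ContDiffOn.absolutelyContinuousOnInterval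
    ((hf.of_le (by exact_mod_cast le_top)).mono (by rwa [uIcc_of_le (by linarith)])),
    ((hf.continuousOn_deriv_of_isOpen hS (by simp)).mono hsub).memLp_two⟩

variable [FiniteDimensional ℝ E] {f : ℝ → E} (hf : ∀ t, IsH1At f t)
include hf

theorem IsH1At.ae_differentiableAt : ∀ᵐ t : ℝ, DifferentiableAt ℝ f t := by
  refine measure_null_of_locally_null _ fun t _ ↦ ?_
  obtain ⟨ε, hε, h1, h2⟩ := hf t
  refine ⟨{t | ¬DifferentiableAt ℝ f t} ∩ Icc (t - ε) (t + ε), inter_mem_nhdsWithin _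
    (Icc_mem_nhds (by linarith) (by linarith)), ?_⟩
  have := h1.ae_differentiableAt'
  rw [uIcc_of_le (by linarith)] at this
  refine measure_mono_null (fun s hs ↦ ?_) (ae_iff.1 this)
  simp only [mem_ofPred_eq, Classical.not_imp]
  exact ⟨hs.2, hs.1⟩

theorem IsH1At.memLp_deriv (a b : ℝ) : MemLp (deriv f) 2 (volume.restrict (Icc a b)) :=
  memLp_of_locally (fun t ↦ by obtain ⟨ε, hε, _, h2⟩ := hf t; exact ⟨ε, hε, h2⟩) a b

theorem IsH1At.intervalIntegrable_deriv (a b : ℝ) : IntervalIntegrable (deriv f) volume a b := by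
  rcases le_total a b with h | h
  · exact MemLp.intervalIntegrable h (IsH1At.memLp_deriv hf a b)
  · exact (MemLp.intervalIntegrable h (IsH1At.memLp_deriv hf b a)).symm

theorem IsH1At.eq_add_integral (a b : ℝ) : f b = f a + ∫ t in a..b, deriv f t := by
  have := FiniteDimensional.complete ℝ E
  have hi := IsH1At.intervalIntegrable_deriv hf
  -- The local fundamental theorem of calculus makes `φ` locally constant, and the line is
  -- connected; no subdivision of `[a, b]` is needed.
  set φ : ℝ → E := fun t ↦ f t - ∫ s in a..t, deriv f s with hφ
  have hd : ∀ t, HasDerivAt φ 0 t := fun t ↦ by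
    obtain ⟨ε, hε, h1, h2⟩ := hf t
    refine (hasDerivAt_const t (φ t)).congr_of_eventuallyEq ?_
    filter_upwards [Icc_mem_nhds (show t - ε < t by linarith) (show t < t + ε by linarith)] with s hs
    have h3 : ∀ x ∈ Icc (t - ε) (t + ε), f x = f (t - ε) + ∫ r in (t - ε)..x, deriv f r :=
      fun x hx ↦ h1.eq_add_integral_deriv (hi _ _) (by rwa [uIcc_of_le (by linarith)])
    have h4 := h3 s hs
    have h5 := h3 t ⟨by linarith, by linarith⟩
    simp only [hφ]
    rw [h4, h5, ← intervalIntegral.integral_add_adjacent_intervals (hi a (t - ε)) (hi (t - ε) s),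
      ← intervalIntegral.integral_add_adjacent_intervals (hi a (t - ε)) (hi (t - ε) t)]
    abel
  have := is_const_of_deriv_eq_zero (fun t ↦ (hd t).differentiableAt) (fun t ↦ (hd t).deriv) b a
  simp only [hφ, intervalIntegral.integral_same, sub_zero] at this
  rw [← this]
  abel

theorem IsH1At.absolutelyContinuousOnInterval (a b : ℝ) : AbsolutelyContinuousOnInterval f a b := by
  have h := AbsolutelyContinuousOnInterval.intervalIntegral
    (IsH1At.intervalIntegrable_deriv hf a b) left_mem_uIcc
  refine h.of_dist_le (K := 1) (L := 0) h fun x _ y _ ↦ ?_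
  rw [IsH1At.eq_add_integral hf a x, IsH1At.eq_add_integral hf a y]
  simp

theorem IsH1At.continuous : Continuous f := by
  refine continuous_iff_continuousAt.2 fun t ↦ ?_
  have := (IsH1At.absolutelyContinuousOnInterval hf (t - 1) (t + 1)).continuousOn
  rw [uIcc_of_le (by linarith)] at this
  exact this.continuousAt (Icc_mem_nhds (by linarith) (by linarith))

omit hf [FiniteDimensional ℝ E] in
/-- The fundamental theorem of calculus for bilinear expressions in absolutely continuous
functions. -/
theorem integral_bilin_deriv [FiniteDimensional ℝ E] [FiniteDimensional ℝ F]
    (B : E →L[ℝ] F →L[ℝ] ℝ) {u u' : ℝ → E} {v v' : ℝ → F} {a b : ℝ}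
    (hu : AbsolutelyContinuousOnInterval u a b) (hv : AbsolutelyContinuousOnInterval v a b)
    (hu' : ∀ᵐ t : ℝ, t ∈ uIoc a b → HasDerivAt u (u' t) t)
    (hv' : ∀ᵐ t : ℝ, t ∈ uIoc a b → HasDerivAt v (v' t) t) :
    ∫ t in a..b, (B (u' t) (v t) + B (u t) (v' t)) = B (u b) (v b) - B (u a) (v a) := by
  rw [← (hu.bilin B hv).integral_deriv_eq_sub]
  refine intervalIntegral.integral_congr_ae ?_
  filter_upwards [hu', hv'] with t h1 h2 ht
  have := (((hasDerivAt_const t B).clm_apply (h1 ht)).clm_apply (h2 ht)).deriv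
  simp only [zero_apply, zero_add] at this
  exact this.symm

end Sobolev

end StationaryLorentz

namespace StationaryLorentz

/-! ## Second order linear systems with twisted periodicity -/

section Twisted

open Filter Topology

variable {E : Type*} [NormedAddCommGroup E] [NormedSpace ℝ E] [FiniteDimensional ℝ E]

/-- Existence and uniqueness for `z'' = A z`; `S t` maps `(z 0, z' 0)` to `(z t, z' t)`. -/
theorem exists_second_order_flow {A : ℝ → E →L[ℝ] E} (hA : ContDiff ℝ ∞ A) :
    ∃ S : ℝ → E × E →L[ℝ] E × E, S 0 = 1 ∧ ContDiff ℝ ∞ S ∧ (∀ t, IsUnit (S t)) ∧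
      (∀ t p, HasDerivAt (fun s ↦ (S s p).1) (S t p).2 t ∧
        HasDerivAt (fun s ↦ (S s p).2) (A t (S t p).1) t) ∧
      ∀ (z z' : ℝ → E) (I : Set ℝ), Convex ℝ I → (0 : ℝ) ∈ I →
        (∀ t ∈ I, HasDerivAt z (z' t) t ∧ HasDerivAt z' (A t (z t)) t) →
        ∀ t ∈ I, (z t, z' t) = S t (z 0, z' 0) := by
  have := FiniteDimensional.complete ℝ E
  let L : ℝ → E × E →L[ℝ] E × E := fun t ↦
    ContinuousLinearMap.inl ℝ E E ∘L ContinuousLinearMap.snd ℝ E E +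
      ContinuousLinearMap.inr ℝ E E ∘L (A t ∘L ContinuousLinearMap.fst ℝ E E)
  have hL : ContDiff ℝ ∞ L :=
    contDiff_const.add (contDiff_const.clm_comp (hA.clm_comp contDiff_const))
  have hLa : ∀ t p, L t p = (p.2, A t p.1) := fun t p ↦ by simp [L]
  obtain ⟨S, h0, hS, hu, hd, -⟩ := exists_fundamental_solution hL
  have hSp : ∀ t p, HasDerivAt (fun s ↦ S s p) (L t (S t p)) t := fun t p ↦ by
    simpa using (hd t).clm_apply (hasDerivAt_const t p)
  refine ⟨S, h0, hS, hu, fun t p ↦ ⟨?_, ?_⟩, fun z z' I hI h0I hz t ht ↦ ?_⟩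
  · have := (ContinuousLinearMap.fst ℝ E E).hasFDerivAt.comp_hasDerivAt t (hSp t p)
    rw [hLa] at this
    exact this
  · have := (ContinuousLinearMap.snd ℝ E E).hasFDerivAt.comp_hasDerivAt t (hSp t p)
    rw [hLa] at this
    exact this
  · set x : ℝ → E × E := fun s ↦ (z s, z' s)
    have hx : ∀ s ∈ I, HasDerivAt x (L s (x s)) s := fun s hs ↦ by
      rw [hLa]; exact (hz s hs).1.prodMk (hz s hs).2
    -- Variation of constants: `S⁻¹ x` has derivative zero. A convex `I` is allowed because the
    -- solutions met later are at first known to solve the equation only on `[0, 1]`.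
    have hc : ∀ s ∈ I, HasDerivWithinAt (fun r ↦ Ring.inverse (S r) (x r)) 0 I s := fun s hs ↦ by
      have h1 := ((hd s).ringInverse (hu s)).clm_apply (hx s hs)
      refine (h1.congr_deriv ?_).hasDerivWithinAt
      have e : Ring.inverse (S s) * (L s * S s) * Ring.inverse (S s) = Ring.inverse (S s) * L s := by
        rw [mul_assoc, mul_assoc, Ring.mul_inverse_cancel _ (hu s), mul_one]
      rw [e]
      simp
    have := hI.norm_image_sub_le_of_norm_hasDerivWithin_le (C := 0) hc (by simp) h0I ht
    simp only [zero_mul, norm_le_zero_iff, sub_eq_zero, h0, Ring.inverse_one] at this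
    have h2 : S t (Ring.inverse (S t) (x t)) = x t := by
      rw [← mul_apply_eq_comp, Ring.mul_inverse_cancel _ (hu t)]; rfl
    rw [this] at h2
    exact h2.symm

theorem IsH1At.sub {f g : ℝ → E} {t₀ : ℝ} (hf : IsH1At f t₀) (hg : IsH1At g t₀) :
    IsH1At (fun t ↦ f t - g t) t₀ := by
  obtain ⟨ε, hε, h1, h2⟩ := hf
  obtain ⟨δ, hδ, -, h3, h4⟩ := hg.exists_small (Icc_mem_nhds (show t₀ - ε < t₀ by linarith)
    (show t₀ < t₀ + ε by linarith))
  have hm : 0 < min ε δ := lt_min hε hδ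
  have hl := min_le_left ε δ
  have hr := min_le_right ε δ
  have hac1 : AbsolutelyContinuousOnInterval f (t₀ - min ε δ) (t₀ + min ε δ) := h1.mono (by
    rw [uIcc_of_le (by linarith), uIcc_of_le (by linarith)]
    exact Icc_subset_Icc (by linarith) (by linarith))
  have hac2 : AbsolutelyContinuousOnInterval g (t₀ - min ε δ) (t₀ + min ε δ) := h3.mono (by
    rw [uIcc_of_le (by linarith), uIcc_of_le (by linarith)]
    exact Icc_subset_Icc (by linarith) (by linarith))
  refine ⟨min ε δ, hm, hac1.sub hac2, MemLp.ae_eq ?_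
    ((MemLp.restrict_mono h2 (Icc_subset_Icc (by linarith) (by linarith))).sub
    (MemLp.restrict_mono h4 (Icc_subset_Icc (by linarith) (by linarith))))⟩
  filter_upwards [ae_restrict_mem measurableSet_Icc, ae_restrict_of_ae hac1.ae_differentiableAt',
    ae_restrict_of_ae hac2.ae_differentiableAt'] with t ht hf' hg'
  rw [uIcc_of_le (by linarith)] at hf' hg'
  exact ((hf' ht).hasDerivAt.sub (hg' ht).hasDerivAt).deriv.symm

omit [FiniteDimensional ℝ E] in
theorem MemLp.intervalIntegrable_bilin {F : Type*} [NormedAddCommGroup F] [NormedSpace ℝ F]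
    (B : E →L[ℝ] F →L[ℝ] ℝ) {f : ℝ → E} {g : ℝ → F}
    {a b : ℝ} (hab : a ≤ b) (hf : MemLp f 2 (volume.restrict (Icc a b)))
    (hg : MemLp g 2 (volume.restrict (Icc a b))) :
    IntervalIntegrable (fun t ↦ B (f t) (g t)) volume a b := by
  rw [intervalIntegrable_iff_integrableOn_Icc_of_le hab]
  have h := (hf.norm.integrable_mul hg.norm).const_mul ‖B‖
  refine h.mono' (B.aestronglyMeasurable_comp₂ hf.1 hg.1) (Eventually.of_forall fun t ↦ ?_)
  refine (B.le_opNorm₂ _ _).trans (le_of_eq ?_)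
  simp [mul_assoc]

/-- A function of class `H¹` on `[0, 1]` with `w 1 = H (w 0)` extends to a twisted periodic function
on the line. -/
theorem exists_twisted_extension (H : E ≃L[ℝ] E) (w₀ : E) {q : ℝ → E}
    (hq : MemLp q 2 (volume.restrict (Icc 0 1))) (hw : w₀ + ∫ s in (0 : ℝ)..1, q s = H w₀) :
    ∃ w : ℝ → E, (∀ t, IsH1At w t) ∧ (∀ t, w (t + 1) = H (w t)) ∧
      (∀ t ∈ Icc (0 : ℝ) 1, w t = w₀ + ∫ s in (0 : ℝ)..t, q s) ∧
      ∀ᵐ t : ℝ, t ∈ Ioo (0 : ℝ) 1 → HasDerivAt w (q t) t := by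
  have := FiniteDimensional.complete ℝ E
  have hqi := MemLp.intervalIntegrable zero_le_one hq
  set u : ℝ → E := fun t ↦ w₀ + ∫ s in (0 : ℝ)..t, q s with hu
  -- The piece on `[0, 1]` is shifted by `n` and transported by `H ^ n`; the hypothesis `u 1 = H (u
  -- 0)` makes consecutive pieces match at the integers.
  set w : ℝ → E := fun t ↦ (H ^ ⌊t⌋) (u (Int.fract t)) with hwd
  have hzs : ∀ (n : ℤ) x, (H ^ (n + 1)) x = (H ^ n) (H x) := fun n x ↦ by
    rw [zpow_add_one]; rfl
  have hu0 : u 0 = w₀ := by simp [hu]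
  have hpiece : ∀ (n : ℤ) (t : ℝ), t ∈ Icc (n : ℝ) (n + 1) → w t = (H ^ n) (u (t - n)) := by
    intro n t ht
    rcases lt_or_eq_of_le ht.2 with h | h
    · have : ⌊t⌋ = n := Int.floor_eq_iff.2 ⟨ht.1, h⟩
      simp only [hwd, Int.fract, this]
    · have h1 : ⌊t⌋ = n + 1 := by rw [h]; simp
      have h2 : Int.fract t = 0 := by rw [Int.fract, h1, h]; simp
      have h3 : t - n = 1 := by rw [h]; ring
      have h4 : u 1 = H w₀ := hw
      simp only [hwd, h1, h2, h3, hzs, hu0, h4]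
  have hint : ∀ (n : ℤ) (a t : ℝ), (n : ℝ) ≤ a → a ≤ t → t ≤ n + 1 →
      w t = w a + ∫ s in a..t, (H ^ n) (q (s - n)) := by
    intro n a t ha hat ht
    have hsub : ∀ x ∈ Icc (0 : ℝ) 1, ∀ y ∈ Icc (0 : ℝ) 1, IntervalIntegrable q volume x y :=
      fun x hx y hy ↦ hqi.mono_set (uIcc_subset_uIcc (by rwa [uIcc_of_le zero_le_one])
        (by rwa [uIcc_of_le zero_le_one]))
    have ha' : a - n ∈ Icc (0 : ℝ) 1 := ⟨by linarith, by linarith⟩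
    have ht' : t - n ∈ Icc (0 : ℝ) 1 := ⟨by linarith, by linarith⟩
    rw [hpiece n t ⟨by linarith, ht⟩, hpiece n a ⟨ha, by linarith⟩,
      intervalIntegral.integral_comp_sub_right (fun s ↦ (H ^ n) (q s)),
      show (∫ x in (a - n)..(t - n), (H ^ n) (q x)) = (H ^ n) (∫ x in (a - n)..(t - n), q x) from
        ((H ^ n : E ≃L[ℝ] E) : E →L[ℝ] E).intervalIntegral_comp_comm (hsub _ ha' _ ht'), ← map_add]
    simp only [hu]
    rw [add_assoc, intervalIntegral.integral_add_adjacent_intervals (hsub 0 (by simp) _ ha')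
      (hsub _ ha' _ ht')]
  have hmem : ∀ n : ℤ, MemLp (fun s ↦ (H ^ n) (q (s - n))) 2
      (volume.restrict (Icc (n : ℝ) (n + 1))) := by
    intro n
    have hp := (measurePreserving_sub_right volume (n : ℝ)).restrict_preimage
      (measurableSet_Icc (a := (0 : ℝ)) (b := 1))
    have e : (fun x : ℝ ↦ x - n) ⁻¹' Icc 0 1 = Icc (n : ℝ) (n + 1) := by
      ext x; simp [add_comm]
    rw [e] at hp
    exact ((H ^ n : E ≃L[ℝ] E) : E →L[ℝ] E).comp_memLp' (hq.comp_measurePreserving hp)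
  refine ⟨w, fun t₀ ↦ ?_, fun t ↦ ?_, fun t ht ↦ ?_, ?_⟩
  · set n := ⌊t₀⌋ with hn
    -- A derivative valid on both sides of `n = ⌊t₀⌋`, needed when `t₀` is itself an integer: the
    -- formulas of the two adjacent pieces are joined at `n`.
    set p : ℝ → E := fun s ↦ if s ≤ n then (H ^ (n - 1)) (q (s - (n - 1 : ℤ))) else
      (H ^ n) (q (s - n)) with hp
    have h1 : (n : ℝ) ≤ t₀ := Int.floor_le t₀
    have h2 : t₀ < n + 1 := Int.lt_floor_add_one t₀
    have hm1 : MemLp p 2 (volume.restrict (Icc ((n : ℝ) - 1) n)) := by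
      have := hmem (n - 1)
      push_cast at this
      rw [sub_add_cancel] at this
      refine this.ae_eq ?_
      filter_upwards [ae_restrict_mem measurableSet_Icc] with s hs
      simp [hp, hs.2]
    have hm2 : MemLp p 2 (volume.restrict (Ioc (n : ℝ) (n + 1))) := by
      refine (MemLp.restrict_mono (hmem n) Ioc_subset_Icc_self).ae_eq ?_
      filter_upwards [ae_restrict_mem measurableSet_Ioc] with s hs
      simp [hp, not_le.2 hs.1]
    have hm : MemLp p 2 (volume.restrict (Icc ((n : ℝ) - 1) (n + 1))) := by
      have := memLp_union hm1 hm2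
      rwa [Icc_union_Ioc_eq_Icc (by linarith) (by linarith)] at this
    have hpi := MemLp.intervalIntegrable (by linarith) hm
    have hl : ∀ t ∈ Icc ((n : ℝ) - 1) n, w t = w (n - 1) + ∫ s in ((n : ℝ) - 1)..t, p s := by
      intro t ht
      rw [hint (n - 1) (n - 1) t (by push_cast; rfl) ht.1 (by push_cast; linarith [ht.2])]
      congr 1
      refine intervalIntegral.integral_congr_ae (Eventually.of_forall fun s hs ↦ ?_)
      rw [uIoc_of_le ht.1] at hs
      simp [hp, hs.2.trans ht.2]
    refine (IsH1At.of_integral (a := n - 1) (b := n + 1) (by linarith) h2 hm fun t ht ↦ ?_).1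
    rcases le_total t n with h | h
    · exact hl t ⟨ht.1, h⟩
    · have hs1 : IntervalIntegrable p volume ((n : ℝ) - 1) n := hpi.mono_set (by
        rw [uIcc_of_le (by linarith), uIcc_of_le (by linarith)]
        exact Icc_subset_Icc le_rfl (by linarith))
      have hs2 : IntervalIntegrable p volume n t := hpi.mono_set (by
        rw [uIcc_of_le h, uIcc_of_le (by linarith)]
        exact Icc_subset_Icc (by linarith) ht.2)
      rw [← intervalIntegral.integral_add_adjacent_intervals hs1 hs2, ← add_assoc,
        ← hl n ⟨by linarith, le_rfl⟩, hint n n t le_rfl h ht.2]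
      congr 1
      refine intervalIntegral.integral_congr_ae (Eventually.of_forall fun s hs ↦ ?_)
      rw [uIoc_of_le h] at hs
      simp [hp, not_le.2 hs.1]
  · simp only [hwd, Int.floor_add_one, Int.fract_add_one]
    rw [add_comm, zpow_add, zpow_one]; rfl
  · have := hpiece 0 t (by simpa using ht)
    have h2 : w t = (1 : E ≃L[ℝ] E) (u t) := by simpa using this
    exact h2
  · have h := hint 0 0
    have hq' : MemLp q 2 (volume.restrict (Icc (0 : ℝ) 1)) := hq
    have := (IsH1At.of_integral (f := w) (t₀ := 1 / 2) (a := 0) (b := 1) (by norm_num) (by norm_num)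
      hq' fun t ht ↦ by
        have h2 : w t = w 0 + ∫ s in (0 : ℝ)..t, (1 : E ≃L[ℝ] E) (q s) := by
          simpa using h t (by simp) ht.1 (by simpa using ht.2)
        exact h2).2
    exact this

variable (E) in
/-- A linearized geodesic flow `z'' = A z` in a parallel frame with holonomy `H`, together with a
timelike solution `y` coming from a Killing field. -/
structure TwistedSystem where
  G : E →L[ℝ] E →L[ℝ] ℝ
  A : ℝ → E →L[ℝ] E
  H : E ≃L[ℝ] E
  y : ℝ → E
  y' : ℝ → E
  symm : ∀ a b, G a b = G b a
  nondeg : ∀ a, (∀ b, G a b = 0) → a = 0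
  isometry : ∀ a b, G (H a) (H b) = G a b
  contDiff_A : ContDiff ℝ ∞ A
  A_symm : ∀ t a b, G (A t a) b = G a (A t b)
  A_twist : ∀ t a, A (t + 1) (H a) = H (A t a)
  contDiff_y : ContDiff ℝ ∞ y
  hasDerivAt_y : ∀ t, HasDerivAt y (y' t) t
  hasDerivAt_y' : ∀ t, HasDerivAt y' (A t (y t)) t
  y_twist : ∀ t, y (t + 1) = H (y t)
  timelike : ∀ t, G (y t) (y t) < 0

/-! ### The constrained index form of a twisted system and its kernel -/

namespace TwistedSystem

variable (𝒯 : TwistedSystem E)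

/-- The twisted periodic functions of class `H¹`. -/
def loops : Set (ℝ → E) := {w | (∀ t, IsH1At w t) ∧ ∀ t, w (t + 1) = 𝒯.H (w t)}

/-- The linearized constraint. -/
def constrained : Set (ℝ → E) := {w | w ∈ 𝒯.loops ∧ ∃ C : ℝ, ∀ᵐ t : ℝ, t ∈ Icc (0 : ℝ) 1 →
  𝒯.G (deriv w t) (𝒯.y t) - 𝒯.G (w t) (𝒯.y' t) = C}

/-- The index form. -/
noncomputable def index (v w : ℝ → E) : ℝ :=
  ∫ t in (0 : ℝ)..1, (𝒯.G (deriv v t) (deriv w t) + 𝒯.G (𝒯.A t (v t)) (w t))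

omit [FiniteDimensional ℝ E] in
theorem continuous_y : Continuous 𝒯.y := 𝒯.contDiff_y.continuous

omit [FiniteDimensional ℝ E] in
theorem continuous_y' : Continuous 𝒯.y' :=
  continuous_iff_continuousAt.2 fun t ↦ (𝒯.hasDerivAt_y' t).continuousAt

omit [FiniteDimensional ℝ E] in
theorem ae_restrict_Ioo {P : ℝ → Prop} (h : ∀ᵐ t : ℝ, t ∈ Ioo (0 : ℝ) 1 → P t) :
    ∀ᵐ t : ℝ, t ∈ Icc (0 : ℝ) 1 → P t := by
  filter_upwards [h, compl_mem_ae_iff.2 (measure_singleton (0 : ℝ)),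
    compl_mem_ae_iff.2 (measure_singleton (1 : ℝ))] with t ht h0 h1 hm
  exact ht ⟨lt_of_le_of_ne hm.1 (Ne.symm h0), lt_of_le_of_ne hm.2 h1⟩

theorem ae_uIoc_of_Icc {P : ℝ → Prop} (h : ∀ᵐ t : ℝ, t ∈ Icc (0 : ℝ) 1 → P t) :
    ∀ᵐ t : ℝ, t ∈ uIoc (0 : ℝ) 1 → P t := by
  filter_upwards [h] with t ht hm
  rw [uIoc_of_le zero_le_one] at hm
  exact ht (Ioc_subset_Icc_self hm)

omit [FiniteDimensional ℝ E] in
/-- The correction that moves a test function into the constraint space along the Killing field. -/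
theorem exists_correction {κ : ℝ → ℝ} (hκm : MemLp κ 2 (volume.restrict (Icc 0 1))) :
    ∃ (c : ℝ) (μ l : ℝ → ℝ), MemLp μ 2 (volume.restrict (Icc 0 1)) ∧ (∀ t, IsH1At l t) ∧
      (∀ t, l (t + 1) = l t) ∧ l 0 = 0 ∧ l 1 = 0 ∧
      (∀ᵐ t : ℝ, t ∈ Ioo (0 : ℝ) 1 → HasDerivAt l (μ t) t) ∧
      ∀ t, μ t * 𝒯.G (𝒯.y t) (𝒯.y t) = κ t - c := by
  have hy := 𝒯.continuous_y
  set ρ : ℝ → ℝ := fun t ↦ (𝒯.G (𝒯.y t) (𝒯.y t))⁻¹ with hρ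
  have hρc : Continuous ρ := by
    refine Continuous.inv₀ ?_ fun t ↦ (𝒯.timelike t).ne
    exact (𝒯.G.continuous.comp hy).clm_apply hy
  have hρ0 : ∀ t, ρ t < 0 := fun t ↦ inv_neg''.2 (𝒯.timelike t)
  have hρi : ∫ t in (0 : ℝ)..1, ρ t ≠ 0 := by
    have := intervalIntegral.intervalIntegral_pos_of_pos (f := fun t ↦ -ρ t)
      (hρc.neg.intervalIntegrable 0 1) (fun t ↦ by linarith [hρ0 t]) zero_lt_one
    rw [intervalIntegral.integral_neg] at this
    linarith
  -- This weighted mean makes `μ = ρ (κ - c)` of mean zero, so that its primitive vanishes at both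
  -- ends and extends periodically. It is defined because `y` is timelike: `ρ < 0` forces `∫ ρ ≠ 0`.
  obtain ⟨c, hc⟩ : ∃ c : ℝ, c = (∫ t in (0 : ℝ)..1, ρ t * κ t) / ∫ t in (0 : ℝ)..1, ρ t := ⟨_, rfl⟩
  have hρκ : MemLp (fun t ↦ ρ t * κ t) 2 (volume.restrict (Icc 0 1)) := by
    have := MemLp.clm_apply_of_continuousOn (Ψ := fun t ↦ ContinuousLinearMap.mul ℝ ℝ (ρ t))
      ((ContinuousLinearMap.mul ℝ ℝ).continuous.comp hρc).continuousOn hκm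
    exact this
  have hρcc : Continuous fun t ↦ ρ t * c := hρc.mul continuous_const
  have hμm : MemLp (fun t ↦ ρ t * κ t - ρ t * c) 2 (volume.restrict (Icc 0 1)) :=
    hρκ.sub (ContinuousOn.memLp_two hρcc.continuousOn)
  have hμi : ∫ t in (0 : ℝ)..1, (ρ t * κ t - ρ t * c) = 0 := by
    rw [intervalIntegral.integral_sub (MemLp.intervalIntegrable zero_le_one hρκ)
      (hρcc.intervalIntegrable 0 1), intervalIntegral.integral_mul_const, hc]
    field_simp
    ring
  obtain ⟨l, hl1, hlt, hle, hld⟩ := exists_twisted_extension (1 : ℝ ≃L[ℝ] ℝ) 0 hμm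
    (by simp [hμi])
  refine ⟨c, _, l, hμm, hl1, hlt, by simpa using hle 0 (by simp), ?_, hld, fun t ↦ ?_⟩
  · rw [hle 1 (by simp), hμi, add_zero]
  · have hne := (𝒯.timelike t).ne
    simp only [hρ]
    field_simp

omit [FiniteDimensional ℝ E] in
theorem isH1At_smul {l : ℝ → ℝ} {t : ℝ} (hl : IsH1At l t) {y : ℝ → E} (hy : ContDiff ℝ ∞ y) :
    IsH1At (fun t ↦ l t • y t) t := by
  have hlc : ContDiff ℝ ∞
      (fun t ↦ (ContinuousLinearMap.lsmul ℝ ℝ : ℝ →L[ℝ] E →L[ℝ] E).flip (y t)) :=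
    (ContinuousLinearMap.flip (ContinuousLinearMap.lsmul ℝ ℝ : ℝ →L[ℝ] E →L[ℝ] E)).contDiff.comp hy
  have := IsH1At.clm_apply isOpen_univ (mem_univ t) hlc.contDiffOn hl
  exact this

/-- Test functions that need not satisfy the constraint. -/
theorem index_unconstrained {v : ℝ → E} (hv : v ∈ 𝒯.constrained)
    (hker : ∀ w ∈ 𝒯.constrained, 𝒯.index v w = 0) (w₀ : E) {q : ℝ → E}
    (hq : MemLp q 2 (volume.restrict (Icc 0 1))) (hw : w₀ + ∫ s in (0 : ℝ)..1, q s = 𝒯.H w₀) :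
    ∫ t in (0 : ℝ)..1, (𝒯.G (deriv v t) (q t) +
      𝒯.G (𝒯.A t (v t)) (w₀ + ∫ s in (0 : ℝ)..t, q s)) = 0 := by
  obtain ⟨⟨hv1, hvt⟩, C, hC⟩ := hv
  obtain ⟨W, hW1, hWt, hWe, hWd⟩ := exists_twisted_extension 𝒯.H w₀ hq hw
  have hy := 𝒯.continuous_y
  have hy' := 𝒯.continuous_y'
  have hvc := IsH1At.continuous hv1
  have hWc := IsH1At.continuous hW1
  obtain ⟨c, μ, l, hμm, hl1, hlt, hl0, hl1', hld, hμc⟩ := 𝒯.exists_correction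
    (κ := fun t ↦ 𝒯.G (q t) (𝒯.y t) - 𝒯.G (W t) (𝒯.y' t)) (by
      refine MemLp.sub ?_ (ContinuousOn.memLp_two ?_)
      · have : MemLp (fun t ↦ 𝒯.G.flip (𝒯.y t) (q t)) 2 (volume.restrict (Icc 0 1)) :=
          MemLp.clm_apply_of_continuousOn (𝒯.G.flip.continuous.comp hy).continuousOn hq
        exact this
      · exact ((𝒯.G.continuous.comp hWc).clm_apply hy').continuousOn)
  -- The linearized constraint of `l y` is `l' G(y, y)`, since the terms with undifferentiated `l`
  -- cancel. With `l' = μ` the constraint of `w` is therefore `κ - μ G(y, y) = c`.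
  set w : ℝ → E := fun t ↦ W t - l t • 𝒯.y t with hwdef
  have hwd : ∀ᵐ t : ℝ, t ∈ Icc (0 : ℝ) 1 →
      HasDerivAt w (q t - (μ t • 𝒯.y t + l t • 𝒯.y' t)) t := by
    refine ae_restrict_Ioo ?_
    filter_upwards [hWd, hld] with t h1 h2 ht
    refine ((h1 ht).sub ((h2 ht).smul (𝒯.hasDerivAt_y t))).congr_deriv ?_
    rw [add_comm (l t • _)]
  have hwc : w ∈ 𝒯.constrained := by
    refine ⟨⟨fun t ↦ (hW1 t).sub ?_, fun t ↦ ?_⟩, c, ?_⟩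
    · exact isH1At_smul (hl1 t) 𝒯.contDiff_y
    · simp only [hwdef, hWt, 𝒯.y_twist, hlt, map_sub, map_smul]
    · filter_upwards [hwd] with t h ht
      rw [(h ht).deriv]
      have := hμc t
      simp only [hwdef, map_sub, map_add, map_smul, sub_apply, add_apply, smul_apply, smul_eq_mul,
        𝒯.symm (𝒯.y' t) (𝒯.y t)]
      have e := 𝒯.symm (𝒯.y t) (𝒯.y' t)
      linarith
  have h0 := hker w hwc
  have hvd := IsH1At.ae_differentiableAt hv1
  set B := ContinuousLinearMap.mul ℝ ℝ
  -- By the constraint on `v`, `p = G(v', y)` almost everywhere, but `p` is absolutely continuous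
  -- and `p' = G(v', y') + G(v, A y)`. With `A` symmetric, the index integrand of `v` against `l y`
  -- is `(l p)'`, whose integral vanishes because `l 0 = l 1 = 0`.
  set p : ℝ → ℝ := fun t ↦ C + 𝒯.G (v t) (𝒯.y' t) with hp
  have hpac : AbsolutelyContinuousOnInterval p 0 1 := by
    have h1 := IsH1At.absolutelyContinuousOnInterval hv1 0 1
    have h2 : AbsolutelyContinuousOnInterval 𝒯.y' 0 1 := by
      refine ContDiffOn.absolutelyContinuousOnInterval (ContDiff.contDiffOn ?_)
      have : 𝒯.y' = deriv 𝒯.y := funext fun t ↦ (𝒯.hasDerivAt_y t).deriv.symm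
      rw [this]
      exact (contDiff_infty_iff_deriv.1 𝒯.contDiff_y).2.of_le (by exact_mod_cast le_top)
    refine (h1.bilin 𝒯.G h2).of_dist_le (K := 1) (L := 0) (h1.bilin 𝒯.G h2) fun x _ y _ ↦ ?_
    simp [hp]
  have hpd : ∀ᵐ t : ℝ, t ∈ uIoc (0 : ℝ) 1 →
      HasDerivAt p (𝒯.G (deriv v t) (𝒯.y' t) + 𝒯.G (v t) (𝒯.A t (𝒯.y t))) t := by
    filter_upwards [hvd] with t h _
    have := ((hasDerivAt_const t 𝒯.G).clm_apply h.hasDerivAt).clm_apply (𝒯.hasDerivAt_y' t)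
    simpa [hp] using this.const_add C
  have hfin := integral_bilin_deriv B (IsH1At.absolutelyContinuousOnInterval hl1 0 1) hpac
    (ae_uIoc_of_Icc (ae_restrict_Ioo hld)) hpd
  rw [hl0, hl1'] at hfin
  have hvm := IsH1At.memLp_deriv hv1 0 1
  have hyc : MemLp (fun t ↦ μ t • 𝒯.y t + l t • 𝒯.y' t) 2 (volume.restrict (Icc 0 1)) := by
    refine MemLp.add ?_ (((IsH1At.continuous hl1).smul hy').continuousOn.memLp_two)
    exact MemLp.clm_apply_of_continuousOn (Ψ := fun t ↦
      (ContinuousLinearMap.lsmul ℝ ℝ : ℝ →L[ℝ] E →L[ℝ] E).flip (𝒯.y t))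
      ((ContinuousLinearMap.lsmul ℝ ℝ : ℝ →L[ℝ] E →L[ℝ] E).flip.continuous.comp hy).continuousOn hμm
  have hAv : Continuous fun t ↦ 𝒯.G (𝒯.A t (v t)) :=
    𝒯.G.continuous.comp (𝒯.contDiff_A.continuous.clm_apply hvc)
  have hI1 : IntervalIntegrable (fun t ↦ 𝒯.G (deriv v t) (q t) + 𝒯.G (𝒯.A t (v t)) (W t))
      volume 0 1 := (MemLp.intervalIntegrable_bilin 𝒯.G zero_le_one hvm hq).add
    ((hAv.clm_apply hWc).intervalIntegrable _ _)
  have hI2 : IntervalIntegrable (fun t ↦ 𝒯.G (deriv v t) (μ t • 𝒯.y t + l t • 𝒯.y' t) +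
      𝒯.G (𝒯.A t (v t)) (l t • 𝒯.y t)) volume 0 1 :=
    (MemLp.intervalIntegrable_bilin 𝒯.G zero_le_one hvm hyc).add
    ((hAv.clm_apply ((IsH1At.continuous hl1).smul hy)).intervalIntegrable _ _)
  have e1 : 𝒯.index v w = ∫ t in (0 : ℝ)..1, ((𝒯.G (deriv v t) (q t) + 𝒯.G (𝒯.A t (v t)) (W t)) -
      (𝒯.G (deriv v t) (μ t • 𝒯.y t + l t • 𝒯.y' t) + 𝒯.G (𝒯.A t (v t)) (l t • 𝒯.y t))) := by
    refine intervalIntegral.integral_congr_ae ?_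
    filter_upwards [ae_uIoc_of_Icc hwd] with t h ht
    rw [(h ht).deriv]
    simp only [hwdef, map_sub]
    ring
  have e2 : ∫ t in (0 : ℝ)..1, (𝒯.G (deriv v t) (μ t • 𝒯.y t + l t • 𝒯.y' t) +
      𝒯.G (𝒯.A t (v t)) (l t • 𝒯.y t)) = 0 := by
    refine (intervalIntegral.integral_congr_ae ?_).trans (hfin.trans (by simp))
    filter_upwards [ae_uIoc_of_Icc hC] with t h ht
    have := h ht
    simp only [map_add, map_smul, smul_eq_mul, B, ContinuousLinearMap.mul_apply', hp, 𝒯.A_symm]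
    rw [← this]
    ring
  rw [e1, intervalIntegral.integral_sub hI1 hI2, e2, sub_zero] at h0
  refine Eq.trans ?_ h0
  refine intervalIntegral.integral_congr_ae (Eventually.of_forall fun t ht ↦ ?_)
  rw [uIoc_of_le zero_le_one] at ht
  simp only [hWe t (Ioc_subset_Icc_self ht)]

/-- Elements of the kernel of the index form on the constrained space solve `v'' = A v`. -/
theorem solves_of_mem_kernel {v : ℝ → E} (hv : v ∈ 𝒯.constrained)
    (hker : ∀ w ∈ 𝒯.constrained, 𝒯.index v w = 0) :
    ∃ v' : ℝ → E, ∀ t, HasDerivAt v (v' t) t ∧ HasDerivAt v' (𝒯.A t (v t)) t := by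
  have := FiniteDimensional.complete ℝ E
  have hun := fun w₀ q hq ↦ 𝒯.index_unconstrained hv hker w₀ (q := q) hq
  obtain ⟨⟨hv1, hvt⟩, -⟩ := hv
  have hvc := IsH1At.continuous hv1
  have hAv : Continuous fun t ↦ 𝒯.A t (v t) := 𝒯.contDiff_A.continuous.clm_apply hvc
  set β : ℝ → E := fun t ↦ ∫ s in (0 : ℝ)..t, 𝒯.A s (v s) with hβ
  have hβd : ∀ t, HasDerivAt β (𝒯.A t (v t)) t := fun t ↦
    intervalIntegral.integral_hasDerivAt_right (hAv.intervalIntegrable _ _)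
      hAv.aestronglyMeasurable.stronglyMeasurableAtFilter hAv.continuousAt
  have hβc : Continuous β := continuous_iff_continuousAt.2 fun t ↦ (hβd t).continuousAt
  have hvm := IsH1At.memLp_deriv hv1 0 1
  -- The du Bois-Reymond device: `v'' = A v` says that `h` is constant. Integration by parts moves
  -- `A v` onto the derivative `q` of the test function, leaving only `h` and one end term.
  set h : ℝ → E := fun t ↦ deriv v t - β t with hh
  have hhm : MemLp h 2 (volume.restrict (Icc 0 1)) := hvm.sub hβc.continuousOn.memLp_two
  have hhi := MemLp.intervalIntegrable zero_le_one hhm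
  have weak : ∀ (w₀ : E) (q : ℝ → E), MemLp q 2 (volume.restrict (Icc 0 1)) →
      w₀ + ∫ s in (0 : ℝ)..1, q s = 𝒯.H w₀ →
      (∫ t in (0 : ℝ)..1, 𝒯.G (h t) (q t)) + 𝒯.G (β 1) (𝒯.H w₀) = 0 := by
    intro w₀ q hq hw
    have hqi := MemLp.intervalIntegrable zero_le_one hq
    set u : ℝ → E := fun t ↦ w₀ + ∫ s in (0 : ℝ)..t, q s with hu
    have hu1 : u 1 = 𝒯.H w₀ := hw
    have huac : AbsolutelyContinuousOnInterval u 0 1 := by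
      have := AbsolutelyContinuousOnInterval.intervalIntegral hqi (c := 0) left_mem_uIcc
      refine this.of_dist_le (K := 1) (L := 0) this fun x _ y _ ↦ by simp [hu]
    have hud : ∀ᵐ t : ℝ, t ∈ uIoc (0 : ℝ) 1 → HasDerivAt u (q t) t := by
      filter_upwards [hqi.ae_hasDerivAt_integral] with t ht hm
      exact (ht (uIoc_subset_uIcc hm) 0 left_mem_uIcc).const_add w₀
    have hβac : AbsolutelyContinuousOnInterval β 0 1 :=
      AbsolutelyContinuousOnInterval.intervalIntegral (hAv.intervalIntegrable _ _) left_mem_uIcc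
    have h1 := integral_bilin_deriv 𝒯.G hβac huac (Eventually.of_forall fun t _ ↦ hβd t) hud
    have h2 := hun w₀ q hq hw
    have hβ0 : β 0 = 0 := by simp [hβ]
    rw [hu1, hβ0, map_zero, zero_apply, sub_zero] at h1
    have huc : ContinuousOn u (Icc 0 1) := by simpa using huac.continuousOn
    have i1 := MemLp.intervalIntegrable_bilin 𝒯.G zero_le_one hvm hq
    have i2 : IntervalIntegrable (fun t ↦ 𝒯.G (𝒯.A t (v t)) (u t)) volume 0 1 :=
      ContinuousOn.intervalIntegrable (by
        rw [uIcc_of_le zero_le_one]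
        exact (𝒯.G.continuous.comp hAv).continuousOn.clm_apply huc)
    have i3 := MemLp.intervalIntegrable_bilin 𝒯.G zero_le_one
      (hβc.continuousOn.memLp_two (a := 0) (b := 1)) hq
    rw [intervalIntegral.integral_add i2 i3] at h1
    rw [intervalIntegral.integral_add i1 i2] at h2
    have e : ∫ t in (0 : ℝ)..1, 𝒯.G (h t) (q t) =
        (∫ t in (0 : ℝ)..1, 𝒯.G (deriv v t) (q t)) - ∫ t in (0 : ℝ)..1, 𝒯.G (β t) (q t) := by
      rw [← intervalIntegral.integral_sub i1 i3]
      simp [hh]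
    rw [e]
    linarith
  set c : E := ∫ t in (0 : ℝ)..1, h t with hc
  have hGc : ∀ e, ∫ t in (0 : ℝ)..1, 𝒯.G (h t) e = 𝒯.G c e := fun e ↦
    (𝒯.G.flip e).intervalIntegral_comp_comm hhi
  have hconst : ∀ e, ∀ᵐ t : ℝ, t ∈ Icc (0 : ℝ) 1 → 𝒯.G (h t) e = 𝒯.G c e := by
    intro e
    set f : ℝ → ℝ := fun t ↦ 𝒯.G (h t) e - 𝒯.G c e with hf
    have hGm : MemLp (fun t ↦ 𝒯.G (h t) e) 2 (volume.restrict (Icc 0 1)) :=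
      (𝒯.G.flip e).comp_memLp' hhm
    have hfm : MemLp f 2 (volume.restrict (Icc 0 1)) :=
      hGm.sub continuousOn_const.memLp_two
    have hfi := MemLp.intervalIntegrable zero_le_one hfm
    have hf0 : ∫ t in (0 : ℝ)..1, f t = 0 := by
      rw [intervalIntegral.integral_sub (MemLp.intervalIntegrable zero_le_one hGm) (by simp), hGc]
      simp
    -- A test function vanishing at both ends, as `f` has mean zero. Because `G` is indefinite, `h -
    -- c` itself would not yield a positive square; for each fixed `e` the scalar `f` gives `∫ f² =
    -- 0`.
    have h1 := weak 0 (fun t ↦ f t • e)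
      ((ContinuousLinearMap.toSpanSingleton ℝ e).comp_memLp' hfm) (by
        rw [intervalIntegral.integral_smul_const, hf0]; simp)
    have h2 : ∫ t in (0 : ℝ)..1, f t ^ 2 = 0 := by
      have e1 : ∀ t, f t ^ 2 = 𝒯.G (h t) (f t • e) - f t * 𝒯.G c e := fun t ↦ by
        simp only [hf, map_smul, smul_eq_mul]; ring
      have i1 : IntervalIntegrable (fun t ↦ 𝒯.G (h t) (f t • e)) volume 0 1 :=
        MemLp.intervalIntegrable_bilin 𝒯.G zero_le_one hhm
        ((ContinuousLinearMap.toSpanSingleton ℝ e).comp_memLp' hfm)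
      simp only [map_zero, add_zero] at h1
      simp only [e1]
      rw [intervalIntegral.integral_sub i1 (hfi.mul_const _), intervalIntegral.integral_mul_const,
        hf0, h1]
      simp
    have hsq : IntegrableOn (fun t ↦ f t ^ 2) (Ioc 0 1) :=
      IntegrableOn.mono_set (show IntegrableOn (fun t ↦ f t ^ 2) (Icc 0 1) volume from hfm.integrable_sq)
        Ioc_subset_Icc_self
    rw [intervalIntegral.integral_of_le zero_le_one,
      integral_eq_zero_iff_of_nonneg (fun t ↦ sq_nonneg _) hsq] at h2
    refine ae_restrict_Ioo ?_
    filter_upwards [(ae_restrict_iff' measurableSet_Ioc).1 h2] with t ht hm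
    have := ht (Ioo_subset_Ioc_self hm)
    simp only [Pi.zero_apply, sq_eq_zero_iff, hf] at this
    linarith
  have hae : ∀ᵐ t : ℝ, t ∈ Icc (0 : ℝ) 1 → deriv v t = c + β t := by
    have := ae_all_iff.2 fun i ↦ hconst (Module.finBasis ℝ E i)
    filter_upwards [this] with t ht hm
    have : h t - c = 0 := by
      refine 𝒯.nondeg _ fun b ↦ ?_
      have hz : ((𝒯.G (h t - c) : E →L[ℝ] ℝ) : E →ₗ[ℝ] ℝ) = 0 :=
        (Module.finBasis ℝ E).ext fun i ↦ by simp [ht i hm]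
      exact LinearMap.congr_fun hz b
    rw [← sub_eq_zero.1 this]
    simp [hh]
  -- The natural boundary condition `v'(1) = H v'(0)`: it comes from test functions with arbitrary
  -- initial value `w₀` and constant derivative `H w₀ - w₀`.
  have hend : c + β 1 = 𝒯.H c := by
    rw [← sub_eq_zero]
    refine 𝒯.nondeg _ fun b ↦ ?_
    obtain ⟨w₀, rfl⟩ := 𝒯.H.surjective b
    have h1 := weak w₀ (fun _ ↦ 𝒯.H w₀ - w₀) continuousOn_const.memLp_two (by simp)
    rw [hGc] at h1
    simp only [map_sub, map_add, sub_apply, add_apply, 𝒯.isometry] at h1 ⊢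
    linarith
  set V' : ℝ → E := fun t ↦ c + β t with hV'
  set Z : ℝ → E := fun t ↦ v 0 + ∫ s in (0 : ℝ)..t, V' s with hZ
  have hV'c : Continuous V' := continuous_const.add hβc
  have hvZ : ∀ t ∈ Icc (0 : ℝ) 1, v t = Z t := fun t ht ↦ by
    rw [IsH1At.eq_add_integral hv1 0 t]
    simp only [hZ]
    congr 1
    refine intervalIntegral.integral_congr_ae ?_
    filter_upwards [hae] with s hs hm
    rw [uIoc_of_le ht.1] at hm
    exact hs ⟨hm.1.le, hm.2.trans ht.2⟩
  have hZd : ∀ t, HasDerivAt Z (V' t) t := fun t ↦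
    (intervalIntegral.integral_hasDerivAt_right (hV'c.intervalIntegrable _ _)
      hV'c.aestronglyMeasurable.stronglyMeasurableAtFilter hV'c.continuousAt).const_add _
  obtain ⟨S, hS0, -, -, hSd, hSu⟩ := exists_second_order_flow 𝒯.contDiff_A
  -- The solution on the whole line with the same initial data. It equals `v` on `[0, 1]`, and then
  -- everywhere once it is known to satisfy the same twisted periodicity.
  set z : ℝ → E := fun t ↦ (S t (v 0, c)).1 with hz
  set z' : ℝ → E := fun t ↦ (S t (v 0, c)).2 with hz'
  have hzd : ∀ t, HasDerivAt z (z' t) t ∧ HasDerivAt z' (𝒯.A t (z t)) t := fun t ↦ hSd t _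
  have hZz : ∀ t ∈ Icc (0 : ℝ) 1, (Z t, V' t) = (z t, z' t) := fun t ht ↦ by
    have := hSu Z V' (Icc 0 1) (convex_Icc 0 1) (by simp) (fun s hs ↦ ⟨hZd s, by
      rw [← hvZ s hs]; exact (hβd s).const_add c⟩) t ht
    rw [this]
    simp [hZ, hV', hβ, hz, hz']
  have h01 : (z 0, z' 0) = (v 0, c) := by simp [hz, hz', hS0]
  have hz0 : z 0 = v 0 := congrArg Prod.fst h01
  have hz'0 : z' 0 = c := congrArg Prod.snd h01
  have hz1 : (z (0 + 1), z' (0 + 1)) = (𝒯.H (z 0), 𝒯.H (z' 0)) := by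
    have h1 := hZz 1 (by simp)
    have h2 := hvZ 1 (by simp)
    have h3 := hvt 0
    rw [zero_add] at h3 ⊢
    rw [← h1, ← h2, h3, hz0, hz'0, ← hend]
  have hz1a : z (0 + 1) = 𝒯.H (z 0) := congrArg Prod.fst hz1
  have hz1b : z' (0 + 1) = 𝒯.H (z' 0) := congrArg Prod.snd hz1
  have hztw : ∀ t, z (t + 1) = 𝒯.H (z t) := fun t ↦ by
    have hT := 𝒯.A_twist
    -- By equivariance of `A`, `t ↦ H⁻¹ z(t + 1)` solves the same equation, and the end conditions
    -- at `1` give it the same initial data as `z`.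
    have e1 := hSu (fun t ↦ 𝒯.H.symm (z (t + 1))) (fun t ↦ 𝒯.H.symm (z' (t + 1))) univ convex_univ
      (mem_univ _) (fun s _ ↦ by
        have d1 := (𝒯.H.symm : E →L[ℝ] E).hasFDerivAt.comp_hasDerivAt s
          ((hzd (s + 1)).1.comp_add_const s 1)
        have d2 := (𝒯.H.symm : E →L[ℝ] E).hasFDerivAt.comp_hasDerivAt s
          ((hzd (s + 1)).2.comp_add_const s 1)
        refine ⟨d1, d2.congr_deriv ?_⟩
        have := hT s (𝒯.H.symm (z (s + 1)))
        rw [ContinuousLinearEquiv.apply_symm_apply] at this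
        rw [this]; simp) t (mem_univ _)
    have e2 : (𝒯.H.symm (z (0 + 1)), 𝒯.H.symm (z' (0 + 1))) = (v 0, c) := by
      rw [hz1a, hz1b]
      simpa using h01
    rw [e2] at e1
    have e3 : 𝒯.H.symm (z (t + 1)) = z t := congrArg Prod.fst e1
    rw [← e3, ContinuousLinearEquiv.apply_symm_apply]
  have hvz : v = z := by
    have hfr : ∀ t ∈ Icc (0 : ℝ) 1, v t = z t := fun t ht ↦ by
      rw [hvZ t ht]
      exact congrArg Prod.fst (hZz t ht)
    have hint : ∀ n : ℤ, ∀ t ∈ Icc (0 : ℝ) 1, v (t + n) = z (t + n) := by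
      intro n
      induction n using Int.induction_on with
      | zero => simpa using hfr
      | succ i ih =>
        intro t ht
        push_cast
        rw [← add_assoc, hvt, hztw]
        have := ih t ht
        push_cast at this
        rw [this]
      | pred i ih =>
        intro t ht
        have := ih t ht
        push_cast at this ⊢
        have e : t + -(i : ℝ) = t + (-(i : ℝ) - 1) + 1 := by ring
        rw [e, hvt, hztw] at this
        exact 𝒯.H.injective this
    funext t
    have := hint ⌊t⌋ (Int.fract t) ⟨Int.fract_nonneg _, (Int.fract_lt_one _).le⟩
    rwa [Int.fract_add_floor] at this
  exact ⟨z', by rw [hvz]; exact hzd⟩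

/-- Twisted periodic solutions of `v'' = A v` lie in the kernel of the index form. -/
theorem mem_kernel_of_solves {v v' : ℝ → E} (hvt : ∀ t, v (t + 1) = 𝒯.H (v t))
    (hv : ∀ t, HasDerivAt v (v' t) t ∧ HasDerivAt v' (𝒯.A t (v t)) t) (hv1 : ∀ t, IsH1At v t) :
    v ∈ 𝒯.constrained ∧ ∀ w ∈ 𝒯.loops, 𝒯.index v w = 0 := by
  have hd : deriv v = v' := funext fun t ↦ (hv t).1.deriv
  refine ⟨⟨⟨hv1, hvt⟩, 𝒯.G (v' 0) (𝒯.y 0) - 𝒯.G (v 0) (𝒯.y' 0), ?_⟩, fun w hw ↦ ?_⟩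
  -- The Wronskian of two solutions is conserved, as `A` is symmetric; its constancy is the
  -- linearized constraint.
  · have hc : ∀ t, HasDerivAt (fun t ↦ 𝒯.G (v' t) (𝒯.y t) - 𝒯.G (v t) (𝒯.y' t)) 0 t := fun t ↦ by
      have h1 := ((hasDerivAt_const t 𝒯.G).clm_apply (hv t).2).clm_apply (𝒯.hasDerivAt_y t)
      have h2 := ((hasDerivAt_const t 𝒯.G).clm_apply (hv t).1).clm_apply (𝒯.hasDerivAt_y' t)
      refine (h1.sub h2).congr_deriv ?_
      simp [𝒯.A_symm]
      ring
    refine Eventually.of_forall fun t _ ↦ ?_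
    rw [hd]
    exact is_const_of_deriv_eq_zero (fun t ↦ (hc t).differentiableAt) (fun t ↦ (hc t).deriv) t 0
  · have hv't : ∀ t, v' (t + 1) = 𝒯.H (v' t) := fun t ↦ by
      have h1 := (hv (t + 1)).1.comp_add_const t 1
      have h2 := (𝒯.H : E →L[ℝ] E).hasFDerivAt.comp_hasDerivAt t (hv t).1
      have h3 : (fun t ↦ v (t + 1)) = (𝒯.H : E →L[ℝ] E) ∘ v := funext hvt
      rw [h3] at h1
      exact h1.unique h2
    have hac : AbsolutelyContinuousOnInterval v' 0 1 := by
      refine ContDiffOn.absolutelyContinuousOnInterval (ContDiff.contDiffOn ?_)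
      rw [contDiff_one_iff_deriv]
      refine ⟨fun t ↦ (hv t).2.differentiableAt, ?_⟩
      have : deriv v' = fun t ↦ 𝒯.A t (v t) := funext fun t ↦ (hv t).2.deriv
      rw [this]
      exact 𝒯.contDiff_A.continuous.clm_apply (IsH1At.continuous hv1)
    -- Integrating `(G(v', w))'`: the boundary terms cancel, because `v'` and `w` are both twisted
    -- by the isometry `H`.
    have h := integral_bilin_deriv 𝒯.G hac (IsH1At.absolutelyContinuousOnInterval hw.1 0 1)
      (Eventually.of_forall fun t _ ↦ (hv t).2)
      ((IsH1At.ae_differentiableAt hw.1).mono fun t ht _ ↦ ht.hasDerivAt)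
    have h1 := hv't 0
    have h2 := hw.2 0
    rw [zero_add] at h1 h2
    rw [h1, h2, 𝒯.isometry, sub_self] at h
    rw [index, hd, ← h]
    congr 1
    funext t
    ring

end TwistedSystem

end Twisted

end StationaryLorentz

namespace StationaryLorentz

/-! ## Powers of a linear map and roots of unity in its spectrum -/

section Spectrum

set_option linter.unusedSectionVars false

open Polynomial

variable {V : Type*} [AddCommGroup V] [Module ℝ V] [FiniteDimensional ℝ V] (P : Module.End ℝ V)

theorem one_tmul_injective : Function.Injective (fun v : V ↦ (1 : ℂ) ⊗ₜ[ℝ] v) :=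
  Module.FaithfullyFlat.tensorProduct_mk_injective (A := ℝ) (B := ℂ) V

theorem ker_pow_sub_one_mono {m k : ℕ} (h : m ∣ k) :
    LinearMap.ker (P ^ m - 1) ≤ LinearMap.ker (P ^ k - 1) := by
  obtain ⟨j, rfl⟩ := h
  intro v hv
  rw [LinearMap.mem_ker, LinearMap.sub_apply, sub_eq_zero] at hv ⊢
  rw [pow_mul]
  induction j with
  | zero => simp
  | succ j ih =>
    rw [pow_succ, Module.End.mul_apply, hv]
    exact ih

/-- Over `ℂ` write `X ^ k - 1 = (X ^ m - 1) q`. Separability of `X ^ k - 1` makes the factors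
coprime, so a root of `q` is a `k`-th but not an `m`-th root of unity and is not an eigenvalue.
Hence `q(P)` is invertible and can be cancelled. -/
theorem ker_pow_sub_one_eq {m k : ℕ} (hk : 0 < k) (h : m ∣ k)
    (hP : ∀ z ∈ complexSpectrum P, z ^ k = 1 → z ^ m = 1) :
    LinearMap.ker (P ^ k - 1) = LinearMap.ker (P ^ m - 1) := by
  refine le_antisymm (fun v hv ↦ ?_) (ker_pow_sub_one_mono P h)
  have hm : m ≠ 0 := by rintro rfl; simp at h; omega
  set Q : Module.End ℂ (ℂ ⊗[ℝ] V) := P.baseChange ℂ with hQ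
  obtain ⟨q, hq⟩ : (X ^ m - 1 : ℂ[X]) ∣ X ^ k - 1 := by
    obtain ⟨j, rfl⟩ := h
    simpa [pow_mul] using sub_dvd_pow_sub_pow (X ^ m : ℂ[X]) 1 j
  have hsep : (X ^ k - 1 : ℂ[X]).Separable := X_pow_sub_one_separable_iff.2 (by
    exact_mod_cast hk.ne')
  have hcop : IsCoprime (X ^ m - 1 : ℂ[X]) q := by
    rw [hq] at hsep
    exact hsep.isCoprime
  have hmon : q.Monic := Monic.of_mul_monic_left (monic_X_pow_sub_C 1 hm)
    (by rw [map_one, ← hq]; simpa using monic_X_pow_sub_C (1 : ℂ) hk.ne')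
  have hu : IsUnit (aeval Q q) := by
    by_contra hu
    rw [(IsAlgClosed.splits q).eq_prod_roots_of_monic hmon] at hu
    obtain ⟨z, hz, hz0⟩ := spectrum.exists_mem_of_not_isUnit_aeval_prod hu
    have h1 : z ^ k = 1 := by
      have := congrArg (eval z) hq
      rw [eval_mul, hz0, mul_zero] at this
      simpa [sub_eq_zero] using this
    have h2 := hP z hz h1
    obtain ⟨a, b, hab⟩ := hcop
    have := congrArg (eval z) hab
    simp [hz0, h2] at this
  have h3 : aeval Q q ((Q ^ m - 1) ((1 : ℂ) ⊗ₜ[ℝ] v)) = 0 := by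
    have := congrArg (aeval Q) hq
    rw [mul_comm, map_mul] at this
    have h4 := LinearMap.congr_fun this ((1 : ℂ) ⊗ₜ[ℝ] v)
    simp only [map_sub, map_pow, aeval_X, map_one, Module.End.mul_apply] at h4
    rw [← h4, hQ, ← LinearMap.baseChange_pow]
    rw [LinearMap.mem_ker, LinearMap.sub_apply, sub_eq_zero] at hv
    rw [LinearMap.sub_apply, LinearMap.baseChange_tmul, hv]
    simp
  have h5 : (Q ^ m - 1) ((1 : ℂ) ⊗ₜ[ℝ] v) = 0 :=
    ((Module.End.isUnit_iff _).1 hu).1 (h3.trans (map_zero _).symm)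
  rw [hQ, ← LinearMap.baseChange_pow, LinearMap.sub_apply, LinearMap.baseChange_tmul,
    sub_eq_zero] at h5
  have h6 := one_tmul_injective h5
  rw [LinearMap.mem_ker, LinearMap.sub_apply, sub_eq_zero]
  exact h6

/-- A section of `f` over its range, extended to `V`, recovers vectors up to `ker f`. The equation
`l ∘ f = h` passes to the complexification at once, which is why it replaces the inclusion of
kernels. -/
theorem exists_comp_eq_of_ker_le_ker {f h : Module.End ℝ V}
    (hle : LinearMap.ker f ≤ LinearMap.ker h) : ∃ l : Module.End ℝ V, l ∘ₗ f = h := by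
  obtain ⟨s, hs⟩ := f.rangeRestrict.exists_rightInverse_of_surjective f.range_rangeRestrict
  obtain ⟨s', hs'⟩ := s.exists_extend
  refine ⟨h ∘ₗ s', LinearMap.ext fun v ↦ ?_⟩
  have h1 : s' (f v) = s (f.rangeRestrict v) := LinearMap.congr_fun hs' (f.rangeRestrict v)
  have h2 : f (s (f.rangeRestrict v)) = f v :=
    congrArg Subtype.val (LinearMap.congr_fun hs (f.rangeRestrict v))
  have h3 : s (f.rangeRestrict v) - v ∈ LinearMap.ker h := hle (by
    rw [LinearMap.mem_ker, map_sub, h2, sub_self])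
  rw [LinearMap.comp_apply, LinearMap.comp_apply, h1]
  rwa [LinearMap.mem_ker, map_sub, sub_eq_zero] at h3

/-- A complex eigenvector for `z` is annihilated by `P ^ k - 1`, hence by `P - 1` after
complexifying `P - 1 = l ∘ (P ^ k - 1)`. -/
theorem eq_one_of_mem_complexSpectrum {k : ℕ}
    (hle : LinearMap.ker (P ^ k - 1) ≤ LinearMap.ker (P - 1)) {z : ℂ}
    (hz : z ∈ complexSpectrum P) (hzk : z ^ k = 1) : z = 1 := by
  obtain ⟨l, hl⟩ := exists_comp_eq_of_ker_le_ker hle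
  obtain ⟨v, hv⟩ := (Module.End.hasEigenvalue_iff_mem_spectrum.2 hz).exists_hasEigenvector
  have h1 := hv.apply_eq_smul
  have h2 := hv.pow_apply k
  have h3 := congrArg (LinearMap.baseChange ℂ) hl
  have h4 := LinearMap.congr_fun h3 v
  have e1 : LinearMap.baseChange ℂ (P ^ k - 1) v = 0 := by
    rw [LinearMap.baseChange_sub, LinearMap.sub_apply, LinearMap.baseChange_pow, h2, hzk,
      one_smul]
    simp
  rw [LinearMap.baseChange_comp, LinearMap.comp_apply, e1, map_zero, LinearMap.baseChange_sub,
    LinearMap.sub_apply, h1] at h4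
  have h5 : (z - 1) • v = 0 := by
    rw [sub_smul, one_smul, h4]
    simp
  exact sub_eq_zero.1 ((smul_eq_zero.1 h5).resolve_right hv.2)

theorem mem_complexSpectrum_iff {z : ℂ} :
    z ∈ complexSpectrum P ↔ (P.charpoly.map (algebraMap ℝ ℂ)).IsRoot z := by
  rw [complexSpectrum, ← Module.End.hasEigenvalue_iff_mem_spectrum,
    Module.End.hasEigenvalue_iff_isRoot_charpoly, LinearMap.charpoly_baseChange]

theorem conj_mem_complexSpectrum {z : ℂ} (hz : z ∈ complexSpectrum P) :
    (starRingEnd ℂ) z ∈ complexSpectrum P := by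
  rw [mem_complexSpectrum_iff, IsRoot.def, eval_map_algebraMap] at hz ⊢
  have := aeval_conj P.charpoly z
  rw [this, hz, map_zero]

open Classical in
/-- The distinct eigenvalues of a real endomorphism. -/
noncomputable def eigenvalueFinset : Finset ℂ := (P.charpoly.map (algebraMap ℝ ℂ)).roots.toFinset

theorem mem_eigenvalueFinset {z : ℂ} : z ∈ eigenvalueFinset P ↔ z ∈ complexSpectrum P := by
  rw [eigenvalueFinset, Multiset.mem_toFinset, mem_complexSpectrum_iff, mem_roots]
  exact (P.charpoly_monic.map _).ne_zero

theorem card_eigenvalueFinset_le : (eigenvalueFinset P).card ≤ Module.finrank ℝ V := by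
  refine (Multiset.toFinset_card_le _).trans ((card_roots' _).trans ?_)
  rw [P.charpoly_monic.natDegree_map, LinearMap.charpoly_natDegree]

open Classical in
/-- The orders of the nontrivial roots of unity in the spectrum. -/
noncomputable def unityOrders : Finset ℕ :=
  ((eigenvalueFinset P).image orderOf).filter (2 ≤ ·)

theorem mem_unityOrders {d : ℕ} : d ∈ unityOrders P ↔
    (∃ z ∈ complexSpectrum P, orderOf z = d) ∧ 2 ≤ d := by
  simp [unityOrders, mem_eigenvalueFinset]

theorem orderOf_conj (z : ℂ) : orderOf ((starRingEnd ℂ) z) = orderOf z :=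
  orderOf_injective (starRingEnd ℂ).toMonoidHom (RingHom.injective _) z

/-- The number of orders is at most half of the dimension if `1` is an eigenvalue. -/
theorem two_mul_card_unityOrders_le (h1 : (1 : ℂ) ∈ complexSpectrum P) :
    2 * (unityOrders P).card ≤ Module.finrank ℝ V := by
  classical
  refine le_trans ?_ (card_eigenvalueFinset_le P)
  -- Every order is attained in the closed upper half plane, as conjugate eigenvalues have equal
  -- order, so `A` bounds the number of orders. Conjugation exchanges `A` and `B`, which share at
  -- most `-1`; the eigenvalue `1`, outside both, makes up for this overlap.
  set A := (eigenvalueFinset P).filter fun z ↦ 0 ≤ z.im ∧ 2 ≤ orderOf z with hA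
  set B := (eigenvalueFinset P).filter fun z ↦ z.im ≤ 0 ∧ 2 ≤ orderOf z with hB
  have hAO : (unityOrders P).card ≤ A.card := by
    refine (Finset.card_le_card ?_).trans (Finset.card_image_le (f := orderOf))
    intro d hd
    obtain ⟨⟨z, hz, rfl⟩, h2⟩ := (mem_unityOrders P).1 hd
    rw [Finset.mem_image]
    rcases le_total 0 z.im with h | h
    · exact ⟨z, Finset.mem_filter.2 ⟨(mem_eigenvalueFinset P).2 hz, h, h2⟩, rfl⟩
    · refine ⟨(starRingEnd ℂ) z, Finset.mem_filter.2 ⟨(mem_eigenvalueFinset P).2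
        (conj_mem_complexSpectrum P hz), by simpa using h, ?_⟩, orderOf_conj z⟩
      rwa [orderOf_conj]
  have hAB : B.card = A.card := by
    refine Finset.card_bij (fun z _ ↦ (starRingEnd ℂ) z) (fun z hz ↦ ?_)
      (fun z _ w _ h ↦ (starRingEnd ℂ).injective h) fun z hz ↦ ⟨(starRingEnd ℂ) z, ?_, by simp⟩
    all_goals
      rw [Finset.mem_filter, mem_eigenvalueFinset] at hz
      rw [Finset.mem_filter, mem_eigenvalueFinset, orderOf_conj]
      exact ⟨conj_mem_complexSpectrum P hz.1, by simpa using hz.2.1, hz.2.2⟩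
  have hinter : (A ∩ B).card ≤ 1 := by
    refine (Finset.card_le_card (t := {-1}) fun z hz ↦ ?_).trans (by simp)
    rw [Finset.mem_inter, Finset.mem_filter, Finset.mem_filter] at hz
    obtain ⟨⟨-, h1, h2⟩, -, h3, -⟩ := hz
    have him : z.im = 0 := le_antisymm h3 h1
    have hn : ‖z‖ = 1 := Complex.norm_eq_one_of_pow_eq_one (pow_orderOf_eq_one z) (by omega)
    obtain ⟨x, rfl⟩ : ∃ x : ℝ, z = x := ⟨z.re, Complex.ext rfl (by simpa using him)⟩
    rw [Complex.norm_real, Real.norm_eq_abs] at hn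
    rcases eq_or_eq_neg_of_abs_eq hn with rfl | rfl
    · simp at h2
    · simp
  have h1n : (1 : ℂ) ∉ A ∪ B := by simp [hA, hB]
  have hsub : insert 1 (A ∪ B) ⊆ eigenvalueFinset P := by
    intro z hz
    rw [Finset.mem_insert, Finset.mem_union] at hz
    rcases hz with rfl | hz | hz
    · exact (mem_eigenvalueFinset P).2 h1
    · exact (Finset.mem_filter.1 hz).1
    · exact (Finset.mem_filter.1 hz).1
  have := Finset.card_le_card hsub
  rw [Finset.card_insert_of_notMem h1n] at this
  have h3 := Finset.card_union_add_card_inter A B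
  omega

/-- An eigenvalue with `z ^ k = 1` has order dividing `k`, and order `1` divides everything, so only
orders at least `2` need to be tested. The value `orderOf z = 0` cannot divide the positive `k`. -/
theorem ker_pow_sub_one_eq_of_orders {m k : ℕ} (hk : 0 < k) (h : m ∣ k)
    (hd : ∀ d ∈ unityOrders P, d ∣ k → d ∣ m) :
    LinearMap.ker (P ^ k - 1) = LinearMap.ker (P ^ m - 1) := by
  refine ker_pow_sub_one_eq P hk h fun z hz hzk ↦ ?_
  have h1 := orderOf_dvd_of_pow_eq_one hzk
  rw [← orderOf_dvd_iff_pow_eq_one]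
  by_cases h2 : 2 ≤ orderOf z
  · exact hd _ ((mem_unityOrders P).2 ⟨⟨z, hz, rfl⟩, h2⟩) h1
  · have h3 : orderOf z ≠ 0 := fun h0 ↦ by rw [h0] at h1; simp at h1; omega
    rw [show orderOf z = 1 by omega]
    exact one_dvd m

end Spectrum

/-- The positive integers, partitioned according to which elements of a finite set divide them. -/
theorem exists_divisibility_partition (O : Finset ℕ) (hO : ∀ d ∈ O, 0 < d) :
    ∃ (s : ℕ) (m : Fin s → ℕ) (q : Fin s → ℕ → ℕ), s ≤ 2 ^ O.card ∧
      (∀ j, 0 < m j) ∧ (∀ j i, 0 < q j i) ∧ (∀ j, StrictMono (q j)) ∧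
      (∀ k : ℕ, 0 < k → ∃! j, k ∈ range (fun i ↦ m j * q j i)) ∧
      ∀ j i, ∀ d ∈ O, d ∣ m j * q j i → d ∣ m j := by
  classical
  let D : ℕ → Finset ℕ := fun k ↦ O.filter (· ∣ k)
  have hD : ∀ k d, d ∈ D k ↔ d ∈ O ∧ d ∣ k := fun k d ↦ by simp [D]
  let C : Finset (Finset ℕ) := O.powerset.filter fun S ↦ ∃ k, 0 < k ∧ D k = S
  have hDC : ∀ k, 0 < k → D k ∈ C := fun k hk ↦ by
    simp only [C, Finset.mem_filter, Finset.mem_powerset]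
    exact ⟨Finset.filter_subset _ _, k, hk, rfl⟩
  let e := C.equivFin
  let μ : Finset ℕ → ℕ := fun S ↦ S.lcm id
  have hμd : ∀ k, μ (D k) ∣ k := fun k ↦ Finset.lcm_dvd fun d hd ↦ ((hD k d).1 hd).2
  have hμD : ∀ k, D (μ (D k)) = D k := fun k ↦ by
    ext d
    rw [hD, hD]
    refine and_congr_right fun hd ↦ ⟨fun h ↦ h.trans (hμd k), fun h ↦ ?_⟩
    exact Finset.dvd_lcm (f := id) ((hD k d).2 ⟨hd, h⟩)
  have hS : ∀ j, ∃ k, 0 < k ∧ D k = (e.symm j : Finset ℕ) := fun j ↦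
    (Finset.mem_filter.1 (e.symm j).2).2
  have hm0 : ∀ j, 0 < μ (e.symm j) := fun j ↦ by
    obtain ⟨k, hk, hkj⟩ := hS j
    rw [← hkj]
    exact Nat.pos_of_dvd_of_pos (hμd k) hk
  have hmD : ∀ j, D (μ (e.symm j)) = e.symm j := fun j ↦ by
    obtain ⟨k, hk, hkj⟩ := hS j
    rw [← hkj, hμD]
  let p : Fin C.card → ℕ → Prop := fun j q ↦ 0 < q ∧ D (μ (e.symm j) * q) = e.symm j
  have hinf : ∀ j, (Set.ofPred (p j)).Infinite := fun j ↦ by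
    -- Quotients of the form `1 + i L` never change which elements of `O` divide the product, since
    -- all of them divide `L`; so each class is infinite and can be enumerated increasingly.
    set L := O.lcm id with hL
    have hL0 : 0 < L := Nat.pos_of_ne_zero fun h ↦ by
      obtain ⟨d, hd, h0⟩ := Finset.lcm_eq_zero_iff.1 h
      exact (hO d hd).ne' h0
    refine Set.infinite_of_injective_forall_mem (f := fun i : ℕ ↦ 1 + i * L) (fun a b h ↦ ?_)
      fun i ↦ ⟨by omega, ?_⟩
    · exact Nat.eq_of_mul_eq_mul_right hL0 (Nat.add_left_cancel h)
    · conv_rhs => rw [← hmD j]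
      ext d
      rw [hD, hD]
      refine and_congr_right fun hd ↦ ?_
      have hdL : d ∣ μ (e.symm j) * (i * L) :=
        ((Finset.dvd_lcm (f := id) hd).mul_left i).mul_left _
      rw [mul_add, mul_one]
      exact Nat.dvd_add_iff_left hdL |>.symm
  have hp : ∀ j i, p j (Nat.nth (p j) i) := fun j i ↦ Nat.nth_mem_of_infinite (hinf j) i
  refine ⟨C.card, fun j ↦ μ (e.symm j), fun j ↦ Nat.nth (p j), ?_, hm0, fun j i ↦ (hp j i).1,
    fun j ↦ Nat.nth_strictMono (hinf j), fun k hk ↦ ?_, fun j i d hd h ↦ ?_⟩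
  · rw [← Finset.card_powerset]
    exact Finset.card_filter_le _ _
  · refine ⟨e ⟨D k, hDC k hk⟩, ?_, ?_⟩
    · obtain ⟨q, hq⟩ := hμd k
      have hj : (e.symm (e ⟨D k, hDC k hk⟩) : Finset ℕ) = D k := by simp
      have hpq : p (e ⟨D k, hDC k hk⟩) q := by
        refine ⟨Nat.pos_of_ne_zero fun h ↦ by simp [h] at hq; omega, ?_⟩
        rw [hj, ← hq]
      obtain ⟨i, hi⟩ : q ∈ range (Nat.nth (p (e ⟨D k, hDC k hk⟩))) := by
        rw [Nat.range_nth_of_infinite (hinf _)]; exact hpq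
      refine ⟨i, ?_⟩
      simp only [hi, hj]
      exact hq.symm
    · rintro j ⟨i, rfl⟩
      have := (hp j i).2
      refine e.symm.injective (Subtype.ext ?_)
      rw [Equiv.symm_apply_apply]
      exact this.symm
  · have h1 : d ∈ D (μ (e.symm j) * Nat.nth (p j) i) := (hD _ _).2 ⟨hd, h⟩
    rw [(hp j i).2, ← hmD j] at h1
    exact ((hD _ _).1 h1).2

end StationaryLorentz

namespace StationaryLorentz

/-! ## Chart representations of the geometry of a Lorentzian manifold -/

section Charts

set_option linter.unusedSectionVars false

open Filter Topology

variable {E : Type*} [NormedAddCommGroup E] [NormedSpace ℝ E]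
  {M : Type*} [TopologicalSpace M] [ChartedSpace E M] [IsManifold 𝓘(ℝ, E) ∞ M]

/-! ### Coordinates of tangent vectors and transition maps -/

section Coord

variable {x x' p : M}

theorem toCoord_ofCoord (hp : p ∈ (chartAt E x).source) (v : E) :
    toCoord x p (ofCoord x p v) = v :=
  (trivializationAt E (TangentSpace 𝓘(ℝ, E)) x).continuousLinearMapAt_symmL hp v

theorem ofCoord_toCoord (hp : p ∈ (chartAt E x).source) (v : TangentSpace 𝓘(ℝ, E) p) :
    ofCoord x p (toCoord x p v) = v :=
  (trivializationAt E (TangentSpace 𝓘(ℝ, E)) x).symmL_continuousLinearMapAt hp v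

theorem toCoord_injective (hp : p ∈ (chartAt E x).source) :
    Function.Injective (toCoord (E := E) x p) :=
  Function.LeftInverse.injective (ofCoord_toCoord hp)

theorem toCoord_surjective (hp : p ∈ (chartAt E x).source) :
    Function.Surjective (toCoord (E := E) x p) :=
  Function.RightInverse.surjective (toCoord_ofCoord hp)

theorem toCoord_eq_tangentCoordChange (hp : p ∈ (chartAt E x).source) (v : TangentSpace 𝓘(ℝ, E) p) :
    toCoord x p v = tangentCoordChange 𝓘(ℝ, E) p x p v := by
  rw [toCoord, TangentBundle.continuousLinearMapAt_trivializationAt_eq_core hp]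
  rfl

/-- The coordinate change from the preferred chart at `p` to itself is trivial at `p`. This permits
frames along a curve to be treated as maps `E → E`. -/
theorem toCoord_self (v : TangentSpace 𝓘(ℝ, E) p) : toCoord p p v = v := by
  rw [toCoord_eq_tangentCoordChange (mem_chart_source E p)]
  exact tangentCoordChange_self (by simp)

theorem ofCoord_self (v : E) : ofCoord p p v = v :=
  toCoord_injective (mem_chart_source E p) (by
    rw [toCoord_ofCoord (mem_chart_source E p)]; exact (toCoord_self (p := p) v).symm)

/-- The transition map from the preferred chart at `x` to the one at `x'`. -/
noncomputable def transition (x x' : M) : E → E :=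
  extChartAt 𝓘(ℝ, E) x' ∘ (extChartAt 𝓘(ℝ, E) x).symm

/-- The domain of `transition x x'`. -/
def transitionDomain (x x' : M) : Set E :=
  (extChartAt 𝓘(ℝ, E) x).target ∩ (extChartAt 𝓘(ℝ, E) x).symm ⁻¹' (chartAt E x').source

theorem transitionDomain_eq : transitionDomain x x' =
    ((extChartAt 𝓘(ℝ, E) x).symm ≫ extChartAt 𝓘(ℝ, E) x').source := by
  rw [PartialEquiv.trans_source, extChartAt_source]; rfl

theorem isOpen_transitionDomain : IsOpen (transitionDomain (E := E) x x') :=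
  (continuousOn_extChartAt_symm x).isOpen_inter_preimage (isOpen_extChartAt_target x)
    (chartAt E x').open_source

theorem mem_transitionDomain (hp : p ∈ (chartAt E x).source) (hp' : p ∈ (chartAt E x').source) :
    extChartAt 𝓘(ℝ, E) x p ∈ transitionDomain x x' :=
  ⟨(extChartAt 𝓘(ℝ, E) x).map_source (by simpa using hp), by
    rw [mem_preimage, (extChartAt 𝓘(ℝ, E) x).left_inv (by simpa using hp)]; exact hp'⟩

theorem transition_apply (hp : p ∈ (chartAt E x).source) :
    transition x x' (extChartAt 𝓘(ℝ, E) x p) = extChartAt 𝓘(ℝ, E) x' p := by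
  rw [transition, Function.comp_apply, (extChartAt 𝓘(ℝ, E) x).left_inv (by simpa using hp)]

theorem contDiffOn_transition : ContDiffOn ℝ ∞ (transition (E := E) x x') (transitionDomain x x') := by
  rw [transitionDomain_eq]
  exact contDiffOn_ext_coord_change x' x

theorem fderiv_transition (hp : p ∈ (chartAt E x).source) (hp' : p ∈ (chartAt E x').source)
    (v : TangentSpace 𝓘(ℝ, E) p) :
    fderiv ℝ (transition x x') (extChartAt 𝓘(ℝ, E) x p) (toCoord x p v) = toCoord x' p v := by
  have h := hasFDerivWithinAt_tangentCoordChange (I := 𝓘(ℝ, E)) (x := x) (y := x') (z := p)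
    (by simp [hp, hp'])
  rw [ModelWithCorners.Boundaryless.range_eq_univ, hasFDerivWithinAt_univ] at h
  rw [transition, h.fderiv, toCoord_eq_tangentCoordChange hp, toCoord_eq_tangentCoordChange hp']
  exact tangentCoordChange_comp (by simp [hp, hp'])

end Coord

/-! ### The metric, the curvature and covariant differentials in an arbitrary chart -/

namespace LorentzMetric

variable (g : LorentzMetric E M) {x x' p : M}

theorem chartForm_apply (hp : p ∈ (chartAt E x).source) (v w : TangentSpace 𝓘(ℝ, E) p) :
    g.chartForm x (extChartAt 𝓘(ℝ, E) x p) (toCoord x p v) (toCoord x p w) = g.inner p v w := by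
  have h : (extChartAt 𝓘(ℝ, E) x).symm (extChartAt 𝓘(ℝ, E) x p) = p :=
    (extChartAt 𝓘(ℝ, E) x).left_inv (by simpa using hp)
  have : ∀ q, q = p → ((ofCoord x q).precomp ℝ ∘L g.inner q ∘L ofCoord x q) (toCoord x p v)
      (toCoord x p w) = g.inner p v w := by
    rintro q rfl
    show g.inner q (ofCoord x q (toCoord x q v)) (ofCoord x q (toCoord x q w)) = _
    rw [ofCoord_toCoord hp, ofCoord_toCoord hp]
  exact this _ h

theorem chartForm_eq (y : E) (v w : E) : g.chartForm x y v w =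
    g.inner ((extChartAt 𝓘(ℝ, E) x).symm y) (ofCoord x _ v) (ofCoord x _ w) := rfl

/-- A vector orthogonal to everything lies in the orthogonal complement of a timelike vector, where
the metric is positive definite. -/
theorem eq_zero_of_inner (u : TangentSpace 𝓘(ℝ, E) p) (h : ∀ v, g.inner p u v = 0) : u = 0 := by
  obtain ⟨v, -, hv⟩ := g.lorentzian p
  by_contra hu
  have := hv u hu (by rw [g.symm, h])
  rw [h] at this
  exact this.false

theorem contMDiffOn_ofCoord (v : E) : ContMDiffOn 𝓘(ℝ, E) (𝓘(ℝ, E).prod 𝓘(ℝ, E)) ∞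
    (fun p ↦ TotalSpace.mk' E p (ofCoord x p v : TangentSpace 𝓘(ℝ, E) p))
    (chartAt E x).source := by
  refine ((trivializationAt E (TangentSpace 𝓘(ℝ, E)) x).contMDiffOn_section_baseSet_iff).2 ?_
  refine (contMDiffOn_const (c := v)).congr fun p hp ↦ ?_
  have h := toCoord_ofCoord (E := E) hp v
  rw [toCoord, Trivialization.continuousLinearMapAt_apply_of_mem] at h
  · exact h
  · exact hp

variable [FiniteDimensional ℝ E]

theorem contDiffOn_chartForm :
    ContDiffOn ℝ ∞ (g.chartForm x) (extChartAt 𝓘(ℝ, E) x).target := by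
  rw [contDiffOn_clm_apply]
  intro v
  rw [contDiffOn_clm_apply]
  intro w
  have h1 : ContMDiffOn 𝓘(ℝ, E) (𝓘(ℝ, E).prod 𝓘(ℝ, ℝ)) ∞
      (fun p ↦ TotalSpace.mk' ℝ (E := Bundle.Trivial M ℝ) p
        (g.inner p (ofCoord x p v) (ofCoord x p w))) (chartAt E x).source :=
    ContMDiffOn.clm_bundle_apply₂ (F₁ := E) (F₂ := E) g.contMDiff.contMDiffOn
      (contMDiffOn_ofCoord v) (contMDiffOn_ofCoord w)
  have h2 : ContMDiffOn 𝓘(ℝ, E) 𝓘(ℝ, ℝ) ∞ (fun p ↦ g.inner p (ofCoord x p v) (ofCoord x p w))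
      (chartAt E x).source := fun p hp ↦ by
    have := h1 p hp
    rw [contMDiffWithinAt_totalSpace] at this
    exact this.2
  rw [← contMDiffOn_iff_contDiffOn]
  have h3 := h2.comp (contMDiffOn_extChartAt_symm (I := 𝓘(ℝ, E)) (n := ∞) x) fun y hy ↦ by
    simpa using (extChartAt 𝓘(ℝ, E) x).map_target hy
  exact h3

theorem _root_.ContinuousLinearMap.isInvertible_of_injective_dual {G : E →L[ℝ] E →L[ℝ] ℝ}
    (h : Function.Injective G) : G.IsInvertible := by
  have hd : Module.finrank ℝ E = Module.finrank ℝ (E →L[ℝ] ℝ) := by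
    rw [← (LinearMap.toContinuousLinearMap (𝕜 := ℝ) (E := E) (F' := ℝ)).finrank_eq]
    exact Subspace.dual_finrank_eq.symm
  refine ⟨(LinearMap.linearEquivOfInjective (G : E →ₗ[ℝ] E →L[ℝ] ℝ) h hd).toContinuousLinearEquiv, ?_⟩
  ext v w
  rfl

theorem isMetricOn_chartForm : IsMetricOn (g.chartForm x) (extChartAt 𝓘(ℝ, E) x).target where
  isOpen := isOpen_extChartAt_target x
  contDiffOn := g.contDiffOn_chartForm
  symm y _ v w := g.symm _ _ _
  invertible y hy := by
    refine ContinuousLinearMap.isInvertible_of_injective_dual ((injective_iff_map_eq_zero _).2 ?_)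
    intro v hv
    have hp : (extChartAt 𝓘(ℝ, E) x).symm y ∈ (chartAt E x).source := by
      simpa using (extChartAt 𝓘(ℝ, E) x).map_target hy
    have h : ofCoord x ((extChartAt 𝓘(ℝ, E) x).symm y) v = 0 := by
      refine g.eq_zero_of_inner _ fun w ↦ ?_
      have := congrArg (fun f : E →L[ℝ] ℝ ↦ f (toCoord x _ w)) hv
      simp only [chartForm_eq] at this
      rw [ofCoord_toCoord hp] at this
      exact this
    rw [← toCoord_ofCoord hp v, h, map_zero]

theorem isTransition : IsTransition (transition x x') (transitionDomain x x')
    (g.chartForm x) (extChartAt 𝓘(ℝ, E) x).target (g.chartForm x')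
    (extChartAt 𝓘(ℝ, E) x').target := by
  have key : ∀ y ∈ transitionDomain x x', ∃ p, p ∈ (chartAt E x).source ∧
      p ∈ (chartAt E x').source ∧ y = extChartAt 𝓘(ℝ, E) x p := fun y hy ↦
    ⟨_, by simpa using (extChartAt 𝓘(ℝ, E) x).map_target hy.1, hy.2,
      ((extChartAt 𝓘(ℝ, E) x).right_inv hy.1).symm⟩
  refine ⟨isOpen_transitionDomain, inter_subset_left, fun y hy ↦ ?_, contDiffOn_transition,
    fun y hy v ↦ ?_, fun y hy v w ↦ ?_⟩
  all_goals obtain ⟨p, hp, hp', rfl⟩ := key y hy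
  · rw [transition_apply hp]
    exact (extChartAt 𝓘(ℝ, E) x').map_source (by simpa using hp')
  · obtain ⟨u, rfl⟩ := toCoord_surjective hp' v
    exact ⟨toCoord x p u, fderiv_transition hp hp' u⟩
  · obtain ⟨v, rfl⟩ := toCoord_surjective hp v
    obtain ⟨w, rfl⟩ := toCoord_surjective hp w
    rw [fderiv_transition hp hp', fderiv_transition hp hp', transition_apply hp,
      g.chartForm_apply hp, g.chartForm_apply hp']

/-- The curvature at `p` is defined in the chart centred at `p`; the transformation law carries it
to any chart around `p`, so that it can be followed along a curve in one fixed chart. -/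
theorem toCoord_curvature (hp : p ∈ (chartAt E x).source) (u v w : TangentSpace 𝓘(ℝ, E) p) :
    toCoord x p (g.curvature p u v w) = curvatureForm (g.chartForm x) (extChartAt 𝓘(ℝ, E) x p)
      (toCoord x p u) (toCoord x p v) (toCoord x p w) := by
  have := FiniteDimensional.complete ℝ E
  have hpp := mem_chart_source E p
  have h := (g.isTransition (x := p) (x' := x)).map_curvatureForm g.isMetricOn_chartForm
    g.isMetricOn_chartForm (mem_transitionDomain hpp hp) (toCoord p p u) (toCoord p p v)
    (toCoord p p w)
  rw [fderiv_transition hpp hp, fderiv_transition hpp hp, fderiv_transition hpp hp,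
    transition_apply hpp] at h
  rw [← h, ← fderiv_transition hpp hp, curvature, toCoord_ofCoord hpp]
  rfl

/-- The representative of a vector field in the preferred chart at `x`. -/
noncomputable def _root_.StationaryLorentz.chartField (x : M) (X : (x : M) → TangentSpace 𝓘(ℝ, E) x)
    (y : E) : E :=
  toCoord x ((extChartAt 𝓘(ℝ, E) x).symm y) (X ((extChartAt 𝓘(ℝ, E) x).symm y))

omit [FiniteDimensional ℝ E] in
theorem _root_.StationaryLorentz.chartField_apply (X : (x : M) → TangentSpace 𝓘(ℝ, E) x)
    (hp : p ∈ (chartAt E x).source) :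
    chartField x X (extChartAt 𝓘(ℝ, E) x p) = toCoord x p (X p) := by
  rw [chartField, (extChartAt 𝓘(ℝ, E) x).left_inv (by simpa using hp)]

variable {X : (x : M) → TangentSpace 𝓘(ℝ, E) x}

omit [FiniteDimensional ℝ E] in
theorem _root_.StationaryLorentz.contDiffOn_chartField
    (hX : ContMDiff 𝓘(ℝ, E) 𝓘(ℝ, E).tangent ∞ (fun x ↦ (⟨x, X x⟩ : TangentBundle 𝓘(ℝ, E) M))) :
    ContDiffOn ℝ ∞ (chartField x X) (extChartAt 𝓘(ℝ, E) x).target := by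
  rw [← contMDiffOn_iff_contDiffOn]
  have h1 := ((trivializationAt E (TangentSpace 𝓘(ℝ, E)) x).contMDiffOn_section_baseSet_iff
    (IB := 𝓘(ℝ, E)) (n := ∞) (s := X)).1 hX.contMDiffOn
  have h2 := h1.comp (contMDiffOn_extChartAt_symm (I := 𝓘(ℝ, E)) (n := ∞) x) fun y hy ↦ by
    simpa using (extChartAt 𝓘(ℝ, E) x).map_target hy
  refine h2.congr fun y hy ↦ ?_
  have hp : (extChartAt 𝓘(ℝ, E) x).symm y ∈ (chartAt E x).source := by
      simpa using (extChartAt 𝓘(ℝ, E) x).map_target hy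
  rw [chartField, toCoord, Trivialization.continuousLinearMapAt_apply_of_mem]
  · rfl
  · exact hp

theorem toCoord_nabla (hX : ContMDiff 𝓘(ℝ, E) 𝓘(ℝ, E).tangent ∞
      (fun x ↦ (⟨x, X x⟩ : TangentBundle 𝓘(ℝ, E) M)))
    (hp : p ∈ (chartAt E x).source) (v : TangentSpace 𝓘(ℝ, E) p) :
    toCoord x p (g.nabla X p v) =
      covDiff (g.chartForm x) (chartField x X) (extChartAt 𝓘(ℝ, E) x p) (toCoord x p v) := by
  have hpp := mem_chart_source E p
  have hd : ∀ {x}, p ∈ (chartAt E x).source →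
      DifferentiableAt ℝ (chartField x X) (extChartAt 𝓘(ℝ, E) x p) := fun {x} hp ↦
    ((contDiffOn_chartField hX).contDiffAt ((isOpen_extChartAt_target x).mem_nhds
      ((extChartAt 𝓘(ℝ, E) x).map_source (by simpa using hp)))).differentiableAt (by simp)
  have h := (g.isTransition (x := p) (x' := x)).map_covDiff g.isMetricOn_chartForm
    g.isMetricOn_chartForm (mem_transitionDomain hpp hp) (Y₀ := chartField p X)
    (Y₁ := chartField x X) (fun z hz ↦ by
      obtain ⟨q, hq, hq', rfl⟩ : ∃ q, q ∈ (chartAt E p).source ∧ q ∈ (chartAt E x).source ∧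
        z = extChartAt 𝓘(ℝ, E) p q := ⟨_, by simpa using (extChartAt 𝓘(ℝ, E) p).map_target hz.1, hz.2, ((extChartAt 𝓘(ℝ, E) p).right_inv hz.1).symm⟩
      rw [transition_apply hq, chartField_apply X hq, chartField_apply X hq',
        fderiv_transition hq hq'])
    (hd hpp) (by rw [transition_apply hpp]; exact hd hp) (toCoord p p v)
  rw [fderiv_transition hpp hp, transition_apply hpp] at h
  rw [h, ← fderiv_transition hpp hp, nabla, toCoord_ofCoord hpp, covDiff_apply,
    chartField_apply X hpp]
  rfl

theorem IsTimelikeKilling.skew {g : LorentzMetric E M} (hX : g.IsTimelikeKilling X) {y : E}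
    (hy : y ∈ (extChartAt 𝓘(ℝ, E) x).target) (v w : E) :
    g.chartForm x y (covDiff (g.chartForm x) (chartField x X) y v) w +
      g.chartForm x y v (covDiff (g.chartForm x) (chartField x X) y w) = 0 := by
  obtain ⟨p, hp, rfl⟩ : ∃ p, p ∈ (chartAt E x).source ∧ y = extChartAt 𝓘(ℝ, E) x p :=
    ⟨_, by simpa using (extChartAt 𝓘(ℝ, E) x).map_target hy,
      ((extChartAt 𝓘(ℝ, E) x).right_inv hy).symm⟩
  obtain ⟨v, rfl⟩ := toCoord_surjective hp v
  obtain ⟨w, rfl⟩ := toCoord_surjective hp w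
  rw [← g.toCoord_nabla hX.contMDiff hp, ← g.toCoord_nabla hX.contMDiff hp, g.chartForm_apply hp,
    g.chartForm_apply hp]
  exact hX.killing p v w

end LorentzMetric

end Charts

end StationaryLorentz

namespace StationaryLorentz

/-! ## Parallel frames along curves -/

section Curves

set_option linter.unusedSectionVars false

open Filter Topology

variable {E : Type*} [NormedAddCommGroup E] [NormedSpace ℝ E]
  {M : Type*} [TopologicalSpace M] [ChartedSpace E M] [IsManifold 𝓘(ℝ, E) ∞ M]

/-- The times at which `γ` is in the domain of the preferred chart at `x`. -/
def curveDom (γ : ℝ → M) (x : M) : Set ℝ := γ ⁻¹' (chartAt E x).source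

/-- The representative of `γ` in the preferred chart at `x`. -/
noncomputable def curveRep (γ : ℝ → M) (x : M) (t : ℝ) : E := extChartAt 𝓘(ℝ, E) x (γ t)

/-- The coordinates, in the preferred chart at `x`, of tangent vectors at `γ t`. -/
noncomputable def curveCoord (γ : ℝ → M) (x : M) (t : ℝ) : E →L[ℝ] E := toCoord x (γ t)

section

variable {γ : ℝ → M} {x x' : M} {t : ℝ}

theorem mem_curveDom_self : t ∈ curveDom (E := E) γ (γ t) := mem_chart_source E (γ t)

theorem curveRep_mem (ht : t ∈ curveDom (E := E) γ x) :
    curveRep γ x t ∈ (extChartAt 𝓘(ℝ, E) x).target :=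
  (extChartAt 𝓘(ℝ, E) x).map_source (by rw [extChartAt_source]; exact ht)

theorem curveRep_mem_transitionDomain (ht : t ∈ curveDom (E := E) γ x)
    (ht' : t ∈ curveDom (E := E) γ x') : curveRep γ x t ∈ transitionDomain (E := E) x x' :=
  mem_transitionDomain ht ht'

theorem curveCoord_self (v : E) : curveCoord γ (γ t) t v = v := toCoord_self v

theorem isUnit_curveCoord (ht : t ∈ curveDom (E := E) γ x) :
    IsUnit (curveCoord (E := E) γ x t) :=
  ⟨⟨curveCoord γ x t, (ofCoord x (γ t) : E →L[ℝ] E),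
    ContinuousLinearMap.ext fun v ↦ toCoord_ofCoord ht v,
    ContinuousLinearMap.ext fun v ↦ ofCoord_toCoord ht v⟩, rfl⟩

theorem fderiv_transition_curve (ht : t ∈ curveDom (E := E) γ x)
    (ht' : t ∈ curveDom (E := E) γ x') :
    fderiv ℝ (transition x x') (curveRep γ x t) * curveCoord (E := E) γ x t = curveCoord γ x' t :=
  ContinuousLinearMap.ext fun v ↦ fderiv_transition ht ht' v

variable (hγ : ContMDiff 𝓘(ℝ, ℝ) 𝓘(ℝ, E) ∞ γ)
include hγ

theorem isOpen_curveDom : IsOpen (curveDom (E := E) γ x) :=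
  (chartAt E x).open_source.preimage hγ.continuous

theorem contDiffOn_curveRep : ContDiffOn ℝ ∞ (curveRep (E := E) γ x) (curveDom (E := E) γ x) := by
  rw [← contMDiffOn_iff_contDiffOn]
  exact (contMDiffOn_extChartAt (I := 𝓘(ℝ, E)) (n := ∞) (x := x)).comp hγ.contMDiffOn fun _ h ↦ h

theorem contDiffOn_deriv_curveRep :
    ContDiffOn ℝ ∞ (deriv (curveRep (E := E) γ x)) (curveDom (E := E) γ x) :=
  ((contDiffOn_infty_iff_deriv_of_isOpen (isOpen_curveDom hγ)).1 (contDiffOn_curveRep hγ)).2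

theorem hasDerivAt_curveRep (ht : t ∈ curveDom (E := E) γ x) :
    HasDerivAt (curveRep (E := E) γ x) (deriv (curveRep γ x) t) t :=
  (((contDiffOn_curveRep hγ).contDiffAt ((isOpen_curveDom hγ).mem_nhds ht)).differentiableAt
    (by simp)).hasDerivAt

theorem curveCoord_velocity (ht : t ∈ curveDom (E := E) γ x) :
    curveCoord (E := E) γ x t (velocity (E := E) γ t) = deriv (curveRep (E := E) γ x) t := by
  have h1 : MDifferentiableAt 𝓘(ℝ, ℝ) 𝓘(ℝ, E) γ t := hγ.mdifferentiableAt (by simp)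
  have h2 : MDifferentiableAt 𝓘(ℝ, E) 𝓘(ℝ, E) (extChartAt 𝓘(ℝ, E) x) (γ t) :=
    mdifferentiableAt_extChartAt ht
  have h3 := mfderiv_comp t h2 h1
  have h4 : (toCoord x (γ t) : TangentSpace 𝓘(ℝ, E) (γ t) →L[ℝ] E) =
      mfderiv 𝓘(ℝ, E) 𝓘(ℝ, E) (extChartAt 𝓘(ℝ, E) x) (γ t) :=
    TangentBundle.continuousLinearMapAt_trivializationAt ht
  have h5 : fderiv ℝ (curveRep (E := E) γ x) t (1 : ℝ) = toCoord x (γ t) (velocity γ t) := by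
    rw [h4, ← mfderiv_eq_fderiv]
    exact DFunLike.congr_fun h3 (1 : ℝ)
  rw [← fderiv_apply_one_eq_deriv, h5]
  rfl

end

namespace LorentzMetric

variable [FiniteDimensional ℝ E] (g : LorentzMetric E M) {γ : ℝ → M}
  (hγ : ContMDiff 𝓘(ℝ, ℝ) 𝓘(ℝ, E) ∞ γ)

/-- The connection form along `γ` in the preferred chart at `x`. -/
noncomputable def curveForm (γ : ℝ → M) (x : M) (t : ℝ) : E →L[ℝ] E :=
  christoffelOp (g.chartForm x) (curveRep γ x t) (deriv (curveRep γ x) t)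

theorem contDiffOn_comp_curve {F : Type*} [NormedAddCommGroup F] [NormedSpace ℝ F] {x : M}
    {f : E → F} (hγ : ContMDiff 𝓘(ℝ, ℝ) 𝓘(ℝ, E) ∞ γ)
    (hf : ∀ y ∈ (extChartAt 𝓘(ℝ, E) x).target, ContDiffAt ℝ ∞ f y) :
    ContDiffOn ℝ ∞ (fun t ↦ f (curveRep γ x t)) (curveDom (E := E) γ x) := fun t ht ↦
  (hf _ (curveRep_mem ht)).comp_contDiffWithinAt t (contDiffOn_curveRep hγ t ht)

include hγ in
theorem contDiffOn_curveForm (x : M) :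
    ContDiffOn ℝ ∞ (g.curveForm γ x) (curveDom (E := E) γ x) := by
  have := FiniteDimensional.complete ℝ E
  exact (contDiffOn_comp_curve hγ fun y hy ↦
    g.isMetricOn_chartForm.contDiffAt_christoffelOp hy).clm_apply (contDiffOn_deriv_curveRep hγ)

/-- The Levi-Civita connection along `γ`. -/
noncomputable def curveConnection : LineConnection (E →L[ℝ] E) M where
  dom := curveDom (E := E) γ
  τ := curveCoord γ
  con := g.curveForm γ
  isOpen _ := isOpen_curveDom hγ
  cover t := ⟨γ t, mem_curveDom_self⟩
  isUnit _ _ ht := isUnit_curveCoord ht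
  contDiffOn := g.contDiffOn_curveForm hγ
  trans i j t hi hj := by
    -- The cocycle is the derivative of the coordinate change along `γ`, so the gauge law is the
    -- transformation law of the Christoffel symbols evaluated on `γ'`.
    have e : ∀ s, s ∈ curveDom (E := E) γ i → s ∈ curveDom (E := E) γ j →
        curveCoord γ i s * Ring.inverse (curveCoord γ j s) =
          fderiv ℝ (transition j i) (curveRep γ j s) := fun s hi hj ↦ by
      rw [← fderiv_transition_curve hj hi, mul_assoc,
        Ring.mul_inverse_cancel _ (isUnit_curveCoord hj), mul_one]
    have hT := g.isTransition (x := j) (x' := i)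
    have hm := curveRep_mem_transitionDomain hj hi
    have h1 := (hT.hasFDerivAt_fderiv hm).comp_hasDerivAt t (hasDerivAt_curveRep hγ hj)
    have h2 := h1.congr_of_eventuallyEq
      (f₁ := fun s ↦ curveCoord γ i s * Ring.inverse (curveCoord γ j s)) (by
        filter_upwards [(isOpen_curveDom hγ).mem_nhds hi, (isOpen_curveDom hγ).mem_nhds hj]
          with s hs hs' using e s hs hs')
    refine h2.congr_deriv ?_
    rw [e t hi hj]
    ext w
    have h3 := hT.map_christoffelOp g.isMetricOn_chartForm g.isMetricOn_chartForm hm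
      (deriv (curveRep γ j) t) w
    have h4 : fderiv ℝ (transition (E := E) j i) (curveRep γ j t) (deriv (curveRep (E := E) γ j) t) =
        deriv (curveRep (E := E) γ i) t := by
      rw [← curveCoord_velocity hγ hj, ← curveCoord_velocity hγ hi, ← fderiv_transition_curve hj hi]
      rfl
    have h5 : transition (E := E) j i (curveRep γ j t) = curveRep γ i t := transition_apply hj
    rw [h4, h5] at h3
    rw [sub_apply, mul_apply_eq_comp, mul_apply_eq_comp]
    exact eq_sub_of_add_eq' h3.symm

end LorentzMetric

end Curves

end StationaryLorentz

namespace StationaryLorentz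

/-! ### Components in a parallel frame: covariant derivative, regularity and metric -/

section Frames

set_option linter.unusedSectionVars false

open Filter Topology

variable {E : Type*} [NormedAddCommGroup E] [NormedSpace ℝ E]
  {M : Type*} [TopologicalSpace M] [ChartedSpace E M] [IsManifold 𝓘(ℝ, E) ∞ M]
  [FiniteDimensional ℝ E]

namespace LorentzMetric

variable (g : LorentzMetric E M) {γ : ℝ → M}
  (hγ : ContMDiff 𝓘(ℝ, ℝ) 𝓘(ℝ, E) ∞ γ)

/-- The metric at a point, as a bilinear form on the model space. -/
noncomputable def modelInner (p : M) : E →L[ℝ] E →L[ℝ] ℝ := g.inner p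

/-- A parallel frame along `γ` that is the identity at time `0`. -/
structure ParallelFrame where
  toFun : ℝ → E →L[ℝ] E
  zero : toFun 0 = 1
  isUnit : ∀ t, IsUnit (toFun t)
  isParallelAt : ∀ t, (g.curveConnection hγ).IsParallelAt toFun t

theorem nonempty_parallelFrame : Nonempty (g.ParallelFrame hγ) := by
  have := FiniteDimensional.complete ℝ E
  obtain ⟨Φ, h0, hΦ⟩ := (g.curveConnection hγ).exists_frame
  exact ⟨⟨Φ, h0, fun t ↦ (hΦ t).2, fun t ↦ (hΦ t).1⟩⟩

namespace ParallelFrame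

variable {g} {hγ} (Φ : g.ParallelFrame hγ) {x : M} {t : ℝ}

/-- The inverse of the frame. -/
noncomputable def inv (t : ℝ) : E →L[ℝ] E := Ring.inverse (Φ.toFun t)

theorem toFun_inv (t : ℝ) (a : E) : Φ.toFun t (Φ.inv t a) = a :=
  DFunLike.congr_fun (Ring.mul_inverse_cancel _ (Φ.isUnit t)) a

theorem inv_toFun (t : ℝ) (a : E) : Φ.inv t (Φ.toFun t a) = a :=
  DFunLike.congr_fun (Ring.inverse_mul_cancel _ (Φ.isUnit t)) a

/-- The vector field along `γ` with components `v` in the frame. -/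
noncomputable def field (v : ℝ → E) : FieldAlong (E := E) γ := fun t ↦ Φ.toFun t (v t)

/-- The components of a vector field along `γ`. -/
noncomputable def components (V : FieldAlong (E := E) γ) : ℝ → E := fun t ↦ Φ.inv t (V t)

theorem field_components (V : FieldAlong (E := E) γ) : Φ.field (Φ.components V) = V :=
  funext fun t ↦ Φ.toFun_inv t (V t)

theorem components_field (v : ℝ → E) : Φ.components (Φ.field v) = v :=
  funext fun t ↦ Φ.inv_toFun t (v t)

/-- The frame in the preferred chart at `x`. -/
noncomputable def chartFrame (x : M) (t : ℝ) : E →L[ℝ] E := curveCoord γ x t * Φ.toFun t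

theorem isUnit_chartFrame (ht : t ∈ curveDom (E := E) γ x) : IsUnit (Φ.chartFrame x t) :=
  (isUnit_curveCoord ht).mul (Φ.isUnit t)

theorem hasDerivAt_chartFrame (ht : t ∈ curveDom (E := E) γ x) :
    HasDerivAt (Φ.chartFrame x) (-(g.curveForm γ x t) * Φ.chartFrame x t) t :=
  Φ.isParallelAt t x ht

theorem contDiffOn_chartFrame (x : M) :
    ContDiffOn ℝ ∞ (Φ.chartFrame x) (curveDom (E := E) γ x) :=
  LineConnection.contDiffOn_frame (c := g.curveConnection hγ) Φ.isParallelAt x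

theorem contDiffOn_inverse_chartFrame (x : M) :
    ContDiffOn ℝ ∞ (fun t ↦ Ring.inverse (Φ.chartFrame x t)) (curveDom (E := E) γ x) := by
  have := FiniteDimensional.complete ℝ E
  intro t ht
  obtain ⟨u, hu⟩ := Φ.isUnit_chartFrame ht
  have h := contDiffAt_ringInverse ℝ (n := ∞) u
  rw [hu] at h
  exact h.comp_contDiffWithinAt t (Φ.contDiffOn_chartFrame x t ht)

theorem inverse_chartFrame (ht : t ∈ curveDom (E := E) γ x) (a : E) :
    Ring.inverse (Φ.chartFrame x t) (curveCoord γ x t a) = Φ.inv t a := by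
  have h := LineConnection.inverse_mul_eq_of_isUnit (y := (1 : E →L[ℝ] E))
    (isUnit_curveCoord ht) (Φ.isUnit t)
  have := DFunLike.congr_fun h a
  rw [mul_one, mul_one] at this
  exact this

theorem chartFrame_inverse (ht : t ∈ curveDom (E := E) γ x) (a : E) :
    Φ.chartFrame x t (Ring.inverse (Φ.chartFrame x t) a) = a :=
  DFunLike.congr_fun (Ring.mul_inverse_cancel _ (Φ.isUnit_chartFrame ht)) a

theorem hasDerivAt_chartFrame_apply {v : ℝ → E} {v' : E} (hv : HasDerivAt v v' t)
    (ht : t ∈ curveDom (E := E) γ x) :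
    HasDerivAt (fun s ↦ Φ.chartFrame x s (v s))
      (Φ.chartFrame x t v' - g.curveForm γ x t (Φ.chartFrame x t (v t))) t := by
  refine ((Φ.hasDerivAt_chartFrame ht).clm_apply hv).congr_deriv ?_
  simp only [mul_apply_eq_comp, neg_apply]
  abel

variable (hγ) in
include hγ in
theorem covDeriv_eq_of_hasDerivAt {V : FieldAlong (E := E) γ} {a : E}
    (h : HasDerivAt (localRep V t) a t) :
    g.covDeriv V t = (a + g.curveForm γ (γ t) t (localRep V t t) : E) := by
  have e : localRep (velocity (E := E) γ) t t = deriv (curveRep (E := E) γ (γ t)) t :=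
    curveCoord_velocity hγ mem_curveDom_self
  rw [covDeriv, h.deriv, e]
  exact ofCoord_self _

/-- The derivative of the frame is minus the connection form, which cancels the Christoffel term of
`covDeriv`. -/
theorem covDeriv_field {v : ℝ → E} {v' : E} (hv : HasDerivAt v v' t) :
    g.covDeriv (Φ.field v) t = (Φ.toFun t v' : E) := by
  have h := Φ.hasDerivAt_chartFrame_apply hv (mem_curveDom_self (E := E) (γ := γ))
  have h1 := covDeriv_eq_of_hasDerivAt (g := g) hγ (V := Φ.field v) h
  refine h1.trans ?_
  have e : ∀ a, Φ.chartFrame (γ t) t a = Φ.toFun t a := fun a ↦ curveCoord_self _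
  rw [show localRep (Φ.field v) t t = Φ.chartFrame (γ t) t (v t) from rfl, ← e]
  exact sub_add_cancel _ _

theorem isH1Field_field (v : ℝ → E) : IsH1Field (Φ.field v) ↔ ∀ t, IsH1At v t := by
  refine ⟨fun h t ↦ ?_, fun h t ↦ ?_⟩
  · have h1 : IsH1At (localRep (Φ.field v) t) t := h t
    have h2 := IsH1At.clm_apply (isOpen_curveDom hγ) mem_curveDom_self
      (Φ.contDiffOn_inverse_chartFrame (γ t)) h1
    refine h2.congr ?_
    filter_upwards [(isOpen_curveDom hγ).mem_nhds (mem_curveDom_self (E := E) (γ := γ) (t := t))]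
      with s hs
    exact (DFunLike.congr_fun (Ring.inverse_mul_cancel _ (Φ.isUnit_chartFrame hs)) (v s)).symm
  · have h1 := IsH1At.clm_apply (isOpen_curveDom hγ) mem_curveDom_self
      (Φ.contDiffOn_chartFrame (γ t)) (h t)
    exact h1

variable (hγ) in
include hγ in
theorem isSmoothField_iff (V : FieldAlong (E := E) γ) :
    IsSmoothField V ↔ ∀ t, ContDiffAt ℝ ∞ (localRep V t) t := by
  refine forall_congr' fun t ↦ ?_
  rw [contMDiffAt_totalSpace, ← contMDiffAt_iff_contDiffAt]
  refine (and_iff_right hγ.contMDiffAt).trans ?_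
  refine Filter.EventuallyEq.contMDiffAt_iff ?_
  filter_upwards [(isOpen_curveDom hγ).mem_nhds (mem_curveDom_self (E := E) (γ := γ) (t := t))]
    with s hs
  rw [localRep, toCoord, Trivialization.continuousLinearMapAt_apply_of_mem]
  exact hs

theorem isSmoothField_field (v : ℝ → E) : IsSmoothField (Φ.field v) ↔ ContDiff ℝ ∞ v := by
  rw [isSmoothField_iff hγ, contDiff_iff_contDiffAt]
  refine forall_congr' fun t ↦ ?_
  have hn := (isOpen_curveDom hγ).mem_nhds (mem_curveDom_self (E := E) (γ := γ) (t := t))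
  refine ⟨fun h ↦ ?_, fun h ↦ ?_⟩
  · have h2 := ((Φ.contDiffOn_inverse_chartFrame (γ t)).contDiffAt hn).clm_apply h
    refine h2.congr_of_eventuallyEq ?_
    filter_upwards [hn] with s hs
    exact (DFunLike.congr_fun (Ring.inverse_mul_cancel _ (Φ.isUnit_chartFrame hs)) (v s)).symm
  · exact ((Φ.contDiffOn_chartFrame (γ t)).contDiffAt hn).clm_apply h

theorem chartForm_chartFrame (ht : t ∈ curveDom (E := E) γ x) (a b : E) :
    g.chartForm x (curveRep γ x t) (Φ.chartFrame x t a) (Φ.chartFrame x t b) =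
      g.modelInner (γ t) (Φ.toFun t a) (Φ.toFun t b) :=
  g.chartForm_apply ht (Φ.toFun t a) (Φ.toFun t b)

/-- Metric compatibility along the curve: the derivative of the metric cancels against the
connection terms of the two parallel vectors. -/
theorem modelInner_toFun (t : ℝ) (a b : E) :
    g.modelInner (γ t) (Φ.toFun t a) (Φ.toFun t b) = g.modelInner (γ 0) a b := by
  have hd : ∀ t, HasDerivAt (fun s ↦ g.modelInner (γ s) (Φ.toFun s a) (Φ.toFun s b)) 0 t := by
    intro t
    set x := γ t with hx
    have ht : t ∈ curveDom (E := E) γ x := mem_curveDom_self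
    have hG := g.isMetricOn_chartForm (x := x)
    have h1 := (hG.differentiableAt (curveRep_mem ht)).hasFDerivAt.comp_hasDerivAt t
      (hasDerivAt_curveRep hγ ht)
    have h2 := Φ.hasDerivAt_chartFrame_apply (hasDerivAt_const t a) ht
    have h3 := Φ.hasDerivAt_chartFrame_apply (hasDerivAt_const t b) ht
    have h4 := ((h1.clm_apply h2).clm_apply h3).congr_of_eventuallyEq
      (f₁ := fun s ↦ g.modelInner (γ s) (Φ.toFun s a) (Φ.toFun s b)) (by
        filter_upwards [(isOpen_curveDom hγ).mem_nhds ht] with s hs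
        exact (Φ.chartForm_chartFrame hs a b).symm)
    refine h4.congr_deriv ?_
    simp only [Function.comp_apply, hG.fderiv_eq (curveRep_mem ht), add_apply, map_zero, zero_sub,
      map_neg, neg_apply, curveForm]
    ring
  have := is_const_of_deriv_eq_zero (fun t ↦ (hd t).differentiableAt) (fun t ↦ (hd t).deriv) t 0
  rw [this, Φ.zero]
  rfl

end ParallelFrame

end LorentzMetric

end Frames

end StationaryLorentz

namespace StationaryLorentz

/-! ## Closed geodesics and their linearized geodesic flow in a parallel frame -/

section JacobiOperator

set_option linter.unusedSectionVars false

open Filter Topology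

variable {E : Type*} [NormedAddCommGroup E] [NormedSpace ℝ E] [FiniteDimensional ℝ E]

/-- The Jacobi operator `w ↦ R(u, w) u` of a metric `G`. -/
noncomputable def jacobiOp (G : E → E →L[ℝ] E →L[ℝ] ℝ) (y u : E) : E →L[ℝ] E :=
  (fderiv ℝ (christoffelOp G) y u).flip u - ((fderiv ℝ (christoffelOp G) y).flip u).flip u
    + christoffelOp G y u * (christoffelOp G y).flip u
    - (christoffelOp G y).flip (christoffelOp G y u u)

theorem IsMetricOn.jacobiOp_apply {G : E → E →L[ℝ] E →L[ℝ] ℝ} {U : Set E} (hG : IsMetricOn G U)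
    {y : E} (hy : y ∈ U) (u w : E) : jacobiOp G y u w = curvatureForm G y u w u := by
  have := FiniteDimensional.complete ℝ E
  rw [hG.curvatureForm_eq hy]
  rfl

theorem IsMetricOn.contDiffOn_jacobiOp {G : E → E →L[ℝ] E →L[ℝ] ℝ} {U : Set E}
    (hG : IsMetricOn G U) {c u : ℝ → E} {S : Set ℝ} (hc : ContDiffOn ℝ ∞ c S)
    (hu : ContDiffOn ℝ ∞ u S) (hcU : MapsTo c S U) :
    ContDiffOn ℝ ∞ (fun t ↦ jacobiOp G (c t) (u t)) S := by
  have := FiniteDimensional.complete ℝ E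
  have hΓ : ContDiffOn ℝ ∞ (fun t ↦ christoffelOp G (c t)) S := fun t ht ↦
    (hG.contDiffAt_christoffelOp (hcU ht)).comp_contDiffWithinAt t (hc t ht)
  have hΓ' : ContDiffOn ℝ ∞ (fun t ↦ fderiv ℝ (christoffelOp G) (c t)) S := fun t ht ↦
    ((hG.contDiffAt_christoffelOp (hcU ht)).fderiv_right (m := ∞) (by simp)).comp_contDiffWithinAt t
      (hc t ht)
  rw [contDiffOn_clm_apply]
  intro w
  have hw : ContDiffOn ℝ ∞ (fun _ : ℝ ↦ w) S := contDiffOn_const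
  exact ((((hΓ'.clm_apply hu).clm_apply hw).clm_apply hu).sub
    (((hΓ'.clm_apply hw).clm_apply hu).clm_apply hu) |>.add
    ((hΓ.clm_apply hu).clm_apply ((hΓ.clm_apply hw).clm_apply hu))).sub
    ((hΓ.clm_apply hw).clm_apply ((hΓ.clm_apply hu).clm_apply hu))

end JacobiOperator

/-! ### Holonomy and Jacobi operator of a periodic curve in a parallel frame -/

section ClosedGeodesics

set_option linter.unusedSectionVars false

open Filter Topology

variable {E : Type*} [NormedAddCommGroup E] [NormedSpace ℝ E]
  {M : Type*} [TopologicalSpace M] [ChartedSpace E M] [IsManifold 𝓘(ℝ, E) ∞ M]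
  [FiniteDimensional ℝ E]

namespace LorentzMetric

variable {g : LorentzMetric E M} {γ : ℝ → M}
  {hγ : ContMDiff 𝓘(ℝ, ℝ) 𝓘(ℝ, E) ∞ γ}

theorem curveDom_add_one (hp : Function.Periodic γ 1) {x : M} {t : ℝ} :
    t + 1 ∈ curveDom (E := E) γ x ↔ t ∈ curveDom (E := E) γ x := by
  simp only [curveDom, mem_preimage, hp t]

theorem curveCoord_add_one (hp : Function.Periodic γ 1) (x : M) (t : ℝ) :
    curveCoord (E := E) γ x (t + 1) = curveCoord γ x t := by
  have : ∀ p q : M, p = q → (toCoord x p : E →L[ℝ] E) = toCoord x q := by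
    rintro p q rfl; rfl
  exact this _ _ (hp t)

theorem curveRep_add_one (hp : Function.Periodic γ 1) (x : M) (t : ℝ) :
    curveRep (E := E) γ x (t + 1) = curveRep γ x t := by
  simp only [curveRep, hp t]

theorem deriv_curveRep_add_one (hp : Function.Periodic γ 1) (x : M) (t : ℝ) :
    deriv (curveRep (E := E) γ x) (t + 1) = deriv (curveRep γ x) t := by
  rw [← deriv_comp_add_const]
  congr 1
  funext s
  exact curveRep_add_one hp x s

theorem curveForm_add_one (hp : Function.Periodic γ 1) (x : M) (t : ℝ) :
    g.curveForm γ x (t + 1) = g.curveForm γ x t := by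
  simp only [curveForm, curveRep_add_one hp, deriv_curveRep_add_one hp]

theorem mk_eq_mk_iff {p q : M} (h : p = q) (a : TangentSpace 𝓘(ℝ, E) p)
    (b : TangentSpace 𝓘(ℝ, E) q) :
    (⟨p, a⟩ : TangentBundle 𝓘(ℝ, E) M) = ⟨q, b⟩ ↔ (a : E) = b := by
  subst h
  simp

variable (g) in
/-- The curvature operator `R(γ', a) γ'` along `γ`, on the model space. -/
noncomputable def curveCurvature (γ : ℝ → M) (t : ℝ) (a : E) : E :=
  g.curvature (γ t) (velocity (E := E) γ t) a (velocity (E := E) γ t)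

namespace ParallelFrame

variable (Φ : g.ParallelFrame hγ) {x : M} {t : ℝ}

/-- The connection along `γ` is `1`-periodic, so the shifted frame is again parallel and differs
from the original by its value at `0`. -/
theorem toFun_add_one (hp : Function.Periodic γ 1) (t : ℝ) :
    Φ.toFun (t + 1) = Φ.toFun t * Φ.toFun 1 := by
  have := FiniteDimensional.complete ℝ E
  have h := LineConnection.eq_of_isParallelAt (c := g.curveConnection hγ) (Ψ := fun t ↦ Φ.toFun (t + 1))
    isOpen_univ isPreconnected_univ (fun t _ ↦ ⟨Φ.isParallelAt t, Φ.isUnit t⟩)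
    (fun t _ x hx ↦ by
      have h1 := (Φ.hasDerivAt_chartFrame (x := x) ((curveDom_add_one hp).2 hx)).comp_add_const t 1
      have e : ∀ s, Φ.chartFrame x (s + 1) = curveCoord γ x s * Φ.toFun (s + 1) := fun s ↦ by
        rw [chartFrame, curveCoord_add_one hp]
      simp only [e, curveForm_add_one hp] at h1
      exact h1) (mem_univ 0) (mem_univ t)
  simpa [Φ.zero] using h

/-- The holonomy of the frame. -/
noncomputable def holonomy : E ≃L[ℝ] E :=
  -- The inverse of `Φ 1`, since periodicity of the field with components `v` reads `Φ(t) Φ(1) v(t +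
  -- 1) = Φ(t) v(t)`.
  ContinuousLinearEquiv.equivOfInverse (Φ.inv 1) (Φ.toFun 1) (Φ.toFun_inv 1) (Φ.inv_toFun 1)

theorem toFun_add_one_holonomy (hp : Function.Periodic γ 1) (t : ℝ) (a : E) :
    Φ.toFun (t + 1) (Φ.holonomy a) = Φ.toFun t a := by
  rw [Φ.toFun_add_one hp, mul_apply_eq_comp]
  exact congrArg _ (Φ.toFun_inv 1 a)

theorem isPeriodicField_field (hp : Function.Periodic γ 1) (v : ℝ → E) :
    IsPeriodicField (Φ.field v) ↔ ∀ t, v (t + 1) = Φ.holonomy (v t) := by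
  refine forall_congr' fun t ↦ ?_
  rw [mk_eq_mk_iff (hp t)]
  have h : (Φ.field v t : E) = Φ.toFun (t + 1) (Φ.holonomy (v t)) :=
    (Φ.toFun_add_one_holonomy hp t (v t)).symm
  rw [h]
  refine ⟨fun h ↦ ?_, fun h ↦ congrArg _ h⟩
  have := congrArg (Φ.inv (t + 1)) h
  rwa [show Φ.inv (t + 1) (Φ.field v (t + 1)) = v (t + 1) from Φ.inv_toFun _ _, Φ.inv_toFun] at this

theorem modelInner_eq {p q : M} (h : p = q) : g.modelInner p = g.modelInner q := by rw [h]

theorem holonomy_isometry (hp : Function.Periodic γ 1) (a b : E) :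
    g.modelInner (γ 0) (Φ.holonomy a) (Φ.holonomy b) = g.modelInner (γ 0) a b := by
  have h1 : γ 1 = γ 0 := by simpa using hp 0
  rw [← Φ.modelInner_toFun 1, modelInner_eq h1]
  congr 2
  · exact Φ.toFun_inv 1 a
  · exact Φ.toFun_inv 1 b

/-- The Jacobi operator along `γ`, in the frame. -/
noncomputable def jacobiOperator (t : ℝ) : E →L[ℝ] E :=
  Ring.inverse (Φ.chartFrame (γ t) t) *
    jacobiOp (g.chartForm (γ t)) (curveRep γ (γ t) t) (deriv (curveRep γ (γ t)) t) *
    Φ.chartFrame (γ t) t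

theorem curveCoord_curvature (ht : t ∈ curveDom (E := E) γ x) (a : E) :
    curveCoord (E := E) γ x t (g.curveCurvature γ t (Φ.toFun t a)) =
    jacobiOp (g.chartForm x) (curveRep γ x t) (deriv (curveRep γ x) t) (Φ.chartFrame x t a) := by
  have hv := curveCoord_velocity hγ ht
  have h := g.toCoord_curvature ht (velocity (E := E) γ t) (Φ.toFun t a) (velocity (E := E) γ t)
  refine h.trans ?_
  rw [g.isMetricOn_chartForm.jacobiOp_apply (curveRep_mem ht), ← hv]
  rfl

theorem jacobiOperator_apply (t : ℝ) (a : E) : Φ.jacobiOperator t a =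
    Φ.inv t (g.curveCurvature γ t (Φ.toFun t a)) := by
  rw [← Φ.inverse_chartFrame mem_curveDom_self, Φ.curveCoord_curvature mem_curveDom_self]
  rfl

theorem jacobiOperator_eq (ht : t ∈ curveDom (E := E) γ x) : Φ.jacobiOperator t =
    Ring.inverse (Φ.chartFrame x t) *
      jacobiOp (g.chartForm x) (curveRep γ x t) (deriv (curveRep γ x) t) * Φ.chartFrame x t := by
  ext a
  rw [Φ.jacobiOperator_apply, ← Φ.inverse_chartFrame ht, Φ.curveCoord_curvature ht]
  rfl

theorem curvature_field (t : ℝ) (v : ℝ → E) :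
    g.curvature (γ t) (velocity γ t) (Φ.field v t) (velocity γ t) =
      (Φ.toFun t (Φ.jacobiOperator t (v t)) : E) := by
  rw [Φ.jacobiOperator_apply, Φ.toFun_inv]
  rfl

theorem chartFrame_jacobiOperator (ht : t ∈ curveDom (E := E) γ x) (a : E) :
    Φ.chartFrame x t (Φ.jacobiOperator t a) =
      jacobiOp (g.chartForm x) (curveRep γ x t) (deriv (curveRep γ x) t) (Φ.chartFrame x t a) := by
  rw [Φ.jacobiOperator_eq ht, mul_assoc, mul_apply_eq_comp, Φ.chartFrame_inverse ht]
  rfl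

theorem contDiff_jacobiOperator : ContDiff ℝ ∞ Φ.jacobiOperator := by
  rw [contDiff_iff_contDiffAt]
  intro t
  have ht : t ∈ curveDom (E := E) γ (γ t) := mem_curveDom_self
  have hn := (isOpen_curveDom hγ).mem_nhds ht
  have h := ((Φ.contDiffOn_inverse_chartFrame (γ t)).clm_comp
    (g.isMetricOn_chartForm.contDiffOn_jacobiOp (contDiffOn_curveRep hγ)
      (contDiffOn_deriv_curveRep hγ) fun s hs ↦ curveRep_mem hs)).clm_comp
    (Φ.contDiffOn_chartFrame (γ t))
  refine (h.contDiffAt hn).congr_of_eventuallyEq ?_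
  filter_upwards [hn] with s hs using Φ.jacobiOperator_eq hs

/-- Pair symmetry of the curvature, `⟨R(u, a) u, b⟩ = ⟨R(u, b) u, a⟩`, in a frame where the metric
is constant. -/
theorem jacobiOperator_symm (t : ℝ) (a b : E) :
    g.modelInner (γ 0) (Φ.jacobiOperator t a) b = g.modelInner (γ 0) a (Φ.jacobiOperator t b) := by
  have := FiniteDimensional.complete ℝ E
  have ht : t ∈ curveDom (E := E) γ (γ t) := mem_curveDom_self
  have hG := g.isMetricOn_chartForm (x := γ t)
  have hm := curveRep_mem ht
  rw [← Φ.modelInner_toFun t, ← Φ.modelInner_toFun t, ← Φ.chartForm_chartFrame ht,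
    ← Φ.chartForm_chartFrame ht, Φ.chartFrame_jacobiOperator ht, Φ.chartFrame_jacobiOperator ht,
    hG.jacobiOp_apply hm, hG.jacobiOp_apply hm, hG.curvatureForm_pair_symm hm, hG.symm _ hm]

/-- In a chart the operator depends only on `γ` and `γ'`, which are periodic; the frame at `t + 1`
preceded by the holonomy is the frame at `t`. -/
theorem jacobiOperator_add_one (hp : Function.Periodic γ 1) (t : ℝ) (a : E) :
    Φ.jacobiOperator (t + 1) (Φ.holonomy a) = Φ.holonomy (Φ.jacobiOperator t a) := by
  have ht : t ∈ curveDom (E := E) γ (γ t) := mem_curveDom_self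
  have ht1 := (curveDom_add_one hp).2 ht
  have e : ∀ a, Φ.chartFrame (γ t) (t + 1) (Φ.holonomy a) = Φ.chartFrame (γ t) t a := fun a ↦ by
    simp only [chartFrame]
    rw [curveCoord_add_one hp, mul_apply_eq_comp, mul_apply_eq_comp,
      Φ.toFun_add_one_holonomy hp]
  have h1 := Φ.chartFrame_jacobiOperator ht1 (Φ.holonomy a)
  rw [e, curveRep_add_one hp, deriv_curveRep_add_one hp, ← Φ.chartFrame_jacobiOperator ht, ← e] at h1
  have := congrArg (fun z ↦ Ring.inverse (Φ.chartFrame (γ t) (t + 1)) z) h1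
  have hi : ∀ b, Ring.inverse (Φ.chartFrame (γ t) (t + 1)) (Φ.chartFrame (γ t) (t + 1) b) = b :=
    fun b ↦ DFunLike.congr_fun (Ring.inverse_mul_cancel _ (Φ.isUnit_chartFrame ht1)) b
  rwa [hi, hi] at this

theorem isJacobi_field (v : ℝ → E) : g.IsJacobi (Φ.field v) ↔
    ContDiff ℝ ∞ v ∧ ∀ t, deriv (deriv v) t = Φ.jacobiOperator t (v t) := by
  have key : ContDiff ℝ ∞ v → ∀ t, g.covDeriv (g.covDeriv (Φ.field v)) t =
      (Φ.toFun t (deriv (deriv v) t) : E) := fun hv t ↦ by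
    have h1 : g.covDeriv (Φ.field v) = Φ.field (deriv v) := funext fun s ↦
      Φ.covDeriv_field (hv.differentiable (by simp) s).hasDerivAt
    rw [h1]
    exact Φ.covDeriv_field
      ((contDiff_infty_iff_deriv.1 hv).2.differentiable (by simp) t).hasDerivAt
  refine ⟨fun h ↦ ?_, fun h ↦ ⟨(Φ.isSmoothField_field v).2 h.1, fun t ↦ ?_⟩⟩
  · have hv := (Φ.isSmoothField_field v).1 h.smooth
    refine ⟨hv, fun t ↦ ?_⟩
    have h1 := (key hv t).symm.trans (h.jacobi t)
    rw [Φ.curvature_field] at h1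
    have := congrArg (Φ.inv t) h1
    rwa [Φ.inv_toFun, Φ.inv_toFun] at this
  · rw [Φ.curvature_field, ← h.2 t]
    exact key h.1 t

end ParallelFrame

end LorentzMetric

end ClosedGeodesics

end StationaryLorentz

namespace StationaryLorentz

/-! ## The kernel of the constrained Hessian consists of the periodic Jacobi fields -/

section Kernel

set_option linter.unusedSectionVars false

open Filter Topology

variable {E : Type*} [NormedAddCommGroup E] [NormedSpace ℝ E]
  {M : Type*} [TopologicalSpace M] [ChartedSpace E M] [IsManifold 𝓘(ℝ, E) ∞ M]
  [FiniteDimensional ℝ E]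

theorem curvatureForm_self (G : E → E →L[ℝ] E →L[ℝ] ℝ) (y u w : E) : curvatureForm G y u u w = 0 := by
  rw [curvatureForm]
  abel

namespace LorentzMetric

variable {g : LorentzMetric E M} {γ : ℝ → M}
  {hγ : ContMDiff 𝓘(ℝ, ℝ) 𝓘(ℝ, E) ∞ γ}

theorem isSmoothField_velocity (hγ : ContMDiff 𝓘(ℝ, ℝ) 𝓘(ℝ, E) ∞ γ) :
    IsSmoothField (velocity (E := E) γ) := by
  rw [ParallelFrame.isSmoothField_iff hγ]
  intro t
  have hn := (isOpen_curveDom hγ).mem_nhds (mem_curveDom_self (E := E) (γ := γ) (t := t))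
  refine ((contDiffOn_deriv_curveRep hγ).contDiffAt hn).congr_of_eventuallyEq ?_
  filter_upwards [hn] with s hs using curveCoord_velocity hγ hs

/-- The geodesic equation `c'' = -Γ(c', c')` at the time at which the chart is centred; a pointwise
identity is all that `deriv_deriv_killing` needs. -/
theorem IsClosedGeodesic.hasDerivAt_deriv_curveRep (h : g.IsClosedGeodesic γ) (t : ℝ) :
    HasDerivAt (deriv (curveRep (E := E) γ (γ t)))
      (-(g.curveForm γ (γ t) t (deriv (curveRep γ (γ t)) t))) t := by
  have hγ := h.contMDiff
  have hn := (isOpen_curveDom hγ).mem_nhds (mem_curveDom_self (E := E) (γ := γ) (t := t))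
  have h1 := (((contDiffOn_deriv_curveRep (E := E) hγ).contDiffAt hn).differentiableAt
    (by simp)).hasDerivAt
  have h2 := h1.congr_of_eventuallyEq (f₁ := localRep (velocity (E := E) γ) t) (by
    filter_upwards [hn] with s hs using curveCoord_velocity hγ hs)
  have h3 := ParallelFrame.covDeriv_eq_of_hasDerivAt (g := g) (hγ := hγ) h2
  have h4 : localRep (velocity (E := E) γ) t t = deriv (curveRep (E := E) γ (γ t)) t :=
    curveCoord_velocity hγ mem_curveDom_self
  rw [h4] at h3
  have h5 := eq_neg_of_add_eq_zero_left (h3.symm.trans (h.geodesic t))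
  exact h1.congr_deriv h5

namespace ParallelFrame

variable (Φ : g.ParallelFrame hγ) {Y : (x : M) → TangentSpace 𝓘(ℝ, E) x}

theorem deriv_components_velocity (h : g.IsClosedGeodesic γ) (t : ℝ) :
    HasDerivAt (Φ.components (velocity γ)) 0 t := by
  have hv := (Φ.isSmoothField_field (Φ.components (velocity γ))).1 (by
    rw [Φ.field_components]; exact isSmoothField_velocity hγ)
  have h1 := (hv.differentiable (by simp) t).hasDerivAt
  have h2 := Φ.covDeriv_field h1
  rw [Φ.field_components] at h2
  have h3 := congrArg (Φ.inv t) (h2.symm.trans (h.geodesic t))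
  rw [Φ.inv_toFun] at h3
  exact h1.congr_deriv (h3.trans (map_zero (Φ.inv t)))

/-- The velocity is parallel, hence has constant components, and `R(γ', γ') = 0`. -/
theorem isJacobi_velocity (h : g.IsClosedGeodesic γ) : g.IsJacobi (velocity (E := E) γ) := by
  have hγ := h.contMDiff
  obtain ⟨Φ⟩ := g.nonempty_parallelFrame hγ
  have h0 : deriv (Φ.components (velocity γ)) = 0 :=
    funext fun t ↦ (Φ.deriv_components_velocity h t).deriv
  have hsm := (Φ.isSmoothField_field (Φ.components (velocity γ))).1 (by
    rw [Φ.field_components]; exact isSmoothField_velocity hγ)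
  rw [← Φ.field_components (velocity γ), Φ.isJacobi_field]
  refine ⟨hsm, fun t ↦ ?_⟩
  rw [h0, Φ.jacobiOperator_apply]
  have ht := mem_curveDom_self (E := E) (γ := γ) (t := t)
  have h1 : g.curveCurvature γ t (velocity (E := E) γ t) = 0 := by
    have := g.toCoord_curvature ht (velocity (E := E) γ t) (velocity (E := E) γ t)
      (velocity (E := E) γ t)
    have h2 : curvatureForm (g.chartForm (γ t)) (extChartAt 𝓘(ℝ, E) (γ t) (γ t))
      (toCoord (γ t) (γ t) (velocity γ t)) (toCoord (γ t) (γ t) (velocity γ t))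
      (toCoord (γ t) (γ t) (velocity γ t)) = 0 :=
      curvatureForm_self _ _ _ _
    rw [h2] at this
    exact toCoord_injective ht (this.trans (map_zero _).symm)
  have e : g.curveCurvature γ t (Φ.toFun t (Φ.components (velocity γ) t)) = 0 :=
    (congrArg (g.curveCurvature γ t) (Φ.toFun_inv t _)).trans h1
  rw [e, map_zero]
  simp

theorem contDiff_components_killing (hY : g.IsTimelikeKilling Y) :
    ContDiff ℝ ∞ (Φ.components fun t ↦ Y (γ t)) := by
  rw [← Φ.isSmoothField_field, Φ.field_components]
  exact hY.contMDiff.comp hγ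

theorem chartFrame_components_killing {x : M} {t : ℝ} (ht : t ∈ curveDom (E := E) γ x) :
    Φ.chartFrame x t (Φ.components (fun t ↦ Y (γ t)) t) = chartField x Y (curveRep γ x t) := by
  rw [curveRep, chartField_apply Y ht]
  exact congrArg (curveCoord γ x t) (Φ.toFun_inv t _)

theorem hasDerivAt_chartField_curve (hY : g.IsTimelikeKilling Y) {x : M} {t : ℝ}
    (ht : t ∈ curveDom (E := E) γ x) :
    DifferentiableAt ℝ (chartField x Y) (curveRep γ x t) :=
  ((contDiffOn_chartField hY.contMDiff).contDiffAt ((isOpen_extChartAt_target x).mem_nhds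
    (curveRep_mem ht))).differentiableAt (by simp)

theorem chartFrame_deriv_killing (hY : g.IsTimelikeKilling Y) {x : M} {t : ℝ}
    (ht : t ∈ curveDom (E := E) γ x) :
    Φ.chartFrame x t (deriv (Φ.components fun t ↦ Y (γ t)) t) =
      covDiff (g.chartForm x) (chartField x Y) (curveRep γ x t) (deriv (curveRep γ x) t) := by
  have h1 := Φ.hasDerivAt_chartFrame_apply
    ((Φ.contDiff_components_killing hY).differentiable (by simp) t).hasDerivAt ht
  have h2 := (hasDerivAt_chartField_curve hY ht).hasFDerivAt.comp_hasDerivAt t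
    (hasDerivAt_curveRep hγ ht)
  have h3 := h2.congr_of_eventuallyEq
    (f₁ := fun s ↦ Φ.chartFrame x s (Φ.components (fun t ↦ Y (γ t)) s)) (by
      filter_upwards [(isOpen_curveDom hγ).mem_nhds ht] with s hs
        using Φ.chartFrame_components_killing hs)
  have h4 := h1.unique h3
  rw [covDiff_apply, ← h4, Φ.chartFrame_components_killing ht, curveForm, sub_add_cancel]

/-- Differentiating `∇_{γ'} Y` once more and inserting the geodesic equation gives `∇²_{γ',γ'} Y`,
which `killing_second` equates with `R(γ', Y) γ'`. -/
theorem deriv_deriv_killing (h : g.IsClosedGeodesic γ) (hY : g.IsTimelikeKilling Y) (t : ℝ) :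
    deriv (deriv (Φ.components fun t ↦ Y (γ t))) t =
      Φ.jacobiOperator t (Φ.components (fun t ↦ Y (γ t)) t) := by
  have := FiniteDimensional.complete ℝ E
  have ht := mem_curveDom_self (E := E) (γ := γ) (t := t)
  set x := γ t with hx
  have hm := curveRep_mem ht
  have hG := g.isMetricOn_chartForm (x := x)
  have hYc := contDiffOn_chartField (x := x) hY.contMDiff
  have hYy := hYc.contDiffAt (hG.isOpen.mem_nhds hm)
  have hB : DifferentiableAt ℝ (covDiff (g.chartForm x) (chartField x Y)) (curveRep γ x t) := by
    have : ContDiffAt ℝ ∞ (covDiff (g.chartForm x) (chartField x Y)) (curveRep γ x t) :=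
      (hYy.fderiv_right (m := ∞) (by simp)).add
        (((ContinuousLinearMap.flipₗᵢ ℝ E E E).contDiff.contDiffAt.comp _
          (hG.contDiffAt_christoffelOp hm)).clm_apply hYy)
    exact this.differentiableAt (by simp)
  have h1 := Φ.hasDerivAt_chartFrame_apply
    ((contDiff_infty_iff_deriv.1 (Φ.contDiff_components_killing hY)).2.differentiable
      (by simp) t).hasDerivAt ht
  have h2 := (hB.hasFDerivAt.comp_hasDerivAt t (hasDerivAt_curveRep hγ ht)).clm_apply
    (h.hasDerivAt_deriv_curveRep t)
  have h3 := h2.congr_of_eventuallyEq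
    (f₁ := fun s ↦ Φ.chartFrame x s (deriv (Φ.components fun t ↦ Y (γ t)) s)) (by
      filter_upwards [(isOpen_curveDom hγ).mem_nhds ht] with s hs
        using Φ.chartFrame_deriv_killing hY hs)
  have h4 := h1.unique h3
  have h5 := hG.killing_second hYc (fun y hy v w ↦ hY.skew hy v w) hm (deriv (curveRep γ x) t)
  have h6 : Φ.chartFrame x t (deriv (deriv (Φ.components fun t ↦ Y (γ t))) t) =
      Φ.chartFrame x t (Φ.jacobiOperator t (Φ.components (fun t ↦ Y (γ t)) t)) := by
    rw [Φ.chartFrame_jacobiOperator ht, hG.jacobiOp_apply hm, Φ.chartFrame_components_killing ht,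
      ← h5, eq_add_of_sub_eq h4, Φ.chartFrame_deriv_killing hY ht, curveForm]
    simp only [Function.comp_apply, map_neg]
    abel
  have := congrArg (fun z ↦ Ring.inverse (Φ.chartFrame x t) z) h6
  have hi : ∀ b, Ring.inverse (Φ.chartFrame x t) (Φ.chartFrame x t b) = b :=
    fun b ↦ DFunLike.congr_fun (Ring.inverse_mul_cancel _ (Φ.isUnit_chartFrame ht)) b
  rwa [hi, hi] at this

theorem isPeriodicField_killing (hp : Function.Periodic γ 1) :
    IsPeriodicField (E := E) (γ := γ) fun t ↦ Y (γ t) := fun t ↦ by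
  have : ∀ p q : M, p = q → (⟨p, Y p⟩ : TangentBundle 𝓘(ℝ, E) M) = ⟨q, Y q⟩ := by
    rintro p q rfl; rfl
  exact this _ _ (hp t)

theorem isPeriodicField_velocity (h : g.IsClosedGeodesic γ) :
    IsPeriodicField (velocity (E := E) γ) := fun t ↦ by
  have hγ := h.contMDiff
  rw [mk_eq_mk_iff (h.periodic t)]
  have ht := mem_curveDom_self (E := E) (γ := γ) (t := t)
  have h1 := curveCoord_velocity hγ ((curveDom_add_one h.periodic).2 ht)
  rw [deriv_curveRep_add_one h.periodic, curveCoord_add_one h.periodic,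
    ← curveCoord_velocity hγ ht] at h1
  exact (curveCoord_self (E := E) (γ := γ) (t := t) (velocity (E := E) γ (t + 1))).symm.trans
    (h1.trans (curveCoord_self (E := E) (velocity (E := E) γ t)))

theorem isJacobi_killing (h : g.IsClosedGeodesic γ) (hY : g.IsTimelikeKilling Y) :
    g.IsJacobi (γ := γ) fun t ↦ Y (γ t) := by
  obtain ⟨Φ⟩ := g.nonempty_parallelFrame h.contMDiff
  rw [← Φ.field_components fun t ↦ Y (γ t), Φ.isJacobi_field]
  exact ⟨Φ.contDiff_components_killing hY, Φ.deriv_deriv_killing h hY⟩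

theorem inner_toFun (t : ℝ) (a : E) (V : FieldAlong (E := E) γ) :
    g.inner (γ t) (Φ.toFun t a) (V t) = g.modelInner (γ 0) a (Φ.components V t) := by
  rw [← Φ.modelInner_toFun t]
  exact congrArg (g.modelInner (γ t) (Φ.toFun t a)) (Φ.toFun_inv t (V t)).symm

/-- The linearized geodesic flow along a closed geodesic, in a parallel frame. -/
noncomputable def twistedSystem (h : g.IsClosedGeodesic γ) (hY : g.IsTimelikeKilling Y) :
    TwistedSystem E where
  G := g.modelInner (γ 0)
  A := Φ.jacobiOperator
  H := Φ.holonomy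
  y := Φ.components fun t ↦ Y (γ t)
  y' := deriv (Φ.components fun t ↦ Y (γ t))
  symm := g.symm (γ 0)
  nondeg a ha := g.eq_zero_of_inner (p := γ 0) a ha
  isometry := Φ.holonomy_isometry h.periodic
  contDiff_A := Φ.contDiff_jacobiOperator
  A_symm := Φ.jacobiOperator_symm
  A_twist := Φ.jacobiOperator_add_one h.periodic
  contDiff_y := Φ.contDiff_components_killing hY
  hasDerivAt_y t := ((Φ.contDiff_components_killing hY).differentiable (by simp) t).hasDerivAt
  hasDerivAt_y' t := by
    rw [← Φ.deriv_deriv_killing h hY]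
    exact ((contDiff_infty_iff_deriv.1 (Φ.contDiff_components_killing hY)).2.differentiable
      (by simp) t).hasDerivAt
  y_twist := (Φ.isPeriodicField_field h.periodic _).1 (by
    rw [Φ.field_components]; exact isPeriodicField_killing h.periodic)
  timelike t := by
    have := hY.timelike (γ t)
    rw [← Φ.inner_toFun]
    exact (congrArg (fun a : E ↦ g.modelInner (γ t) a (Y (γ t))) (Φ.toFun_inv t _)).trans_lt this

variable (h : g.IsClosedGeodesic γ) (hY : g.IsTimelikeKilling Y)

theorem field_mem_loopTangent (v : ℝ → E) :
    Φ.field v ∈ loopTangent γ ↔ v ∈ (Φ.twistedSystem h hY).loops := by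
  rw [loopTangent, mem_ofPred_eq, Φ.isPeriodicField_field h.periodic, Φ.isH1Field_field, and_comm]
  rfl

theorem covDeriv_killing (t : ℝ) : g.covDeriv (fun s ↦ Y (γ s)) t =
    (Φ.toFun t ((Φ.twistedSystem h hY).y' t) : E) := by
  have := Φ.covDeriv_field ((Φ.twistedSystem h hY).hasDerivAt_y t)
  rw [← this]
  congr 1
  exact (Φ.field_components fun s ↦ Y (γ s)).symm

theorem constraint_field {v : ℝ → E} {t : ℝ} (hv : DifferentiableAt ℝ v t) :
    g.inner (γ t) (g.covDeriv (Φ.field v) t) (Y (γ t))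
      - g.inner (γ t) (Φ.field v t) (g.covDeriv (fun s ↦ Y (γ s)) t) =
    (Φ.twistedSystem h hY).G (deriv v t) ((Φ.twistedSystem h hY).y t)
      - (Φ.twistedSystem h hY).G (v t) ((Φ.twistedSystem h hY).y' t) := by
  have e1 : g.inner (γ t) (g.covDeriv (Φ.field v) t) (Y (γ t)) =
      g.modelInner (γ 0) (deriv v t) (Φ.components (fun s ↦ Y (γ s)) t) := by
    rw [← Φ.inner_toFun, Φ.covDeriv_field hv.hasDerivAt]
  have e2 : g.inner (γ t) (Φ.field v t) (g.covDeriv (fun s ↦ Y (γ s)) t) =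
      g.modelInner (γ 0) (v t) ((Φ.twistedSystem h hY).y' t) := by
    rw [← Φ.modelInner_toFun t, Φ.covDeriv_killing h hY]
    rfl
  rw [e1, e2]
  rfl

/-- The two constraint expressions agree wherever the components are differentiable, and for `H¹`
components this is almost everywhere. -/
theorem field_mem_constraintTangent (v : ℝ → E) :
    Φ.field v ∈ g.constraintTangent Y γ ↔ v ∈ (Φ.twistedSystem h hY).constrained := by
  have key : v ∈ (Φ.twistedSystem h hY).loops → ∀ C : ℝ,
      ((∀ᵐ t : ℝ, t ∈ Icc (0 : ℝ) 1 → g.inner (γ t) (g.covDeriv (Φ.field v) t) (Y (γ t))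
        - g.inner (γ t) (Φ.field v t) (g.covDeriv (fun s ↦ Y (γ s)) t) = C) ↔
      ∀ᵐ t : ℝ, t ∈ Icc (0 : ℝ) 1 →
        (Φ.twistedSystem h hY).G (deriv v t) ((Φ.twistedSystem h hY).y t)
          - (Φ.twistedSystem h hY).G (v t) ((Φ.twistedSystem h hY).y' t) = C) := fun hv C ↦ by
    refine eventually_congr ?_
    filter_upwards [IsH1At.ae_differentiableAt hv.1] with t ht
    rw [Φ.constraint_field h hY ht]
  constructor
  · rintro ⟨h1, C, hC⟩
    have h2 := (Φ.field_mem_loopTangent h hY v).1 h1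
    exact ⟨h2, C, (key h2 C).1 hC⟩
  · rintro ⟨h2, C, hC⟩
    exact ⟨(Φ.field_mem_loopTangent h hY v).2 h2, C, (key h2 C).2 hC⟩

theorem indexForm_field {v w : ℝ → E} (hv : ∀ t, IsH1At v t) (hw : ∀ t, IsH1At w t) :
    g.indexForm (Φ.field v) (Φ.field w) = (Φ.twistedSystem h hY).index v w := by
  refine intervalIntegral.integral_congr_ae ?_
  filter_upwards [IsH1At.ae_differentiableAt hv, IsH1At.ae_differentiableAt hw] with t h1 h2 _
  have e1 : g.inner (γ t) (g.covDeriv (Φ.field v) t) (g.covDeriv (Φ.field w) t) =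
      g.modelInner (γ 0) (deriv v t) (deriv w t) := by
    rw [← Φ.modelInner_toFun t, Φ.covDeriv_field h1.hasDerivAt, Φ.covDeriv_field h2.hasDerivAt]
    rfl
  have e2 : g.inner (γ t) (g.curvature (γ t) (velocity γ t) (Φ.field v t) (velocity γ t))
      (Φ.field w t) = g.modelInner (γ 0) (Φ.jacobiOperator t (v t)) (w t) := by
    rw [← Φ.modelInner_toFun t, Φ.curvature_field]
    rfl
  rw [e1, e2]
  rfl

theorem contDiff_of_solves {v v' : ℝ → E}
    (hv : ∀ t, HasDerivAt v (v' t) t ∧ HasDerivAt v' (Φ.jacobiOperator t (v t)) t) :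
    ContDiff ℝ ∞ v := by
  obtain ⟨S, -, hS, -, -, hu⟩ := exists_second_order_flow Φ.contDiff_jacobiOperator
  have h1 : v = fun t ↦ (S t (v 0, v' 0)).1 := funext fun t ↦
    congrArg Prod.fst (hu v v' univ convex_univ (mem_univ _) (fun s _ ↦ hv s) t (mem_univ _))
  rw [h1]
  exact (hS.clm_apply contDiff_const).fst

theorem isJacobi_field_of_solves {v v' : ℝ → E}
    (hv : ∀ t, HasDerivAt v (v' t) t ∧ HasDerivAt v' (Φ.jacobiOperator t (v t)) t) :
    g.IsJacobi (Φ.field v) := by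
  rw [Φ.isJacobi_field]
  refine ⟨Φ.contDiff_of_solves hv, fun t ↦ ?_⟩
  rw [show deriv v = v' from funext fun s ↦ (hv s).1.deriv]
  exact (hv t).2.deriv

theorem solves_of_isJacobi_field {v : ℝ → E} (h : g.IsJacobi (Φ.field v)) (t : ℝ) :
    HasDerivAt v (deriv v t) t ∧ HasDerivAt (deriv v) (Φ.jacobiOperator t (v t)) t := by
  obtain ⟨h1, h2⟩ := (Φ.isJacobi_field v).1 h
  refine ⟨(h1.differentiable (by simp) t).hasDerivAt, ?_⟩
  rw [← h2]
  exact ((contDiff_infty_iff_deriv.1 h1).2.differentiable (by simp) t).hasDerivAt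

end ParallelFrame

/-- The kernel of the Hessian of the action functional on the constraint manifold consists of the
periodic Jacobi fields. -/
theorem IsClosedGeodesic.mem_hessianKernel_iff (h : g.IsClosedGeodesic γ)
    {Y : (x : M) → TangentSpace 𝓘(ℝ, E) x} (hY : g.IsTimelikeKilling Y)
    (V : FieldAlong (E := E) γ) :
    V ∈ g.hessianKernel Y γ ↔ g.IsJacobi V ∧ IsPeriodicField V := by
  obtain ⟨Φ⟩ := g.nonempty_parallelFrame h.contMDiff
  rw [← Φ.field_components V]
  generalize Φ.components V = v
  constructor
  · rintro ⟨h1, h2⟩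
    have h3 := (Φ.field_mem_constraintTangent h hY v).1 h1
    obtain ⟨v', hv'⟩ := (Φ.twistedSystem h hY).solves_of_mem_kernel h3 fun w hw ↦ by
      rw [← Φ.indexForm_field h hY h3.1.1 hw.1.1]
      exact h2 _ ((Φ.field_mem_constraintTangent h hY w).2 hw)
    exact ⟨Φ.isJacobi_field_of_solves hv', h1.1.1⟩
  · rintro ⟨h1, h2⟩
    have hc := ((Φ.isJacobi_field v).1 h1).1
    obtain ⟨h3, h4⟩ := (Φ.twistedSystem h hY).mem_kernel_of_solves
      ((Φ.isPeriodicField_field h.periodic v).1 h2) (Φ.solves_of_isJacobi_field h1)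
      fun t ↦ IsH1At.of_contDiffOn isOpen_univ (mem_univ t) hc.contDiffOn
    refine ⟨(Φ.field_mem_constraintTangent h hY v).2 h3, fun W hW ↦ ?_⟩
    rw [← Φ.field_components W] at hW ⊢
    have hW' := (Φ.field_mem_constraintTangent h hY _).1 hW
    rw [Φ.indexForm_field h hY h3.1.1 hW'.1.1]
    exact h4 _ hW'.1


end LorentzMetric

end Kernel

end StationaryLorentz

namespace StationaryLorentz

/-! ## The linearized Poincaré map and iterates of closed geodesics -/

section Iterates

set_option linter.unusedSectionVars false

open Filter Topology

variable {E : Type*} [NormedAddCommGroup E] [NormedSpace ℝ E]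
  {M : Type*} [TopologicalSpace M] [ChartedSpace E M] [IsManifold 𝓘(ℝ, E) ∞ M]
  [FiniteDimensional ℝ E]

/-- The Jacobi operator is quadratic in the velocity, so passing to the `N`-th iterate multiplies it
by `N²`, matching two time derivatives of `v (N ·)`. -/
theorem jacobiOp_smul (G : E → E →L[ℝ] E →L[ℝ] ℝ) (y u : E) (c : ℝ) :
    jacobiOp G y (c • u) = (c * c) • jacobiOp G y u := by
  ext w
  simp only [jacobiOp, map_smul, add_apply, sub_apply, smul_apply, mul_apply_eq_comp,
    ContinuousLinearMap.flip_apply, smul_add, smul_sub, mul_smul]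

namespace LorentzMetric

variable {g : LorentzMetric E M} {γ : ℝ → M}
  {hγ : ContMDiff 𝓘(ℝ, ℝ) 𝓘(ℝ, E) ∞ γ}

theorem contMDiff_iterate (hγ : ContMDiff 𝓘(ℝ, ℝ) 𝓘(ℝ, E) ∞ γ) (N : ℕ) :
    ContMDiff 𝓘(ℝ, ℝ) 𝓘(ℝ, E) ∞ (iterate γ N) :=
  hγ.comp (contDiff_const.mul contDiff_id).contMDiff

theorem iterate_one (γ : ℝ → M) : iterate γ 1 = γ := by
  funext t
  simp [iterate]

theorem hasDerivAt_comp_mul {F : Type*} [NormedAddCommGroup F] [NormedSpace ℝ F] {f : ℝ → F}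
    {f' : F} {N : ℕ} {t : ℝ} (h : HasDerivAt f f' (N * t)) :
    HasDerivAt (fun s : ℝ ↦ f (N * s)) ((N : ℝ) • f') t := by
  have h1 : HasDerivAt (fun s : ℝ ↦ (N : ℝ) * s) N t := by
    simpa using (hasDerivAt_id t).const_mul (N : ℝ)
  exact h.scomp t h1

theorem deriv_curveRep_iterate (hγ : ContMDiff 𝓘(ℝ, ℝ) 𝓘(ℝ, E) ∞ γ) {N : ℕ} {x : M} {t : ℝ}
    (ht : t ∈ curveDom (E := E) (iterate γ N) x) :
    deriv (curveRep (E := E) (iterate γ N) x) t = (N : ℝ) • deriv (curveRep γ x) (N * t) :=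
  (hasDerivAt_comp_mul (hasDerivAt_curveRep hγ (t := N * t) ht)).deriv

theorem curveForm_iterate (hγ : ContMDiff 𝓘(ℝ, ℝ) 𝓘(ℝ, E) ∞ γ) {N : ℕ} {x : M} {t : ℝ}
    (ht : t ∈ curveDom (E := E) (iterate γ N) x) :
    g.curveForm (iterate γ N) x t = (N : ℝ) • g.curveForm γ x (N * t) := by
  rw [curveForm, deriv_curveRep_iterate hγ ht, map_smul]
  rfl

namespace ParallelFrame

variable (Φ : g.ParallelFrame hγ)

/-- The frame along an iterate. -/
noncomputable def iterate (N : ℕ) : g.ParallelFrame (contMDiff_iterate hγ N) where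
  toFun t := Φ.toFun (N * t)
  zero := by rw [mul_zero, Φ.zero]
  isUnit t := Φ.isUnit _
  isParallelAt t x hx := by
    have h := hasDerivAt_comp_mul (Φ.hasDerivAt_chartFrame (x := x) (t := N * t) hx)
    refine h.congr_deriv ?_
    show _ = -(g.curveForm (StationaryLorentz.iterate γ N) x t) * _
    rw [curveForm_iterate hγ hx, neg_mul, neg_mul, smul_neg, smul_mul_assoc]
    rfl

theorem jacobiOperator_iterate (N : ℕ) (t : ℝ) :
    (Φ.iterate N).jacobiOperator t = ((N : ℝ) * N) • Φ.jacobiOperator (N * t) := by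
  have ht : t ∈ curveDom (E := E) (StationaryLorentz.iterate γ N) (γ (N * t)) := mem_curveDom_self
  rw [(Φ.iterate N).jacobiOperator_eq ht, deriv_curveRep_iterate hγ ht, jacobiOp_smul,
    mul_smul_comm, smul_mul_assoc]
  rfl

/-- `v ↦ v (N ·)` maps solutions of the Jacobi equation along `γ` to solutions along its iterate. -/
theorem solves_iterate {v v' : ℝ → E} {N : ℕ}
    (hv : ∀ t, HasDerivAt v (v' t) t ∧ HasDerivAt v' (Φ.jacobiOperator t (v t)) t) (t : ℝ) :
    HasDerivAt (fun s : ℝ ↦ v (N * s)) ((N : ℝ) • v' (N * t)) t ∧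
      HasDerivAt (fun s : ℝ ↦ (N : ℝ) • v' (N * s))
        ((Φ.iterate N).jacobiOperator t (v (N * t))) t := by
  refine ⟨hasDerivAt_comp_mul (hv _).1, ?_⟩
  refine ((hasDerivAt_comp_mul (hv (N * t)).2).const_smul (N : ℝ)).congr_deriv ?_
  rw [Φ.jacobiOperator_iterate, smul_smul]
  rfl

/-- The flow of the Jacobi equation. -/
noncomputable def flow (t : ℝ) : E × E →L[ℝ] E × E :=
  (exists_second_order_flow Φ.contDiff_jacobiOperator).choose t

theorem flow_zero : Φ.flow 0 = 1 :=
  (exists_second_order_flow Φ.contDiff_jacobiOperator).choose_spec.1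

theorem flow_solves (p : E × E) (t : ℝ) : HasDerivAt (fun s ↦ (Φ.flow s p).1) (Φ.flow t p).2 t ∧
    HasDerivAt (fun s ↦ (Φ.flow s p).2) (Φ.jacobiOperator t (Φ.flow t p).1) t :=
  (exists_second_order_flow Φ.contDiff_jacobiOperator).choose_spec.2.2.2.1 t p

theorem eq_flow {v v' : ℝ → E}
    (hv : ∀ t, HasDerivAt v (v' t) t ∧ HasDerivAt v' (Φ.jacobiOperator t (v t)) t) (t : ℝ) :
    (v t, v' t) = Φ.flow t (v 0, v' 0) :=
  (exists_second_order_flow Φ.contDiff_jacobiOperator).choose_spec.2.2.2.2 v v' univ convex_univ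
    (mem_univ _) (fun s _ ↦ hv s) t (mem_univ _)

/-- The return map of the Jacobi equation, in the frame. -/
noncomputable def returnMap : Module.End ℝ (E × E) :=
  (Φ.toFun 1 : E →ₗ[ℝ] E).prodMap (Φ.toFun 1 : E →ₗ[ℝ] E) ∘ₗ (Φ.flow 1 : E × E →ₗ[ℝ] E × E)

theorem returnMap_apply (p : E × E) :
    Φ.returnMap p = (Φ.toFun 1 (Φ.flow 1 p).1, Φ.toFun 1 (Φ.flow 1 p).2) := rfl

/-- Transporting the solution after one period back by the frame gives a solution of the same
equation, by equivariance of the Jacobi operator; its initial data are the return map. -/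
theorem flow_add_one (hp : Function.Periodic γ 1) (p : E × E) (t : ℝ) :
    Φ.flow t (Φ.returnMap p) = (Φ.toFun 1 (Φ.flow (t + 1) p).1, Φ.toFun 1 (Φ.flow (t + 1) p).2) := by
  have h := Φ.eq_flow (v := fun t ↦ Φ.toFun 1 (Φ.flow (t + 1) p).1)
    (v' := fun t ↦ Φ.toFun 1 (Φ.flow (t + 1) p).2) (fun t ↦ ?_) t
  · rw [h, returnMap_apply, zero_add]
  · have h1 := (Φ.toFun 1).hasFDerivAt.comp_hasDerivAt t
      ((Φ.flow_solves p (t + 1)).1.comp_add_const t 1)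
    have h2 := (Φ.toFun 1).hasFDerivAt.comp_hasDerivAt t
      ((Φ.flow_solves p (t + 1)).2.comp_add_const t 1)
    refine ⟨h1, h2.congr_deriv ?_⟩
    have h3 := Φ.jacobiOperator_add_one hp t (Φ.toFun 1 (Φ.flow (t + 1) p).1)
    have h4 : ∀ a, Φ.holonomy (Φ.toFun 1 a) = a := Φ.inv_toFun 1
    have h5 : ∀ a, Φ.toFun 1 (Φ.holonomy a) = a := Φ.toFun_inv 1
    rw [h4] at h3
    rw [h3, h5]

/-- The Jacobi field along the `N`-th iterate with given initial values along `γ`. -/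
noncomputable def jacobiField (N : ℕ) : E × E →ₗ[ℝ] FieldAlong (E := E) (StationaryLorentz.iterate γ N) where
  toFun p := (Φ.iterate N).field fun t ↦ (Φ.flow (N * t) p).1
  map_add' p q := by
    funext t
    show (Φ.toFun (N * t) (Φ.flow (N * t) (p + q)).1 : E) =
      Φ.toFun (N * t) (Φ.flow (N * t) p).1 + Φ.toFun (N * t) (Φ.flow (N * t) q).1
    simp
  map_smul' c p := by
    funext t
    show (Φ.toFun (N * t) (Φ.flow (N * t) (c • p)).1 : E) =
      c • Φ.toFun (N * t) (Φ.flow (N * t) p).1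
    simp

theorem jacobiField_apply (N : ℕ) (p : E × E) :
    Φ.jacobiField N p = (Φ.iterate N).field fun t ↦ (Φ.flow (N * t) p).1 := rfl

/-- Positions at all times determine the velocity at time `0`, hence the full initial data. -/
theorem eq_of_flow_fst_eq {p q : E × E} (h : ∀ t, (Φ.flow t p).1 = (Φ.flow t q).1) : p = q := by
  have e : ∀ p, Φ.flow 0 p = p := fun p ↦ by rw [Φ.flow_zero]; rfl
  have h1 : (fun t ↦ (Φ.flow t p).1) = fun t ↦ (Φ.flow t q).1 := funext h
  have h2 := (Φ.flow_solves p 0).1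
  rw [h1] at h2
  have h3 := h2.unique (Φ.flow_solves q 0).1
  have h0 := h 0
  rw [e, e] at h0 h3
  exact Prod.ext h0 h3

theorem jacobiField_injective {N : ℕ} (hN : 0 < N) : Function.Injective (Φ.jacobiField N) := by
  intro p q h
  refine Φ.eq_of_flow_fst_eq fun t ↦ ?_
  have h1 := congrArg (Φ.iterate N).components h
  rw [jacobiField_apply, jacobiField_apply, components_field, components_field] at h1
  have h2 := congrFun h1 (t / N)
  have : (N : ℝ) * (t / N) = t := by field_simp
  simpa [this] using h2

theorem isJacobi_jacobiField (N : ℕ) (p : E × E) : g.IsJacobi (Φ.jacobiField N p) :=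
  (Φ.iterate N).isJacobi_field_of_solves (Φ.solves_iterate (Φ.flow_solves p))

theorem exists_eq_jacobiField {N : ℕ} (hN : 0 < N)
    {V : FieldAlong (E := E) (StationaryLorentz.iterate γ N)} (hV : g.IsJacobi V) :
    ∃ p, V = Φ.jacobiField N p := by
  obtain ⟨v, rfl⟩ : ∃ v, V = (Φ.iterate N).field v := ⟨_, ((Φ.iterate N).field_components V).symm⟩
  have h1 := (Φ.iterate N).eq_flow ((Φ.iterate N).solves_of_isJacobi_field hV)
  have hN' : (N : ℝ) ≠ 0 := by positivity
  -- The iterate runs `N` times as fast, so its initial derivative is divided by `N` to obtain data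
  -- along `γ`.
  set p : E × E := (v 0, (N : ℝ)⁻¹ • deriv v 0)
  have h2 := (Φ.iterate N).eq_flow (Φ.solves_iterate (N := N) (Φ.flow_solves p))
  have e : Φ.flow ((N : ℝ) * 0) p = p := by rw [mul_zero, Φ.flow_zero]; rfl
  refine ⟨p, ?_⟩
  rw [jacobiField_apply]
  congr 1
  funext t
  have h3 : (((Φ.flow (N * t) p).1, (N : ℝ) • (Φ.flow (N * t) p).2) : E × E) =
      (Φ.iterate N).flow t ((Φ.flow (N * 0) p).1, (N : ℝ) • (Φ.flow (N * 0) p).2) := h2 t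
  rw [e, show ((N : ℝ) • p.2) = deriv v 0 from smul_inv_smul₀ hN' _] at h3
  exact congrArg Prod.fst ((h1 t).trans h3.symm)

theorem exists_eq_flow {V : FieldAlong (E := E) γ} (hV : g.IsJacobi V) :
    ∃ p, V = Φ.field fun t ↦ (Φ.flow t p).1 := by
  obtain ⟨v, rfl⟩ : ∃ v, V = Φ.field v := ⟨_, (Φ.field_components V).symm⟩
  refine ⟨(v 0, deriv v 0), ?_⟩
  congr 1
  funext t
  exact congrArg Prod.fst (Φ.eq_flow (Φ.solves_of_isJacobi_field hV) t)

theorem flow_add_natCast (hp : Function.Periodic γ 1) (N : ℕ) (p : E × E) (t : ℝ) :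
    Φ.toFun (t + N) (Φ.flow (t + N) p).1 = Φ.toFun t (Φ.flow t ((Φ.returnMap ^ N) p)).1 := by
  induction N generalizing p with
  | zero => simp
  | succ N ih =>
    have h1 := ih (Φ.returnMap p)
    rw [pow_succ]
    refine Eq.trans ?_ h1
    rw [Φ.flow_add_one hp, Nat.cast_succ, ← add_assoc, Φ.toFun_add_one hp]
    rfl

/-- One period of the iterate is `N` periods of `γ`, so periodicity says that the data `P ^ N p` and
`p` give the same positions at all times; these determine the data. -/
theorem isPeriodicField_jacobiField (hp : Function.Periodic γ 1) {N : ℕ} (hN : 0 < N)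
    (p : E × E) : IsPeriodicField (Φ.jacobiField N p) ↔ (Φ.returnMap ^ N) p = p := by
  have hN' : (N : ℝ) ≠ 0 := by positivity
  have key (t : ℝ) : ((⟨StationaryLorentz.iterate γ N (t + 1), Φ.jacobiField N p (t + 1)⟩ :
      TangentBundle 𝓘(ℝ, E) M) = ⟨StationaryLorentz.iterate γ N t, Φ.jacobiField N p t⟩) ↔
      (Φ.flow (N * t) ((Φ.returnMap ^ N) p)).1 = (Φ.flow (N * t) p).1 := by
    have e : (N : ℝ) * (t + 1) = N * t + N := by ring
    have hq : StationaryLorentz.iterate γ N (t + 1) = StationaryLorentz.iterate γ N t := by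
      rw [StationaryLorentz.iterate, StationaryLorentz.iterate, e]
      simpa using hp.nat_mul N (N * t)
    rw [mk_eq_mk_iff hq]
    have h1 : (Φ.jacobiField N p (t + 1) : E) =
        Φ.toFun (N * t) (Φ.flow (N * t) ((Φ.returnMap ^ N) p)).1 := by
      rw [← Φ.flow_add_natCast hp, ← e]
      rfl
    have h2 : (Φ.jacobiField N p t : E) = Φ.toFun (N * t) (Φ.flow (N * t) p).1 := rfl
    constructor
    · intro h
      have h3 := congrArg (Φ.inv (N * t)) (h1.symm.trans (h.trans h2))
      rwa [inv_toFun, inv_toFun] at h3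
    · intro h
      exact h1.trans ((congrArg (Φ.toFun (N * t)) h).trans h2.symm)
  constructor
  · intro h
    refine Φ.eq_of_flow_fst_eq fun t ↦ ?_
    have := (key (t / N)).1 (h _)
    rwa [mul_div_cancel₀ _ hN'] at this
  · intro h t
    rw [key, h]

end ParallelFrame

end LorentzMetric

end Iterates

end StationaryLorentz

namespace StationaryLorentz

/-! ## Nondegeneracy and nullity in terms of the return map -/

section ReturnMap

set_option linter.unusedSectionVars false

open Filter Topology

variable {E : Type*} [NormedAddCommGroup E] [NormedSpace ℝ E]
  {M : Type*} [TopologicalSpace M] [ChartedSpace E M] [IsManifold 𝓘(ℝ, E) ∞ M]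
  [FiniteDimensional ℝ E]

theorem one_mem_complexSpectrum {V : Type*} [AddCommGroup V] [Module ℝ V]
    [FiniteDimensional ℝ V] {P : Module.End ℝ V} {x : V} (hx : P x = x) (h0 : x ≠ 0) :
    (1 : ℂ) ∈ complexSpectrum P := by
  rw [mem_complexSpectrum_iff]
  have h1 : P.charpoly.IsRoot 1 := by
    rw [← Module.End.hasEigenvalue_iff_isRoot_charpoly]
    exact Module.End.hasEigenvalue_of_hasEigenvector
      (Module.End.hasEigenvector_iff.2 ⟨Module.End.mem_eigenspace_iff.2 (by simpa using hx), h0⟩)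
  simpa using h1.map (f := algebraMap ℝ ℂ)

namespace LorentzMetric

variable {g : LorentzMetric E M} {γ : ℝ → M} {Y : (x : M) → TangentSpace 𝓘(ℝ, E) x}

theorem velocity_iterate (hγ : ContMDiff 𝓘(ℝ, ℝ) 𝓘(ℝ, E) ∞ γ) (N : ℕ) (t : ℝ) :
    (velocity (E := E) (iterate γ N) t : E) = (N : ℝ) • (velocity (E := E) γ (N * t) : E) := by
  have ht : t ∈ curveDom (E := E) (iterate γ N) (γ (N * t)) := mem_curveDom_self
  have h1 := curveCoord_velocity (contMDiff_iterate hγ N) ht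
  rw [deriv_curveRep_iterate hγ ht, ← curveCoord_velocity hγ (mem_curveDom_self)] at h1
  have h2 := (curveCoord_self (E := E) (γ := iterate γ N) (t := t)
      (velocity (E := E) (iterate γ N) t)).symm.trans h1
  exact h2.trans <| congrArg (fun a : E ↦ (N : ℝ) • a)
    (curveCoord_self (E := E) (γ := γ) (t := N * t) (velocity (E := E) γ (N * t)))

theorem IsClosedGeodesic.iterate (h : g.IsClosedGeodesic γ) (N : ℕ) :
    g.IsClosedGeodesic (iterate γ N) := by
  refine ⟨contMDiff_iterate h.contMDiff N, fun t ↦ ?_, fun t ↦ ?_⟩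
  · rw [StationaryLorentz.iterate, StationaryLorentz.iterate, mul_add, mul_one]
    simpa using h.periodic.nat_mul N (N * t)
  · obtain ⟨Φ⟩ := g.nonempty_parallelFrame h.contMDiff
    have h1 : velocity (E := E) (StationaryLorentz.iterate γ N) =
        (Φ.iterate N).field fun t ↦ (N : ℝ) • Φ.components (velocity γ) (N * t) := by
      funext t
      refine (velocity_iterate h.contMDiff N t).trans ?_
      have h2 : (velocity (E := E) γ (N * t) : E) =
        Φ.toFun (N * t) (Φ.components (velocity γ) (N * t)) := (Φ.toFun_inv _ _).symm
      exact (congrArg (fun a : E ↦ (N : ℝ) • a) h2).trans (map_smul (Φ.toFun (N * t)) _ _).symm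
    have h3 := (hasDerivAt_comp_mul (Φ.deriv_components_velocity h (N * t))).const_smul (N : ℝ)
    have h4 := (Φ.iterate N).covDeriv_field h3
    rw [h1]
    have h5 : (Φ.iterate N).toFun t ((N : ℝ) • (N : ℝ) • (0 : E)) = 0 := by
      rw [smul_zero, smul_zero, map_zero]
    exact h4.trans h5

variable (g) in
-- Nondegeneracy of the metric identifies tangent and cotangent vectors; through this identification
-- the return map on `E × E` becomes the Poincaré map.
theorem exists_phaseEquiv (x : M) : ∃ e : (E × E) ≃ₗ[ℝ] PhaseSpace (E := E) x,
    ∀ a b : TangentSpace 𝓘(ℝ, E) x, e (a, b) = (a, g.inner x b) := by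
  obtain ⟨f, hf⟩ := ContinuousLinearMap.isInvertible_of_injective_dual (G := g.modelInner x)
    ((injective_iff_map_eq_zero _).2 fun v hv ↦
      g.eq_zero_of_inner (p := x) v fun w ↦ congrArg (fun l : E →L[ℝ] ℝ ↦ l w) hv)
  refine ⟨((LinearEquiv.refl ℝ E).prodCongr f.toLinearEquiv : (E × E) ≃ₗ[ℝ] E × (E →L[ℝ] ℝ)),
    fun a b ↦ ?_⟩
  exact Prod.ext rfl (congrArg (fun l : E →L[ℝ] E →L[ℝ] ℝ ↦ l b) hf)

namespace ParallelFrame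

variable {hγ : ContMDiff 𝓘(ℝ, ℝ) 𝓘(ℝ, E) ∞ γ} (Φ : g.ParallelFrame hγ)

/-- Kernel elements are the periodic Jacobi fields, Jacobi fields along the iterate are parametrized
by data along `γ`, and periodicity is a fixed point equation for the `N`-th power of the return map.
-/
theorem hessianKernel_iterate (h : g.IsClosedGeodesic γ) (hY : g.IsTimelikeKilling Y) {N : ℕ}
    (hN : 0 < N) : g.hessianKernel Y (StationaryLorentz.iterate γ N) =
      (Submodule.map (Φ.jacobiField N) (LinearMap.ker (Φ.returnMap ^ N - 1)) :
        Submodule ℝ (FieldAlong (E := E) (StationaryLorentz.iterate γ N))) := by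
  ext V
  rw [(h.iterate N).mem_hessianKernel_iff hY, SetLike.mem_coe, Submodule.mem_map]
  constructor
  · rintro ⟨h1, h2⟩
    obtain ⟨p, rfl⟩ := Φ.exists_eq_jacobiField hN h1
    rw [Φ.isPeriodicField_jacobiField h.periodic hN] at h2
    exact ⟨p, by simp [h2], rfl⟩
  · rintro ⟨p, hp, rfl⟩
    refine ⟨Φ.isJacobi_jacobiField N p, ?_⟩
    rw [Φ.isPeriodicField_jacobiField h.periodic hN]
    simpa [sub_eq_zero] using hp

theorem nullity_iterate (h : g.IsClosedGeodesic γ) (hY : g.IsTimelikeKilling Y) {N : ℕ}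
    (hN : 0 < N) : g.nullity Y (StationaryLorentz.iterate γ N) =
      Module.rank ℝ (LinearMap.ker (Φ.returnMap ^ N - 1)) := by
  rw [nullity, Φ.hessianKernel_iterate h hY hN, Submodule.span_eq]
  exact (Submodule.equivMapOfInjective _ (Φ.jacobiField_injective hN) _).rank_eq.symm

/-- The kernel of the Hessian is spanned by the velocity and the Killing field, in terms of their
initial values. -/
theorem isNondegenerateCriticalOrbit_iterate_iff (h : g.IsClosedGeodesic γ)
    (hY : g.IsTimelikeKilling Y) {p q : E × E} (hp : velocity γ = Φ.field fun t ↦ (Φ.flow t p).1)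
    (hq : (fun t ↦ Y (γ t)) = Φ.field fun t ↦ (Φ.flow t q).1) {N : ℕ} (hN : 0 < N) :
    g.IsNondegenerateCriticalOrbit Y (StationaryLorentz.iterate γ N) ↔
      LinearMap.ker (Φ.returnMap ^ N - 1) = Submodule.span ℝ {p, q} := by
  have hN' : IsUnit (N : ℝ) := (Nat.cast_ne_zero.2 hN.ne').isUnit
  have h1 : velocity (E := E) (StationaryLorentz.iterate γ N) =
      (N : ℝ) • Φ.jacobiField N p := by
    funext t
    exact (velocity_iterate hγ N t).trans (congrArg (fun V ↦ (N : ℝ) • (V (N * t) : E)) hp)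
  have h2 : (fun t ↦ Y (StationaryLorentz.iterate γ N t)) = Φ.jacobiField N q := by
    funext t
    exact congrFun hq (N * t)
  have h3 : Submodule.span ℝ {velocity (E := E) (StationaryLorentz.iterate γ N),
      fun t ↦ Y (StationaryLorentz.iterate γ N t)} =
      Submodule.map (Φ.jacobiField N) (Submodule.span ℝ {p, q}) := by
    rw [h1, h2, Submodule.map_span, image_pair, Submodule.span_insert, Submodule.span_insert,
      Submodule.span_singleton_smul_eq hN']
  have h4 : g.IsNondegenerateCriticalOrbit Y (StationaryLorentz.iterate γ N) ↔
      g.hessianKernel Y (StationaryLorentz.iterate γ N) =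
        (Submodule.span ℝ {velocity (E := E) (StationaryLorentz.iterate γ N),
          fun t ↦ Y (StationaryLorentz.iterate γ N t)} : Submodule ℝ (FieldAlong _)) :=
    ⟨fun h ↦ h.kernel_eq, fun h5 ↦ ⟨h.iterate N, h5⟩⟩
  rw [h4, Φ.hessianKernel_iterate h hY hN, h3, SetLike.coe_set_eq]
  exact (Submodule.map_injective_of_injective (Φ.jacobiField_injective hN)).eq_iff

theorem returnMap_eq_of_isPeriodicField (hp : Function.Periodic γ 1) {p : E × E}
    (h : IsPeriodicField (Φ.field fun t ↦ (Φ.flow t p).1)) : Φ.returnMap p = p := by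
  have h1 (s : ℝ) : (⟨StationaryLorentz.iterate γ 1 s, Φ.jacobiField 1 p s⟩ :
      TangentBundle 𝓘(ℝ, E) M) = ⟨γ s, Φ.field (fun t ↦ (Φ.flow t p).1) s⟩ := by
    refine (mk_eq_mk_iff (by rw [iterate_one]) _ _).2 ?_
    show Φ.toFun ((1 : ℕ) * s) (Φ.flow ((1 : ℕ) * s) p).1 = Φ.toFun s (Φ.flow s p).1
    rw [Nat.cast_one, one_mul]
  simpa using (Φ.isPeriodicField_jacobiField hp one_pos p).1 fun t ↦
    (h1 (t + 1)).trans ((h t).trans (h1 t).symm)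

/-- Nondegeneracy of the iterates in terms of the spectrum of the return map. -/
theorem isNondegenerateCriticalOrbit_iterate_iff_spectrum (h : g.IsClosedGeodesic γ)
    (hY : g.IsTimelikeKilling Y) {N : ℕ} (hN : 0 < N) :
    g.IsNondegenerateCriticalOrbit Y (StationaryLorentz.iterate γ N) ↔
      g.IsNondegenerateCriticalOrbit Y γ ∧
        ∀ z ∈ complexSpectrum Φ.returnMap \ {1}, z ^ N ≠ 1 := by
  obtain ⟨p, hp⟩ := Φ.exists_eq_flow (isJacobi_velocity h)
  obtain ⟨q, hq⟩ := Φ.exists_eq_flow (isJacobi_killing h hY)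
  have h1 := Φ.isNondegenerateCriticalOrbit_iterate_iff h hY hp hq one_pos
  rw [iterate_one] at h1
  rw [h1, Φ.isNondegenerateCriticalOrbit_iterate_iff h hY hp hq hN]
  have hmono := ker_pow_sub_one_mono Φ.returnMap (one_dvd N)
  -- The velocity and the Killing field are periodic Jacobi fields of `γ` itself. If their span is
  -- all of `ker (P ^ N - 1)`, the intermediate `ker (P - 1)` is squeezed between them.
  have hle : Submodule.span ℝ {p, q} ≤ LinearMap.ker (Φ.returnMap ^ 1 - 1) := by
    have hp' := Φ.returnMap_eq_of_isPeriodicField h.periodic (hp ▸ isPeriodicField_velocity h)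
    have hq' := Φ.returnMap_eq_of_isPeriodicField h.periodic
      (hq ▸ isPeriodicField_killing (Y := Y) h.periodic)
    rw [Submodule.span_le, pair_subset_iff]
    simp [hp', hq']
  constructor
  · intro h2
    have h3 : LinearMap.ker (Φ.returnMap ^ 1 - 1) = Submodule.span ℝ {p, q} :=
      le_antisymm (hmono.trans h2.le) hle
    refine ⟨h3, fun z hz hzN ↦ hz.2 (eq_one_of_mem_complexSpectrum Φ.returnMap ?_ hz.1 hzN)⟩
    rw [pow_one] at h3
    exact (h2.trans h3.symm).le
  · rintro ⟨h2, h3⟩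
    rw [← h2]
    refine ker_pow_sub_one_eq _ hN (one_dvd N) fun z hz hzN ↦ ?_
    by_contra h4
    exact h3 z ⟨hz, fun h5 ↦ h4 (by rw [h5, pow_one])⟩ hzN

theorem field_flow_initial (p : E × E) :
    (Φ.field (fun t ↦ (Φ.flow t p).1) 0 : E) = p.1 ∧
      (g.covDeriv (Φ.field fun t ↦ (Φ.flow t p).1) 0 : E) = p.2 := by
  have e : Φ.flow 0 p = p := by rw [Φ.flow_zero]; rfl
  refine ⟨?_, (Φ.covDeriv_field (Φ.flow_solves p 0).1).trans ?_⟩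
  · show Φ.toFun 0 (Φ.flow 0 p).1 = p.1
    rw [e, Φ.zero]
    rfl
  · rw [e, Φ.zero]
    rfl

/-- Every element of the phase space is the initial value of some Jacobi field, so the defining
relation prescribes the map everywhere; this yields existence and uniqueness together. -/
theorem isPoincareMap_iff (h : g.IsClosedGeodesic γ) {e : (E × E) ≃ₗ[ℝ] PhaseSpace (E := E) (γ 0)}
    (he : ∀ a b : TangentSpace 𝓘(ℝ, E) (γ 0), e (a, b) = (a, g.inner (γ 0) b))
    (P : PhaseSpace (E := E) (γ 0) →ₗ[ℝ] PhaseSpace (E := E) (γ 0)) :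
    g.IsPoincareMap γ P ↔ P = e.conj Φ.returnMap := by
  have h01 : γ 0 = γ 1 := by simpa using (h.periodic 0).symm
  have key (p : E × E) : e p = ((Φ.field (fun t ↦ (Φ.flow t p).1) 0 : TangentSpace 𝓘(ℝ, E) (γ 0)),
      g.inner (γ 0) (g.covDeriv (Φ.field fun t ↦ (Φ.flow t p).1) 0)) := by
    rw [← he]
    exact congrArg e (Prod.ext (Φ.field_flow_initial p).1.symm (Φ.field_flow_initial p).2.symm)
  have key' (p : E × E) : (Φ.field (fun t ↦ (Φ.flow t p).1) 1 : E) = (Φ.returnMap p).1 ∧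
      (g.covDeriv (Φ.field fun t ↦ (Φ.flow t p).1) 1 : E) = (Φ.returnMap p).2 :=
    ⟨rfl, Φ.covDeriv_field (Φ.flow_solves p 1).1⟩
  constructor
  · intro hP
    refine LinearMap.ext fun x ↦ ?_
    obtain ⟨p, rfl⟩ := e.surjective x
    rw [LinearEquiv.conj_apply_apply, e.symm_apply_apply]
    have h1 := hP (Φ.field fun t ↦ (Φ.flow t p).1) (Φ.isJacobi_field_of_solves (Φ.flow_solves p))
      (Φ.returnMap p).1 (Φ.returnMap p).2 ((mk_eq_mk_iff h01 _ _).2 (key' p).1.symm)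
      ((mk_eq_mk_iff h01 _ _).2 (key' p).2.symm)
    rw [key]
    exact h1.trans (he _ _).symm
  · rintro rfl J hJ u w hu hw
    obtain ⟨p, rfl⟩ := Φ.exists_eq_flow hJ
    have hu' := ((mk_eq_mk_iff h01 _ _).1 hu).trans (key' p).1
    have hw' := ((mk_eq_mk_iff h01 _ _).1 hw).trans (key' p).2
    rw [← key, LinearEquiv.conj_apply_apply, e.symm_apply_apply, ← he]
    exact congrArg e (Prod.ext hu'.symm hw'.symm)

end ParallelFrame

theorem IsClosedGeodesic.exists_nullity_partition (h : g.IsClosedGeodesic γ) (hY : g.IsTimelikeKilling Y) :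
    ∃ (s : ℕ) (m : Fin s → ℕ) (q : Fin s → ℕ → ℕ),
      s ≤ 2 ^ Module.finrank ℝ E ∧
      (∀ j, 0 < m j) ∧ (∀ j i, 0 < q j i) ∧ (∀ j, StrictMono (q j)) ∧
      (∀ k : ℕ, 0 < k → ∃! j, k ∈ range (fun i ↦ m j * q j i)) ∧
      ∀ j i, g.nullity Y (StationaryLorentz.iterate γ (m j * q j i)) =
        g.nullity Y (StationaryLorentz.iterate γ (m j)) := by
  obtain ⟨Φ⟩ := g.nonempty_parallelFrame h.contMDiff
  -- The initial data of the Killing field are fixed by the return map, and they are nonzero because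
  -- `Y` is timelike.
  have h1 : (1 : ℂ) ∈ complexSpectrum Φ.returnMap := by
    obtain ⟨p, hp⟩ := Φ.exists_eq_flow (ParallelFrame.isJacobi_killing h hY)
    refine one_mem_complexSpectrum (Φ.returnMap_eq_of_isPeriodicField h.periodic
      (hp ▸ ParallelFrame.isPeriodicField_killing (Y := Y) h.periodic)) ?_
    rintro rfl
    have h2 : (Y (γ 0) : E) = 0 := (congrFun hp 0).trans (Φ.field_flow_initial 0).1
    have h3 := hY.timelike (γ 0)
    have h4 : g.modelInner (γ 0) (Y (γ 0)) (Y (γ 0)) = 0 :=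
      (congrArg (fun a : E ↦ g.modelInner (γ 0) a (Y (γ 0))) h2).trans
        (congrArg (fun l : E →L[ℝ] ℝ ↦ l (Y (γ 0))) (map_zero (g.modelInner (γ 0))))
    exact h3.ne h4
  obtain ⟨s, m, q, hs, hm, hq, hmono, hpart, hdvd⟩ := exists_divisibility_partition
    (unityOrders Φ.returnMap) fun d hd ↦
      two_pos.trans_le ((mem_unityOrders Φ.returnMap).1 hd).2
  refine ⟨s, m, q, hs.trans (Nat.pow_le_pow_right two_pos ?_), hm, hq, hmono, hpart, fun j i ↦ ?_⟩
  -- The phase space has dimension `2 dim M`, so there are at most `dim M` nontrivial orders.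
  · have := two_mul_card_unityOrders_le Φ.returnMap h1
    rw [Module.finrank_prod] at this
    omega
  · have hk := Nat.mul_pos (hm j) (hq j i)
    rw [Φ.nullity_iterate h hY hk, Φ.nullity_iterate h hY (hm j),
      ker_pow_sub_one_eq_of_orders Φ.returnMap hk (dvd_mul_right _ _) (hdvd j i)]

end LorentzMetric

theorem complexSpectrum_conj {V W : Type*} [AddCommGroup V] [Module ℝ V] [FiniteDimensional ℝ V]
    [AddCommGroup W] [Module ℝ W] (e : V ≃ₗ[ℝ] W) (P : Module.End ℝ V) :
    complexSpectrum (e.conj P) = complexSpectrum P := by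
  have := e.finiteDimensional
  ext z
  rw [mem_complexSpectrum_iff, mem_complexSpectrum_iff, LinearEquiv.charpoly_conj]

end ReturnMap

end StationaryLorentz

theorem mainTheorem12
    {E : Type*} [NormedAddCommGroup E] [NormedSpace ℝ E] [FiniteDimensional ℝ E]
    {M : Type*} [TopologicalSpace M] [T2Space M] [SecondCountableTopology M]
    [ChartedSpace E M] [IsManifold 𝓘(ℝ, E) ∞ M]
    (g : StationaryLorentz.LorentzMetric E M)
    (Y : (x : M) → TangentSpace 𝓘(ℝ, E) x) (hY : g.IsTimelikeKilling Y)
    (γ : ℝ → M) (hγ : g.IsClosedGeodesic γ) :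
    -- the linearized Poincaré map is well defined, and
    (∃ P : StationaryLorentz.LorentzMetric.PhaseSpace (E := E) (γ 0) →ₗ[ℝ]
        StationaryLorentz.LorentzMetric.PhaseSpace (E := E) (γ 0),
      g.IsPoincareMap γ P ∧ (∀ P', g.IsPoincareMap γ P' → P' = P) ∧
      ∀ N : ℕ, 1 ≤ N →
        (g.IsNondegenerateCriticalOrbit Y (StationaryLorentz.iterate γ N) ↔
          g.IsNondegenerateCriticalOrbit Y γ ∧
            ∀ z ∈ StationaryLorentz.complexSpectrum P \ {1}, z ^ N ≠ 1)) ∧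
    -- the nullities of the iterates
    ∃ (s : ℕ) (m : Fin s → ℕ) (q : Fin s → ℕ → ℕ),
      s ≤ 2 ^ Module.finrank ℝ E ∧
      (∀ j, 0 < m j) ∧ (∀ j i, 0 < q j i) ∧ (∀ j, StrictMono (q j)) ∧
      (∀ k : ℕ, 0 < k → ∃! j, k ∈ range (fun i ↦ m j * q j i)) ∧
      ∀ j i, g.nullity Y (StationaryLorentz.iterate γ (m j * q j i)) =
        g.nullity Y (StationaryLorentz.iterate γ (m j)) := by
  obtain ⟨Φ⟩ := g.nonempty_parallelFrame hγ.contMDiff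
  obtain ⟨e, he⟩ := g.exists_phaseEquiv (γ 0)
  refine ⟨⟨e.conj Φ.returnMap, (Φ.isPoincareMap_iff hγ he _).2 rfl,
    fun P' hP' ↦ (Φ.isPoincareMap_iff hγ he P').1 hP', fun N hN ↦ ?_⟩,
    hγ.exists_nullity_partition hY⟩
  rw [StationaryLorentz.complexSpectrum_conj]
  exact Φ.isNondegenerateCriticalOrbit_iterate_iff_spectrum hγ hY hN
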